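/- Let $p>0$ and $\beta\in\mathbb R$, put $Q(x)=1+|x|^{4p}$ for $x\in\mathbb R^4$, and let $|\mathbb S^4|$ denote the volume of the standard unit $4$-sphere. Call $u$ a normal solution with total curvature $\beta$ if $Qe^{4u}\in L^1(\mathbb R^4)$, $$u(x)=\frac{2}{3!\,|\mathbb S^4|}\int_{\mathbb R^4}\log\frac{|y|}{|x-y|}\,\bigl(1+|y|^{4p}\bigr)e^{4u(y)}\,dy+C\qquad\text{for all }x\in\mathbb R^4$$ with some constant $C\in\mathbb R$, and $$\frac{2}{3!\,|\mathbb S^4|}\int_{\mathbb R^4}\bigl(1+|x|^{4p}\bigr)e^{4u(x)}\,dx=\beta .$$ Then there exists a normal solution $u:\mathbb R^4\to\mathbb R$ with total curvature $\beta$ that is radially symmetric about the origin, of class $C^4$, and of class $C^\infty$ whenever $Q$ is of class $C^\infty$, if and only if $$\max\{2,2p\}<\beta<2+2p .$$ -/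

import Mathlib

open MeasureTheory
open scoped ContDiff

noncomputable section

/-- The volume `|𝕊ⁿ|` of the standard unit `n`-sphere in `ℝⁿ⁺¹`. -/
def sphereVolume (n : ℕ) : ℝ :=
  ((volume : Measure (EuclideanSpace ℝ (Fin (n + 1)))).toSphere).real Set.univ

/-- The normalising constant `2 / ((n-1)! |𝕊ⁿ|)`, used for `n ≥ 1`. -/
def normalConst (n : ℕ) : ℝ :=
  2 / ((Nat.factorial (n - 1) : ℝ) * sphereVolume n)

/-- The curvature function `Q(x) = 1 + |x|^{np}` on `ℝⁿ`. -/
def powerCurvature (n : ℕ) (p : ℝ) (x : EuclideanSpace ℝ (Fin n)) : ℝ :=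
  1 + ‖x‖ ^ ((n : ℝ) * p)

/-- `u` is a normal solution with curvature function `Q`: `Q e^{nu}` is integrable on `ℝⁿ` and, for
some constant `C` and every `x`,
`u(x) = 2 / ((n-1)! |𝕊ⁿ|) ∫ log (|y| / |x - y|) Q(y) e^{n u(y)} dy + C`.
(For continuous `Q` and `u` the integrand is automatically integrable for every `x`, because
the kernel tends to `0` as `|y| → ∞` and its singularities are logarithmic.) -/
def IsNormalSolution (n : ℕ) (Q u : EuclideanSpace ℝ (Fin n) → ℝ) : Prop :=
  Integrable (fun y => Q y * Real.exp (n * u y)) ∧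
    ∃ C : ℝ, ∀ x, u x =
      normalConst n *
        (∫ y, Real.log (‖y‖ / ‖x - y‖) * (Q y * Real.exp (n * u y))) + C

/-- The normalised total curvature `2 / ((n-1)! |𝕊ⁿ|) ∫ Q e^{nu} dx`. -/
def totalCurvature (n : ℕ) (Q u : EuclideanSpace ℝ (Fin n) → ℝ) : ℝ :=
  normalConst n * ∫ x, Q x * Real.exp (n * u x)

/-- Radial symmetry about the origin. -/
def IsRadial {n : ℕ} (u : EuclideanSpace ℝ (Fin n) → ℝ) : Prop :=
  ∀ x y, ‖x‖ = ‖y‖ → u x = u y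

end

/-! For radial `u` the logarithmic kernel may be averaged over spheres. On ℝ⁴ the mean of log|x-y| -
log|y| over |y| = s is the explicit function `logKernel (|x|/s)`, so the equation becomes U(r) = C -
∫ logKernel(r/s) a(s) ds with a one-dimensional density a ≥ 0 of integral β. All dimensional
constants are absorbed into a; of |𝕊⁴| only positivity matters.

Necessity. The logarithmic derivative k of the kernel satisfies k(t) + k(1/t) = 1. Let x and y be
the masses of the parts of the density coming from 1 and from |x|^{4p}, so x + y = β. Pohozaev's
identity for each part separately (`pohozaev_head`, `pohozaev_tail`) gives x = x²/2 + A and (1+p)y =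
B + y²/2 with A, B > 0 and A + B = xy. Adding, x + (1+p)y = β²/2, that is 2py = β(β-2) and 2px =
β(2+2p-β), hence 2 < β < 2+2p. The first identity alone gives x < 2, and (β-2)(β-2p) = 2p(2-x) then
gives β > 2p.

Existence. Splitting `logKernel` into t²/4 minus a kernel supported in t > 1 turns the integral
equation into a Volterra equation with one parameter b, solved by monotone iteration. Its solution
is a normal solution exactly when a moment of the density equals -b; this shooting problem has a
unique solution (`exists_volterraMoment_eq`, `volterraMoment_unique`). Apply it to the curvatures
(1-τ) + τ|x|^{4p}, τ ∈ [0,1]: the solutions depend continuously on τ, while Fatou's lemma makes the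
two masses lower semicontinuous. The sublevel sets of the masses at the values x, y belonging to β
are thus closed; by the Pohozaev relation they cover [0,1], and each contains an endpoint.
Connectedness gives a common point, where the total mass is β (`exists_isRadialNormal_family`). A
dilation and an additive constant then equalise the two coefficients.

Regularity. A radial function is smooth at the origin when its profile is a polynomial in r² up to a
remainder with vanishing derivatives (`contDiff_of_isFlat_sub`). Inverting the radial bilaplacian
raises the order of the remainder by four, which gives C⁴ at once and C^∞ by iteration. -/

/-! ### The spherically averaged logarithmic kernel and its derivative. -/

section Kernel

open Set Filter Topology

/-- The spherical mean of `log |x - y| - log |y|` over `|y| = s` in `ℝ⁴`, as a function of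
`t = |x| / s`. -/
noncomputable def logKernel (t : ℝ) : ℝ :=
  if t ≤ 1 then t ^ 2 / 4 else Real.log t + (t ^ 2)⁻¹ / 4

/-- The logarithmic derivative `t * logKernel' t`. -/
noncomputable def fluxKernel (t : ℝ) : ℝ :=
  if t ≤ 1 then t ^ 2 / 2 else 1 - (t ^ 2)⁻¹ / 2

/-- The kernel of the Volterra operator inverting the radial bilaplacian. -/
noncomputable def volterraKernel (t : ℝ) : ℝ :=
  if t ≤ 1 then 0 else (t ^ 2 - (t ^ 2)⁻¹) / 4 - Real.log t

/-- For t = r/s the second term vanishes when s ≥ r, and the first contributes only a multiple of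
r². This splitting makes the integral equation a Volterra equation with one free quadratic
coefficient. -/
lemma logKernel_eq (t : ℝ) : logKernel t = t ^ 2 / 4 - volterraKernel t := by
  unfold logKernel volterraKernel; split_ifs <;> ring

lemma continuous_volterraKernel : Continuous volterraKernel := by
  have h : volterraKernel =
      fun t => (fun u : ℝ => (u ^ 2 - (u ^ 2)⁻¹) / 4 - Real.log u) (max t 1) := by
    ext t
    unfold volterraKernel
    split_ifs with ht
    · simp [max_eq_right ht]
    · simp [max_eq_left (not_le.1 ht).le]
  rw [h]
  have hpos : ∀ t : ℝ, max t 1 ≠ 0 := fun t => (lt_of_lt_of_le one_pos (le_max_right t 1)).ne'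
  have hc : Continuous fun t : ℝ => max t 1 := continuous_id.max continuous_const
  exact (((hc.pow 2).sub ((hc.pow 2).inv₀ fun t => pow_ne_zero 2 (hpos t))).div_const 4).sub
    (hc.log hpos)

lemma continuous_logKernel : Continuous logKernel := by
  rw [show logKernel = fun t => t ^ 2 / 4 - volterraKernel t from funext logKernel_eq]
  exact ((continuous_pow 2).div_const 4).sub continuous_volterraKernel

lemma continuous_fluxKernel : Continuous fluxKernel := by
  have h : fluxKernel = fun t => t ^ 2 / 2 - (max t 1 ^ 2 / 2 - (1 - (max t 1 ^ 2)⁻¹ / 2)) := by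
    ext t
    unfold fluxKernel
    split_ifs with ht
    · rw [max_eq_right ht]; norm_num
    · rw [max_eq_left (not_le.1 ht).le]; ring
  rw [h]
  have hpos : ∀ t : ℝ, max t 1 ≠ 0 := fun t => (lt_of_lt_of_le one_pos (le_max_right t 1)).ne'
  have hc : Continuous fun t : ℝ => max t 1 := continuous_id.max continuous_const
  exact ((continuous_pow 2).div_const 2).sub (((hc.pow 2).div_const 2).sub
    (continuous_const.sub (((hc.pow 2).inv₀ fun t => pow_ne_zero 2 (hpos t)).div_const 2)))

lemma volterraKernel_nonneg (t : ℝ) : 0 ≤ volterraKernel t := by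
  unfold volterraKernel
  split_ifs with ht
  · exact le_rfl
  · have ht := not_le.1 ht
    have h0 : 0 < t := by linarith
    -- With y = log t², the inequality y ≤ sinh y reads 2 log t ≤ (t² - t⁻²)/2.
    have h1 : Real.log (t ^ 2) ≤ Real.sinh (Real.log (t ^ 2)) :=
      Real.self_le_sinh_iff.2 (Real.log_nonneg (by nlinarith))
    rw [Real.sinh_log (by positivity), Real.log_pow] at h1
    push_cast at h1
    linarith

lemma logKernel_nonneg (t : ℝ) : 0 ≤ logKernel t := by
  unfold logKernel
  split_ifs with ht
  · positivity
  · have := Real.log_nonneg (not_le.1 ht).le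
    positivity

lemma volterraKernel_le (t : ℝ) : volterraKernel t ≤ t ^ 2 / 4 := by
  have := logKernel_nonneg t
  rw [logKernel_eq] at this
  linarith

lemma logKernel_le {t : ℝ} (h0 : 0 ≤ t) : logKernel t ≤ 1 + t := by
  unfold logKernel
  split_ifs with ht
  · nlinarith
  · have ht := not_le.1 ht
    have h1 := Real.log_le_sub_one_of_pos (by linarith : 0 < t)
    have h2 : (t ^ 2)⁻¹ ≤ 1 := inv_le_one_of_one_le₀ (by nlinarith)
    linarith

lemma log_le_logKernel {t : ℝ} (h0 : 0 < t) : Real.log t ≤ logKernel t := by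
  unfold logKernel
  split_ifs with ht
  · have := Real.log_nonpos h0.le ht
    nlinarith [sq_nonneg t]
  · have : 0 ≤ (t ^ 2)⁻¹ := by positivity
    linarith

lemma fluxKernel_nonneg (t : ℝ) : 0 ≤ fluxKernel t := by
  unfold fluxKernel
  split_ifs with ht
  · positivity
  · have ht := not_le.1 ht
    have h2 : (t ^ 2)⁻¹ ≤ 1 := inv_le_one_of_one_le₀ (by nlinarith)
    linarith

lemma fluxKernel_pos {t : ℝ} (h0 : 0 < t) : 0 < fluxKernel t := by
  unfold fluxKernel
  split_ifs with ht
  · positivity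
  · have ht := not_le.1 ht
    have h2 : (t ^ 2)⁻¹ ≤ 1 := inv_le_one_of_one_le₀ (by nlinarith)
    linarith

lemma fluxKernel_le_one {t : ℝ} (h0 : 0 ≤ t) : fluxKernel t ≤ 1 := by
  unfold fluxKernel
  split_ifs with ht
  · nlinarith
  · have : 0 ≤ (t ^ 2)⁻¹ := by positivity
    linarith

/-- `fluxKernel (|x|/|y|)` is the spherical mean of x·(x-y)/|x-y|², and x·(x-y) + y·(y-x) = |x-y|².
All symmetrisation in the Pohozaev argument rests on this reciprocity. -/
lemma fluxKernel_add_inv {t : ℝ} (h0 : 0 < t) : fluxKernel t + fluxKernel t⁻¹ = 1 := by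
  unfold fluxKernel
  rcases lt_trichotomy t 1 with h | h | h
  · rw [if_pos h.le, if_neg (not_le.2 (one_lt_inv_iff₀.2 ⟨h0, h⟩))]
    simp
  · subst h; norm_num
  · rw [if_neg (not_le.2 h), if_pos (inv_le_one_of_one_le₀ h.le)]
    simp

/-- The two branches meet at t = 1 with common slope 1/2, so the one-sided derivatives glue. -/
lemma hasDerivAt_logKernel {t : ℝ} (h0 : 0 < t) :
    HasDerivAt logKernel (fluxKernel t / t) t := by
  have hA : ∀ t : ℝ, HasDerivAt (fun u : ℝ => u ^ 2 / 4) (t / 2) t := fun t => by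
    have := (hasDerivAt_pow 2 t).div_const 4
    refine this.congr_deriv ?_; norm_num; try ring
  have hB : ∀ t : ℝ, 0 < t → HasDerivAt (fun u : ℝ => Real.log u + (u ^ 2)⁻¹ / 4)
      (1 / t - 1 / (2 * t ^ 3)) t := fun t ht => by
    have := (Real.hasDerivAt_log ht.ne').add
      (((hasDerivAt_pow 2 t).fun_inv (pow_ne_zero 2 ht.ne')).div_const 4)
    refine this.congr_deriv ?_
    have := ht.ne'
    field_simp
    norm_num
    try ring
  rcases lt_trichotomy t 1 with h | h | h
  · have := hA t
    refine (this.congr_of_eventuallyEq ?_).congr_deriv ?_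
    · filter_upwards [gt_mem_nhds h] with u hu
      rw [logKernel, if_pos hu.le]
    · rw [fluxKernel, if_pos h.le]; field_simp
  · subst h
    have h1 : HasDerivWithinAt logKernel (fluxKernel 1 / 1) (Iic 1) 1 := by
      refine ((hA 1).hasDerivWithinAt.congr_deriv (by norm_num [fluxKernel])).congr
        (fun u hu => by rw [logKernel, if_pos (mem_Iic.1 hu)]) (by norm_num [logKernel])
    have h2 : HasDerivWithinAt logKernel (fluxKernel 1 / 1) (Ici 1) 1 := by
      refine ((hB 1 one_pos).hasDerivWithinAt.congr_deriv (by norm_num [fluxKernel])).congr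
        (fun u hu => ?_) (by norm_num [logKernel])
      rcases eq_or_lt_of_le (mem_Ici.1 hu) with h | h
      · subst h; norm_num [logKernel]
      · rw [logKernel, if_neg (not_le.2 h)]
    have := h1.union h2
    rwa [Iic_union_Ici, hasDerivWithinAt_univ] at this
  · refine ((hB t h0).congr_of_eventuallyEq ?_).congr_deriv ?_
    · filter_upwards [lt_mem_nhds h] with u hu
      rw [logKernel, if_neg (not_le.2 hu)]
    · rw [fluxKernel, if_neg (not_le.2 h)]; field_simp

end Kernel

/-! ### Radial logarithmic potentials and Pohozaev's identity. -/

section Potential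

open Set Filter Topology

lemma integrableOn_logKernel_mul {a : ℝ → ℝ} (ha : IntegrableOn a (Ioi 0))
    (ha' : IntegrableOn (fun s => a s / s) (Ioi 0)) {r : ℝ} (hr : 0 ≤ r) :
    IntegrableOn (fun s => logKernel (r / s) * a s) (Ioi 0) := by
  have hm : Measurable fun s : ℝ => logKernel (r / s) :=
    continuous_logKernel.measurable.comp (measurable_const.div measurable_id)
  refine ((ha.norm.add (ha'.norm.const_mul r))).mono'
    (hm.aestronglyMeasurable.mul ha.aestronglyMeasurable) ?_
  filter_upwards [ae_restrict_mem measurableSet_Ioi] with s hs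
  have hs : 0 < s := hs
  rw [norm_mul, Real.norm_of_nonneg (logKernel_nonneg _)]
  calc logKernel (r / s) * ‖a s‖ ≤ (1 + r / s) * ‖a s‖ :=
        mul_le_mul_of_nonneg_right (logKernel_le (by positivity)) (norm_nonneg _)
    _ = ‖a s‖ + r * ‖a s / s‖ := by
        rw [norm_div, Real.norm_of_nonneg hs.le]; ring

lemma integrableOn_fluxKernel_mul {a : ℝ → ℝ} (ha : IntegrableOn a (Ioi 0)) {r : ℝ}
    (hr : 0 ≤ r) : IntegrableOn (fun s => fluxKernel (r / s) * a s) (Ioi 0) := by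
  have hm : Measurable fun s : ℝ => fluxKernel (r / s) :=
    continuous_fluxKernel.measurable.comp (measurable_const.div measurable_id)
  refine ha.norm.mono' (hm.aestronglyMeasurable.mul ha.aestronglyMeasurable) ?_
  filter_upwards [ae_restrict_mem measurableSet_Ioi] with s hs
  have hs : 0 < s := hs
  rw [norm_mul, Real.norm_of_nonneg (fluxKernel_nonneg _)]
  exact mul_le_of_le_one_left (norm_nonneg _) (fluxKernel_le_one (by positivity))

lemma hasDerivAt_integral_logKernel {a : ℝ → ℝ} (ha : IntegrableOn a (Ioi 0))
    (ha' : IntegrableOn (fun s => a s / s) (Ioi 0)) {r : ℝ} (hr : 0 < r) :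
    HasDerivAt (fun r => ∫ s in Ioi 0, logKernel (r / s) * a s)
      ((∫ s in Ioi 0, fluxKernel (r / s) * a s) / r) r := by
  have hm : ∀ x : ℝ, Measurable fun s : ℝ => logKernel (x / s) := fun x =>
    continuous_logKernel.measurable.comp (measurable_const.div measurable_id)
  have key := (hasDerivAt_integral_of_dominated_loc_of_deriv_le
    (μ := volume.restrict (Ioi (0 : ℝ))) (F := fun r s => logKernel (r / s) * a s)
    (F' := fun r s => fluxKernel (r / s) * a s / r) (bound := fun s => ‖a s‖ * (2 / r))
    -- On (r/2, ∞) one has 1/x ≤ 2/r and the flux kernel is at most 1, so the x-derivative is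
    -- dominated by a multiple of `|a|`.
    (x₀ := r) (s := Ioi (r / 2)) (Ioi_mem_nhds (by linarith)) ?_
    (integrableOn_logKernel_mul ha ha' hr.le) ?_ ?_ ?_ ?_).2
  · rwa [integral_div] at key
  · exact Eventually.of_forall fun x => (hm x).aestronglyMeasurable.mul ha.aestronglyMeasurable
  · exact ((integrableOn_fluxKernel_mul ha hr.le).div_const r).aestronglyMeasurable
  · filter_upwards [ae_restrict_mem measurableSet_Ioi] with s hs x hx
    have hs : 0 < s := hs
    have hx : r / 2 < x := hx
    have hx0 : 0 < x := by linarith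
    rw [norm_div, norm_mul, Real.norm_of_nonneg (fluxKernel_nonneg _), Real.norm_of_nonneg hx0.le,
      div_eq_mul_inv]
    have h2 : x⁻¹ ≤ 2 / r := by
      rw [inv_le_comm₀ hx0 (by positivity), inv_div]; exact hx.le
    exact mul_le_mul (mul_le_of_le_one_left (norm_nonneg _) (fluxKernel_le_one (by positivity)))
      h2 (by positivity) (norm_nonneg _)
  · exact ha.norm.mul_const _
  · filter_upwards [ae_restrict_mem measurableSet_Ioi] with s hs x hx
    have hs : 0 < s := hs
    have hx : r / 2 < x := hx
    have hx0 : 0 < x := by linarith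
    have h1 : HasDerivAt (fun x => logKernel (x / s)) (fluxKernel (x / s) / (x / s) * (1 / s)) x :=
      HasDerivAt.comp x (hasDerivAt_logKernel (by positivity)) ((hasDerivAt_id x).div_const s)
    refine (h1.mul_const (a s)).congr_deriv ?_
    field_simp

/-- The pairing `∫∫ f(s) k(s, σ) g(σ)` attached to the flux kernel. -/
noncomputable def fluxPairing (f g : ℝ → ℝ) : ℝ :=
  ∫ s in Ioi 0, f s * ∫ σ in Ioi 0, fluxKernel (s / σ) * g σ

lemma integrable_fluxKernel_prod {f g : ℝ → ℝ} (hf : IntegrableOn f (Ioi 0))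
    (hg : IntegrableOn g (Ioi 0)) :
    Integrable (fun z : ℝ × ℝ => f z.1 * (fluxKernel (z.1 / z.2) * g z.2))
      ((volume.restrict (Ioi 0)).prod (volume.restrict (Ioi 0))) := by
  have hm : Measurable fun z : ℝ × ℝ => fluxKernel (z.1 / z.2) :=
    continuous_fluxKernel.measurable.comp (measurable_fst.div measurable_snd)
  have h := Integrable.mul_prod hf hg
  have h2 := h.norm.mono' (hm.aestronglyMeasurable.mul h.aestronglyMeasurable) (by
    have h1 : ∀ᵐ z ∂((volume.restrict (Ioi (0:ℝ))).prod (volume.restrict (Ioi (0:ℝ)))),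
        z ∈ Ioi (0:ℝ) ×ˢ Ioi (0:ℝ) := by
      rw [Measure.prod_restrict]
      exact ae_restrict_mem (measurableSet_Ioi.prod measurableSet_Ioi)
    filter_upwards [h1] with z hz
    have hz1 : 0 < z.1 := hz.1
    have hz2 : 0 < z.2 := hz.2
    rw [Pi.mul_apply, norm_mul, Real.norm_of_nonneg (fluxKernel_nonneg _)]
    exact mul_le_of_le_one_left (norm_nonneg _) (fluxKernel_le_one (by positivity)))
  refine h2.congr (Eventually.of_forall fun z => ?_)
  simp only [Pi.mul_apply]; ring

lemma fluxPairing_eq_prod {f g : ℝ → ℝ} (hf : IntegrableOn f (Ioi 0))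
    (hg : IntegrableOn g (Ioi 0)) :
    fluxPairing f g = ∫ z, f z.1 * (fluxKernel (z.1 / z.2) * g z.2)
      ∂((volume.restrict (Ioi 0)).prod (volume.restrict (Ioi 0))) := by
  rw [integral_prod _ (integrable_fluxKernel_prod hf hg), fluxPairing]
  simp_rw [integral_const_mul]

/-- Exchanging the variables in the second double integral leaves k(t) + k(1/t) = 1 as the total
kernel, and the product of the two masses remains. -/
lemma fluxPairing_add_swap {f g : ℝ → ℝ} (hf : IntegrableOn f (Ioi 0))
    (hg : IntegrableOn g (Ioi 0)) :
    fluxPairing f g + fluxPairing g f = (∫ s in Ioi 0, f s) * ∫ s in Ioi 0, g s := by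
  have hswap : ∫ z, g z.1 * (fluxKernel (z.1 / z.2) * f z.2)
      ∂((volume.restrict (Ioi (0 : ℝ))).prod (volume.restrict (Ioi (0 : ℝ)))) =
      ∫ z, g z.2 * (fluxKernel (z.2 / z.1) * f z.1)
      ∂((volume.restrict (Ioi (0 : ℝ))).prod (volume.restrict (Ioi (0 : ℝ)))) :=
    (integral_prod_swap (fun z : ℝ × ℝ => g z.1 * (fluxKernel (z.1 / z.2) * f z.2))).symm
  have hint : Integrable (fun z : ℝ × ℝ => g z.2 * (fluxKernel (z.2 / z.1) * f z.1))
      ((volume.restrict (Ioi (0 : ℝ))).prod (volume.restrict (Ioi (0 : ℝ)))) :=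
    (integrable_fluxKernel_prod hg hf).swap
  rw [fluxPairing_eq_prod hf hg, fluxPairing_eq_prod hg hf, hswap,
    ← integral_add (integrable_fluxKernel_prod hf hg) hint,
    ← integral_prod_mul]
  refine integral_congr_ae ?_
  have h1 : ∀ᵐ z ∂((volume.restrict (Ioi (0:ℝ))).prod (volume.restrict (Ioi (0:ℝ)))),
      z ∈ Ioi (0:ℝ) ×ˢ Ioi (0:ℝ) := by
    rw [Measure.prod_restrict]
    exact ae_restrict_mem (measurableSet_Ioi.prod measurableSet_Ioi)
  filter_upwards [h1] with z hz
  have hz1 : 0 < z.1 := hz.1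
  have hz2 : 0 < z.2 := hz.2
  have := fluxKernel_add_inv (div_pos hz1 hz2)
  rw [inv_div] at this
  linear_combination f z.1 * g z.2 * this

lemma integrableOn_mul_flux {f g : ℝ → ℝ} (hf : IntegrableOn f (Ioi 0))
    (hg : IntegrableOn g (Ioi 0)) :
    IntegrableOn (fun s => f s * ∫ σ in Ioi 0, fluxKernel (s / σ) * g σ) (Ioi 0) := by
  have := (integrable_fluxKernel_prod hf hg).integral_prod_left
  simp_rw [integral_const_mul] at this
  exact this

lemma fluxPairing_self {f : ℝ → ℝ} (hf : IntegrableOn f (Ioi 0)) :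
    fluxPairing f f = (∫ s in Ioi 0, f s) ^ 2 / 2 := by
  have := fluxPairing_add_swap hf hf
  linarith

lemma fluxPairing_add_right {f g h : ℝ → ℝ} (hf : IntegrableOn f (Ioi 0))
    (hg : IntegrableOn g (Ioi 0)) (hh : IntegrableOn h (Ioi 0)) :
    fluxPairing f (fun s => g s + h s) = fluxPairing f g + fluxPairing f h := by
  unfold fluxPairing
  rw [← integral_add (integrableOn_mul_flux hf hg) (integrableOn_mul_flux hf hh)]
  refine setIntegral_congr_fun measurableSet_Ioi fun s hs => ?_
  have hs : 0 < s := hs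
  simp only
  rw [← mul_add, ← integral_add (integrableOn_fluxKernel_mul hg hs.le)
    (integrableOn_fluxKernel_mul hh hs.le)]
  simp_rw [mul_add]

lemma fluxPairing_const_mul_left (c : ℝ) (f g : ℝ → ℝ) :
    fluxPairing (fun s => c * f s) g = c * fluxPairing f g := by
  unfold fluxPairing
  rw [← integral_const_mul]
  simp_rw [mul_assoc]

lemma setIntegral_Ioi_pos {h : ℝ → ℝ} (hi : IntegrableOn h (Ioi 0)) (h0 : ∀ s, 0 < s → 0 < h s) :
    0 < ∫ s in Ioi 0, h s := by
  rw [setIntegral_pos_iff_support_of_nonneg_ae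
    ((ae_restrict_mem measurableSet_Ioi).mono fun s hs => (h0 s hs).le) hi]
  have : Function.support h ∩ Ioi 0 = Ioi 0 :=
    inter_eq_self_of_subset_right fun s hs => (h0 s hs).ne'
  simp [this]

lemma fluxPairing_pos {f g : ℝ → ℝ} (hf : IntegrableOn f (Ioi 0))
    (hg : IntegrableOn g (Ioi 0)) (hf0 : ∀ s, 0 < s → 0 < f s) (hg0 : ∀ s, 0 < s → 0 < g s) :
    0 < fluxPairing f g := by
  refine setIntegral_Ioi_pos (integrableOn_mul_flux hf hg) fun s hs => mul_pos (hf0 s hs) ?_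
  exact setIntegral_Ioi_pos (integrableOn_fluxKernel_mul hg hs.le) fun σ hσ =>
    mul_pos (fluxKernel_pos (div_pos hs hσ)) (hg0 σ hσ)

/-- The Pohozaev identity for radial logarithmic potentials. -/
theorem pohozaev_identity {a U : ℝ → ℝ} {C q : ℝ} (hq : 0 ≤ q) (ha : IntegrableOn a (Ioi 0))
    (ha' : IntegrableOn (fun s => a s / s) (Ioi 0)) (ha0 : ∀ s, 0 < s → 0 ≤ a s)
    (hU : ∀ r, 0 < r → U r = C - ∫ s in Ioi 0, logKernel (r / s) * a s)
    (hw : IntegrableOn (fun s => s ^ q * Real.exp (4 * U s) * s ^ 3) (Ioi 0)) :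
    (1 + q / 4) * (∫ s in Ioi 0, s ^ q * Real.exp (4 * U s) * s ^ 3) =
      fluxPairing (fun s => s ^ q * Real.exp (4 * U s) * s ^ 3) a := by
  set w : ℝ → ℝ := fun s => s ^ q * Real.exp (4 * U s) * s ^ 3 with hwdef
  set D : ℝ → ℝ := fun s => ∫ σ in Ioi 0, fluxKernel (s / σ) * a σ with hD
  set H : ℝ → ℝ := fun r => r ^ (q + 4) * Real.exp (4 * U r) with hH
  have hUd : ∀ r, 0 < r → HasDerivAt U (-(D r / r)) r := fun r hr => by
    refine ((hasDerivAt_integral_logKernel ha ha' hr).const_sub C).congr_of_eventuallyEq ?_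
    filter_upwards [lt_mem_nhds hr] with x hx using hU x hx
  have hHw : ∀ r, 0 < r → H r = r * w r := fun r hr => by
    simp only [hH, hwdef]
    rw [Real.rpow_add hr, show (4 : ℝ) = (4 : ℕ) by norm_num, Real.rpow_natCast]
    ring
  -- Since U' = -D/r, the derivative of r^{q+4} e^{4U} is (q+4)w - 4wD. Its integral over the
  -- half-line is the identity, provided `H` vanishes at both ends.
  have hHd : ∀ r ∈ Ioi (0 : ℝ), HasDerivAt H ((q + 4) * w r - 4 * (w r * D r)) r := fun r hr => by
    have hr : 0 < r := hr
    have h1 := (Real.hasDerivAt_rpow_const (p := q + 4) (Or.inl hr.ne')).mul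
      (((hUd r hr).const_mul 4).exp)
    refine h1.congr_deriv ?_
    simp only [hwdef]
    rw [show q + 4 - 1 = q + (3 : ℕ) by push_cast; ring, Real.rpow_add hr,
      show q + 4 = q + (4 : ℕ) by push_cast; ring, Real.rpow_add hr, Real.rpow_natCast,
      Real.rpow_natCast]
    field_simp
    push_cast
    ring
  have hDint : IntegrableOn (fun s => w s * D s) (Ioi 0) := integrableOn_mul_flux hw ha
  have hH'int : IntegrableOn (fun r => (q + 4) * w r - 4 * (w r * D r)) (Ioi 0) :=
    (hw.const_mul _).sub (hDint.const_mul _)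
  -- Kernel and density are nonnegative, so `U` is bounded above and `H` is O(r^{q+4}) at the
  -- origin.
  have hUC : ∀ r, 0 < r → U r ≤ C := fun r hr => by
    rw [hU r hr, sub_le_self_iff]
    exact setIntegral_nonneg measurableSet_Ioi fun s hs =>
      mul_nonneg (logKernel_nonneg _) (ha0 s hs)
  have hH0 : H 0 = 0 := by
    simp only [hH]; rw [Real.zero_rpow (by linarith)]; simp
  have hcont : ContinuousWithinAt H (Ici 0) 0 := by
    rw [ContinuousWithinAt, hH0]
    have hb : Tendsto (fun r : ℝ => r ^ (q + 4) * Real.exp (4 * C)) (𝓝[Ici 0] 0) (𝓝 0) := by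
      have : Continuous fun r : ℝ => r ^ (q + 4) * Real.exp (4 * C) :=
        (Real.continuous_rpow_const (by linarith)).mul continuous_const
      have h := this.tendsto 0
      simp only [Real.zero_rpow (show q + 4 ≠ 0 by linarith), zero_mul] at h
      exact h.mono_left nhdsWithin_le_nhds
    refine tendsto_of_tendsto_of_tendsto_of_le_of_le' tendsto_const_nhds hb ?_ ?_
    · filter_upwards [self_mem_nhdsWithin] with r hr
      exact mul_nonneg (Real.rpow_nonneg hr _) (Real.exp_pos _).le
    · filter_upwards [self_mem_nhdsWithin] with r hr
      rcases eq_or_lt_of_le (mem_Ici.1 hr) with h | h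
      · subst h; simp only [hH]; rw [Real.zero_rpow (by linarith)]; simp
      · refine mul_le_mul_of_nonneg_left (Real.exp_le_exp.2 ?_) (Real.rpow_nonneg hr _)
        linarith [hUC r h]
  have hlim := tendsto_limUnder_of_hasDerivAt_of_integrableOn_Ioi hHd hH'int
  set m := limUnder atTop H
  have hm0 : 0 ≤ m := ge_of_tendsto hlim (by
    filter_upwards [eventually_gt_atTop 0] with r hr
    exact mul_nonneg (Real.rpow_nonneg hr.le _) (Real.exp_pos _).le)
  -- A positive limit would make w = H/r at least m/(2r) near infinity, against the integrability of
  -- `w`.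
  have hm : m = 0 := by
    by_contra hne
    have hmpos : 0 < m := lt_of_le_of_ne hm0 (Ne.symm hne)
    obtain ⟨R, hR⟩ := eventually_atTop.1 (hlim.eventually (lt_mem_nhds (half_lt_self hmpos)))
    refine not_integrableOn_Ioi_inv (a := max R 1) ?_
    have hsub : Ioi (max R 1) ⊆ Ioi 0 := Ioi_subset_Ioi (le_trans zero_le_one (le_max_right _ _))
    refine ((hw.mono_set hsub).const_mul (2 / m)).mono' measurable_inv.aestronglyMeasurable ?_
    filter_upwards [ae_restrict_mem measurableSet_Ioi] with r hr
    have hr0 : 0 < r := hsub hr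
    have h1 := hR r (le_trans (le_max_left _ _) (le_of_lt hr))
    rw [hHw r hr0] at h1
    rw [norm_inv, Real.norm_of_nonneg hr0.le, inv_eq_one_div, div_le_iff₀ hr0, div_mul_eq_mul_div,
      div_mul_eq_mul_div, le_div_iff₀ hmpos]
    linarith
  rw [hm] at hlim
  have key := integral_Ioi_of_hasDerivAt_of_tendsto hcont hHd hH'int hlim
  rw [hH0, integral_sub (hw.const_mul _) (hDint.const_mul _), integral_const_mul,
    integral_const_mul] at key
  change _ = ∫ s in Ioi 0, w s * D s
  linarith

end Potential

/-! ### The two masses of a radial normal solution and their constraints. -/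

section RadialNormal

open Set Filter Topology

/-- Profiles `U` of radial normal solutions with curvature function `c + d |x|^{4p}`, the
dimensional constant being absorbed into `c` and `d`. -/
structure IsRadialNormal (p c d : ℝ) (U : ℝ → ℝ) : Prop where
  continuous : Continuous U
  integrable : IntegrableOn (fun s => (c + d * s ^ (4 * p)) * Real.exp (4 * U s) * s ^ 3) (Ioi 0)
  exists_eq : ∃ C, ∀ r, 0 ≤ r → U r =
    C - ∫ s in Ioi 0, logKernel (r / s) * ((c + d * s ^ (4 * p)) * Real.exp (4 * U s) * s ^ 3)

/-- The total mass contributed by the constant part of the curvature function. -/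
noncomputable def headMass (c : ℝ) (U : ℝ → ℝ) : ℝ :=
  ∫ s in Ioi 0, c * (Real.exp (4 * U s) * s ^ 3)

/-- The total mass contributed by the growing part of the curvature function. -/
noncomputable def tailMass (p d : ℝ) (U : ℝ → ℝ) : ℝ :=
  ∫ s in Ioi 0, d * (s ^ (4 * p) * Real.exp (4 * U s) * s ^ 3)

lemma integrableOn_density_div {p c d : ℝ} (hp : 0 < p) {U : ℝ → ℝ} (hU : Continuous U)
    (h : IntegrableOn (fun s => (c + d * s ^ (4 * p)) * Real.exp (4 * U s) * s ^ 3) (Ioi 0)) :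
    IntegrableOn (fun s => (c + d * s ^ (4 * p)) * Real.exp (4 * U s) * s ^ 3 / s) (Ioi 0) := by
  have hc : Continuous fun s : ℝ => (c + d * s ^ (4 * p)) * Real.exp (4 * U s) * s ^ 2 :=
    ((continuous_const.add (continuous_const.mul (Real.continuous_rpow_const (by positivity)))).mul
      (Real.continuous_exp.comp (continuous_const.mul hU))).mul (continuous_pow 2)
  have heq : ∀ s ∈ Ioi (0 : ℝ), (c + d * s ^ (4 * p)) * Real.exp (4 * U s) * s ^ 2 =
      (c + d * s ^ (4 * p)) * Real.exp (4 * U s) * s ^ 3 / s := fun s hs => by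
    have : s ≠ 0 := ne_of_gt hs
    field_simp
  refine IntegrableOn.congr_fun ?_ heq measurableSet_Ioi
  rw [← Ioc_union_Ioi_eq_Ioi zero_le_one]
  refine IntegrableOn.union
    ((hc.integrableOn_Icc (a := 0) (b := 1)).mono_set Ioc_subset_Icc_self) ?_
  have hsub : Ioi (1 : ℝ) ⊆ Ioi 0 := Ioi_subset_Ioi zero_le_one
  refine (h.mono_set hsub).norm.mono' hc.aestronglyMeasurable ?_
  filter_upwards [ae_restrict_mem measurableSet_Ioi] with s hs
  have hs1 : 1 < s := hs
  rw [norm_mul, norm_mul _ (s ^ 3)]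
  refine mul_le_mul_of_nonneg_left ?_ (norm_nonneg _)
  rw [Real.norm_of_nonneg (by positivity), Real.norm_of_nonneg (by positivity)]
  exact pow_le_pow_right₀ hs1.le (by norm_num)

variable {p c d : ℝ} {U : ℝ → ℝ}

lemma IsRadialNormal.integrable_head (h : IsRadialNormal p c d U) (hc : 0 ≤ c) (hd : 0 ≤ d) :
    IntegrableOn (fun s => c * (Real.exp (4 * U s) * s ^ 3)) (Ioi 0) := by
  refine h.integrable.mono' (continuous_const.mul ((Real.continuous_exp.comp
    (continuous_const.mul h.continuous)).mul (continuous_pow 3))).aestronglyMeasurable ?_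
  filter_upwards [ae_restrict_mem measurableSet_Ioi] with s hs
  have hs : 0 < s := hs
  rw [Real.norm_of_nonneg (by positivity), mul_assoc]
  exact mul_le_mul_of_nonneg_right (le_add_of_nonneg_right (by positivity)) (by positivity)

lemma IsRadialNormal.integrable_tail (h : IsRadialNormal p c d U) (hc : 0 ≤ c) (hd : 0 ≤ d) :
    IntegrableOn (fun s => d * (s ^ (4 * p) * Real.exp (4 * U s) * s ^ 3)) (Ioi 0) := by
  refine (h.integrable.sub (h.integrable_head hc hd)).congr (Eventually.of_forall fun s => ?_)
  simp only [Pi.sub_apply]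
  ring

lemma IsRadialNormal.integral_eq (h : IsRadialNormal p c d U) (hc : 0 ≤ c) (hd : 0 ≤ d) :
    ∫ s in Ioi 0, (c + d * s ^ (4 * p)) * Real.exp (4 * U s) * s ^ 3 =
      headMass c U + tailMass p d U := by
  rw [headMass, tailMass, ← integral_add (h.integrable_head hc hd) (h.integrable_tail hc hd)]
  congr 1; ext s; ring

/-- Pohozaev's identity with q = 0. The density is the sum of the two parts, and the pairing of the
constant part with itself is half the square of its mass. -/
lemma IsRadialNormal.pohozaev_head (h : IsRadialNormal p c d U) (hp : 0 < p) (hc : 0 ≤ c)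
    (hd : 0 ≤ d) : headMass c U = headMass c U ^ 2 / 2 +
      fluxPairing (fun s => c * (Real.exp (4 * U s) * s ^ 3))
        (fun s => d * (s ^ (4 * p) * Real.exp (4 * U s) * s ^ 3)) := by
  -- The degenerate coefficient must be allowed, since it occurs at an endpoint of the interpolating
  -- family.
  rcases hc.eq_or_lt with rfl | hc'
  · simp [headMass, fluxPairing]
  obtain ⟨C, hC⟩ := h.exists_eq
  have hhead := h.integrable_head hc hd
  have hw : IntegrableOn (fun s => s ^ (0 : ℝ) * Real.exp (4 * U s) * s ^ 3) (Ioi 0) := by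
    refine (hhead.const_mul c⁻¹).congr (Eventually.of_forall fun s => ?_)
    simp only [Real.rpow_zero]
    field_simp
  have key := pohozaev_identity le_rfl h.integrable
    (integrableOn_density_div hp h.continuous h.integrable)
    (fun s hs => by positivity) (fun r hr => hC r hr.le) hw
  simp only [Real.rpow_zero, one_mul, zero_div, add_zero] at key
  rw [headMass, ← fluxPairing_self hhead, ← fluxPairing_add_right hhead hhead
    (h.integrable_tail hc hd), fluxPairing_const_mul_left, integral_const_mul, key]
  congr 2
  ext s
  ring

/-- Pohozaev's identity with q = 4p, whose factor 1 + q/4 is 1 + p. -/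
lemma IsRadialNormal.pohozaev_tail (h : IsRadialNormal p c d U) (hp : 0 < p) (hc : 0 ≤ c)
    (hd : 0 ≤ d) : (1 + p) * tailMass p d U =
      fluxPairing (fun s => d * (s ^ (4 * p) * Real.exp (4 * U s) * s ^ 3))
        (fun s => c * (Real.exp (4 * U s) * s ^ 3)) + tailMass p d U ^ 2 / 2 := by
  rcases hd.eq_or_lt with rfl | hd'
  · simp [tailMass, fluxPairing]
  obtain ⟨C, hC⟩ := h.exists_eq
  have htail := h.integrable_tail hc hd
  have hw : IntegrableOn (fun s => s ^ (4 * p) * Real.exp (4 * U s) * s ^ 3) (Ioi 0) := by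
    refine (htail.const_mul d⁻¹).congr (Eventually.of_forall fun s => ?_)
    simp only
    field_simp
  have key := pohozaev_identity (by positivity) h.integrable
    (integrableOn_density_div hp h.continuous h.integrable)
    (fun s hs => by have : 0 < s := hs; positivity) (fun r hr => hC r hr.le) hw
  rw [mul_div_cancel_left₀ p (by norm_num : (4 : ℝ) ≠ 0)] at key
  rw [tailMass, ← fluxPairing_self htail, ← fluxPairing_add_right htail
    (h.integrable_head hc hd) htail, fluxPairing_const_mul_left, integral_const_mul,
    mul_left_comm, key]
  congr 2
  ext s
  ring

/-- The Pohozaev identity for the two masses of a radial normal solution. -/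
theorem IsRadialNormal.pohozaev (h : IsRadialNormal p c d U) (hp : 0 < p) (hc : 0 ≤ c)
    (hd : 0 ≤ d) : headMass c U + (1 + p) * tailMass p d U =
      (headMass c U + tailMass p d U) ^ 2 / 2 := by
  have h1 := h.pohozaev_head hp hc hd
  have h2 := h.pohozaev_tail hp hc hd
  have h3 := fluxPairing_add_swap (h.integrable_head hc hd) (h.integrable_tail hc hd)
  rw [← headMass, ← tailMass] at h3
  linear_combination h1 + h2 + h3

lemma headMass_nonneg (hc : 0 ≤ c) (U : ℝ → ℝ) : 0 ≤ headMass c U :=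
  setIntegral_nonneg measurableSet_Ioi fun s hs => by
    have : 0 < s := hs
    positivity

lemma tailMass_nonneg (p : ℝ) (hd : 0 ≤ d) (U : ℝ → ℝ) : 0 ≤ tailMass p d U :=
  setIntegral_nonneg measurableSet_Ioi fun s hs => by
    have : 0 < s := hs
    positivity

lemma IsRadialNormal.headMass_pos (h : IsRadialNormal p c d U) (hc : 0 < c) (hd : 0 ≤ d) :
    0 < headMass c U :=
  setIntegral_Ioi_pos (h.integrable_head hc.le hd) fun s hs => by positivity

lemma IsRadialNormal.tailMass_pos (h : IsRadialNormal p c d U) (hc : 0 ≤ c) (hd : 0 < d) :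
    0 < tailMass p d U :=
  setIntegral_Ioi_pos (h.integrable_tail hc hd.le) fun s hs => by positivity

/-- The cross term is positive, so the mass x satisfies x > x²/2. -/
lemma IsRadialNormal.headMass_lt_two (h : IsRadialNormal p c d U) (hp : 0 < p) (hc : 0 < c)
    (hd : 0 < d) : headMass c U < 2 := by
  have h1 := h.pohozaev_head hp hc.le hd.le
  have h2 : 0 < fluxPairing (fun s => c * (Real.exp (4 * U s) * s ^ 3))
      (fun s => d * (s ^ (4 * p) * Real.exp (4 * U s) * s ^ 3)) :=
    fluxPairing_pos (h.integrable_head hc.le hd.le) (h.integrable_tail hc.le hd.le)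
      (fun s hs => by positivity) (fun s hs => by positivity)
  have h3 := h.headMass_pos hc hd.le
  nlinarith

/-- The total mass of a radial normal solution lies in the range found by Pohozaev's identity and
the volume bound. -/
theorem IsRadialNormal.mass_mem (h : IsRadialNormal p c d U) (hp : 0 < p) (hc : 0 < c)
    (hd : 0 < d) : max 2 (2 * p) < headMass c U + tailMass p d U ∧
      headMass c U + tailMass p d U < 2 + 2 * p := by
  have h1 := h.pohozaev hp hc.le hd.le
  have h2 := h.headMass_lt_two hp hc hd
  have h3 := h.headMass_pos hc hd.le
  have h4 := h.tailMass_pos hc.le hd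
  set x := headMass c U
  set y := tailMass p d U
  have hβ : 0 < x + y := by positivity
  have h5 : 2 < x + y := by
    by_contra! hle
    have : 0 < p * y := by positivity
    nlinarith
  have h6 : x + y < 2 + 2 * p := by
    by_contra! hle
    have : 0 < p * x := by positivity
    nlinarith
  refine ⟨max_lt h5 ?_, h6⟩
  by_contra! hle
  -- A rearrangement of Pohozaev's identity. Its right side is positive because x < 2, so β - 2p has
  -- the sign of β - 2.
  have h7 : (x + y - 2) * (x + y - 2 * p) = 2 * p * (2 - x) := by linear_combination -2 * h1
  have h8 : 0 < 2 * p * (2 - x) := by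
    have : 0 < 2 - x := by linarith
    positivity
  nlinarith

/-- Also valid when one coefficient vanishes. This bound, uniform over the interpolating family,
prevents loss of the moment at infinity. -/
lemma IsRadialNormal.mass_le (h : IsRadialNormal p c d U) (hp : 0 < p) (hc : 0 ≤ c)
    (hd : 0 ≤ d) : headMass c U + tailMass p d U ≤ 2 + 2 * p := by
  have h1 := h.pohozaev hp hc hd
  have h3 := headMass_nonneg hc U
  have h4 := tailMass_nonneg p hd U
  by_contra! hle
  have : 0 ≤ p * headMass c U := by positivity
  nlinarith

end RadialNormal

/-! ### The Volterra equation: existence, monotonicity, continuous dependence. -/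

section Volterra

open Set Filter Topology

/-- The truncated exponential nonlinearity `e^{4 min(u, 0)}`. -/
noncomputable def cappedExp (u : ℝ) : ℝ := Real.exp (4 * min u 0)

lemma cappedExp_pos (u : ℝ) : 0 < cappedExp u := Real.exp_pos _

lemma cappedExp_le_one (u : ℝ) : cappedExp u ≤ 1 :=
  Real.exp_le_one_iff.2 (by linarith [min_le_right u 0])

lemma cappedExp_mono : Monotone cappedExp := fun u v h =>
  Real.exp_le_exp.2 (by linarith [min_le_min_right 0 h])

lemma cappedExp_le_exp (u : ℝ) : cappedExp u ≤ Real.exp (4 * u) :=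
  Real.exp_le_exp.2 (by linarith [min_le_left u 0])

lemma cappedExp_of_nonpos {u : ℝ} (h : u ≤ 0) : cappedExp u = Real.exp (4 * u) := by
  rw [cappedExp, min_eq_left h]

lemma continuous_cappedExp : Continuous cappedExp :=
  Real.continuous_exp.comp (continuous_const.mul (continuous_id.min continuous_const))

/-- The cap at 0 makes the nonlinearity bounded by 1 and globally Lipschitz, so the Volterra
equation is solvable for every b. The solutions finally used are nonpositive and do not feel the
cap. -/
lemma abs_cappedExp_sub_le (u v : ℝ) : |cappedExp u - cappedExp v| ≤ 4 * |u - v| := by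
  wlog h : v ≤ u generalizing u v
  · rw [abs_sub_comm, abs_sub_comm u]; exact this v u (not_le.1 h).le
  rw [abs_of_nonneg (sub_nonneg.2 (cappedExp_mono h)), abs_of_nonneg (sub_nonneg.2 h)]
  have h1 : cappedExp v = cappedExp u * Real.exp (4 * min v 0 - 4 * min u 0) := by
    rw [cappedExp, cappedExp, ← Real.exp_add]; congr 1; ring
  have h2 := Real.add_one_le_exp (4 * min v 0 - 4 * min u 0)
  have h3 : min u 0 - min v 0 ≤ u - v := by
    rcases min_cases u 0 with h | h <;> rcases min_cases v 0 with h' | h' <;> linarith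
  have h5 : min v 0 ≤ min u 0 := min_le_min_right 0 h
  have h4 := cappedExp_le_one u
  have h6 := cappedExp_pos u
  rw [h1]
  nlinarith

lemma volterraKernel_mul_nonneg {s : ℝ} (hs : 0 < s) (r : ℝ) :
    0 ≤ volterraKernel (r / s) * s ^ 3 := mul_nonneg (volterraKernel_nonneg _) (by positivity)

lemma volterraKernel_of_le {r s : ℝ} (hs : 0 < s) (h : r ≤ s) : volterraKernel (r / s) = 0 := by
  rw [volterraKernel, if_pos ((div_le_one hs).2 h)]

lemma volterraKernel_mul_le (r : ℝ) {s : ℝ} (hs : 0 < s) :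
    volterraKernel (r / s) * s ^ 3 ≤ r ^ 2 * (s / 4) := by
  have h := mul_le_mul_of_nonneg_right (volterraKernel_le (r / s)) (by positivity : 0 ≤ s ^ 3)
  refine h.trans (le_of_eq ?_)
  field_simp

lemma volterraKernel_mul_le_indicator {r R s : ℝ} (hr : r ≤ R) (hs : 0 < s) :
    volterraKernel (r / s) * s ^ 3 ≤ (Ioc 0 R).indicator (fun s => R ^ 2 * (s / 4)) s := by
  by_cases h : s ∈ Ioc 0 R
  · rw [indicator_of_mem h]
    rcases le_or_gt r s with h' | h'
    · rw [volterraKernel_of_le hs h', zero_mul]; positivity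
    · refine (volterraKernel_mul_le r hs).trans ?_
      have : r ^ 2 ≤ R ^ 2 := pow_le_pow_left₀ (by linarith) hr 2
      exact mul_le_mul_of_nonneg_right this (by positivity)
  · rw [indicator_of_notMem h]
    have : R < s := by
      by_contra! h'; exact h ⟨hs, h'⟩
    rw [volterraKernel_of_le hs (by linarith), zero_mul]

/-- The Volterra operator `u ↦ b r² + (Δ²)⁻¹ (Q e^{4 min(u, 0)})`. -/
noncomputable def volterraOp (b : ℝ) (Q u : ℝ → ℝ) (r : ℝ) : ℝ :=
  b * r ^ 2 + ∫ s in Ioi 0, volterraKernel (r / s) * s ^ 3 * (Q s * cappedExp (u s))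

lemma integrableOn_indicator_weight {Q : ℝ → ℝ} (hQ : Continuous Q) (R : ℝ) :
    IntegrableOn (fun s => (Ioc 0 R).indicator (fun s => R ^ 2 * (s / 4)) s * |Q s|) (Ioi 0) := by
  have h : Continuous fun s : ℝ => R ^ 2 * (s / 4) * |Q s| :=
    (continuous_const.mul (continuous_id.div_const 4)).mul hQ.abs
  have h1 : IntegrableOn (fun s : ℝ => R ^ 2 * (s / 4) * |Q s|) (Ioc 0 R) :=
    (h.integrableOn_Icc).mono_set Ioc_subset_Icc_self
  have h2 := ((integrable_indicator_iff measurableSet_Ioc).2 h1).integrableOn (s := Ioi 0)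
  refine h2.congr (Eventually.of_forall fun s => ?_)
  simp only [indicator]
  split_ifs <;> simp

lemma norm_volterra_integrand_le {r R s q v : ℝ} (hr : r ≤ R) (hs : 0 < s)
    (hv : 0 ≤ v) (hv1 : v ≤ 1) :
    ‖volterraKernel (r / s) * s ^ 3 * (q * v)‖ ≤
      (Ioc 0 R).indicator (fun s => R ^ 2 * (s / 4)) s * |q| := by
  rw [norm_mul, norm_mul q, Real.norm_of_nonneg (volterraKernel_mul_nonneg hs r),
    Real.norm_of_nonneg hv, Real.norm_eq_abs]
  exact mul_le_mul (volterraKernel_mul_le_indicator hr hs)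
    (mul_le_of_le_one_right (abs_nonneg _) hv1) (by positivity)
    ((volterraKernel_mul_nonneg hs r).trans (volterraKernel_mul_le_indicator hr hs))

lemma aestronglyMeasurable_volterra {Q u : ℝ → ℝ} (hQ : Continuous Q) (hu : Measurable u) (r : ℝ)
    (μ : Measure ℝ) : AEStronglyMeasurable
      (fun s => volterraKernel (r / s) * s ^ 3 * (Q s * cappedExp (u s))) μ :=
  (((continuous_volterraKernel.measurable.comp (measurable_const.div measurable_id)).mul
    (measurable_id.pow_const 3)).mul
    (hQ.measurable.mul (continuous_cappedExp.measurable.comp hu))).aestronglyMeasurable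

lemma integrableOn_volterra {Q u : ℝ → ℝ} (hQ : Continuous Q) (hu : Measurable u) (r : ℝ) :
    IntegrableOn (fun s => volterraKernel (r / s) * s ^ 3 * (Q s * cappedExp (u s))) (Ioi 0) := by
  refine (integrableOn_indicator_weight hQ |r|).mono' (aestronglyMeasurable_volterra hQ hu r _) ?_
  filter_upwards [ae_restrict_mem measurableSet_Ioi] with s hs
  exact norm_volterra_integrand_le (le_abs_self r) hs (cappedExp_pos _).le
    (cappedExp_le_one _)

lemma continuous_volterraOp {Q u : ℝ → ℝ} (b : ℝ) (hQ : Continuous Q) (hu : Measurable u) :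
    Continuous (volterraOp b Q u) := by
  refine (continuous_const.mul (continuous_pow 2)).add (continuous_iff_continuousAt.2 fun r => ?_)
  refine continuousAt_of_dominated
    (bound := fun s => (Ioc 0 (|r| + 1)).indicator (fun s => (|r| + 1) ^ 2 * (s / 4)) s * |Q s|)
    (Eventually.of_forall fun x => aestronglyMeasurable_volterra hQ hu x _) ?_
    (integrableOn_indicator_weight hQ _) ?_
  · filter_upwards [gt_mem_nhds (lt_add_one r)] with x hx
    filter_upwards [ae_restrict_mem measurableSet_Ioi] with s hs
    exact norm_volterra_integrand_le
      (hx.le.trans (by linarith [le_abs_self r])) hs (cappedExp_pos _).le (cappedExp_le_one _)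
  · filter_upwards [ae_restrict_mem measurableSet_Ioi] with s hs
    exact (((continuous_volterraKernel.comp (continuous_id.div_const s)).mul
      continuous_const).mul continuous_const).continuousAt

lemma volterraOp_mono {Q u v : ℝ → ℝ} {b c : ℝ} (hQ : Continuous Q) (hQ0 : ∀ s, 0 < s → 0 ≤ Q s)
    (hu : Measurable u) (hv : Measurable v) (hbc : b ≤ c) (h : ∀ s, 0 < s → u s ≤ v s) (r : ℝ) :
    volterraOp b Q u r ≤ volterraOp c Q v r := by
  refine add_le_add (mul_le_mul_of_nonneg_right hbc (sq_nonneg r))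
    (setIntegral_mono_on (integrableOn_volterra hQ hu r) (integrableOn_volterra hQ hv r)
      measurableSet_Ioi fun s hs => ?_)
  exact mul_le_mul_of_nonneg_left (mul_le_mul_of_nonneg_left (cappedExp_mono (h s hs)) (hQ0 s hs))
    (volterraKernel_mul_nonneg hs r)

/-- Picard iterates of the Volterra operator, starting from `b r²`. -/
noncomputable def volterraIter (b : ℝ) (Q : ℝ → ℝ) : ℕ → ℝ → ℝ
  | 0 => fun r => b * r ^ 2
  | n + 1 => volterraOp b Q (volterraIter b Q n)

lemma continuous_volterraIter (b : ℝ) {Q : ℝ → ℝ} (hQ : Continuous Q) (n : ℕ) :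
    Continuous (volterraIter b Q n) := by
  induction n with
  | zero => exact continuous_const.mul (continuous_pow 2)
  | succ n ih => exact continuous_volterraOp b hQ ih.measurable

/-- Kernel, curvature and nonlinearity are nonnegative and the nonlinearity increases, so the
iterates increase from b r²; convergence needs no contraction estimate. -/
lemma volterraIter_le_succ (b : ℝ) {Q : ℝ → ℝ} (hQ : Continuous Q)
    (hQ0 : ∀ s, 0 < s → 0 ≤ Q s) (n : ℕ) (r : ℝ) :
    volterraIter b Q n r ≤ volterraIter b Q (n + 1) r := by
  induction n generalizing r with
  | zero =>
    refine le_add_of_nonneg_right (setIntegral_nonneg measurableSet_Ioi fun s hs => ?_)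
    exact mul_nonneg (volterraKernel_mul_nonneg hs r) (mul_nonneg (hQ0 s hs) (cappedExp_pos _).le)
  | succ n ih =>
    exact volterraOp_mono hQ hQ0 (continuous_volterraIter b hQ n).measurable
      (continuous_volterraIter b hQ (n + 1)).measurable le_rfl (fun s _ => ih s) r

lemma volterraIter_mono (b : ℝ) {Q : ℝ → ℝ} (hQ : Continuous Q)
    (hQ0 : ∀ s, 0 < s → 0 ≤ Q s) (r : ℝ) : Monotone fun n => volterraIter b Q n r :=
  monotone_nat_of_le_succ fun n => volterraIter_le_succ b hQ hQ0 n r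

lemma bddAbove_volterraIter (b : ℝ) {Q : ℝ → ℝ} (hQ : Continuous Q)
    (hQ0 : ∀ s, 0 < s → 0 ≤ Q s) (r : ℝ) : BddAbove (range fun n => volterraIter b Q n r) := by
  refine ⟨b * r ^ 2 + ∫ s in Ioi 0,
    (Ioc 0 |r|).indicator (fun s => |r| ^ 2 * (s / 4)) s * |Q s|, ?_⟩
  rintro _ ⟨n, rfl⟩
  refine (volterraIter_le_succ b hQ hQ0 n r).trans (add_le_add le_rfl ?_)
  refine setIntegral_mono_on (integrableOn_volterra hQ (continuous_volterraIter b hQ n).measurable r)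
    (integrableOn_indicator_weight hQ |r|) measurableSet_Ioi fun s hs => (le_abs_self _).trans ?_
  exact norm_volterra_integrand_le (le_abs_self r) hs (cappedExp_pos _).le
    (cappedExp_le_one _)

/-- The solution of the Volterra equation `u = volterraOp b Q u`. -/
noncomputable def volterraSol (b : ℝ) (Q : ℝ → ℝ) (r : ℝ) : ℝ := ⨆ n, volterraIter b Q n r

variable {b b' : ℝ} {Q Q' : ℝ → ℝ}

lemma tendsto_volterraIter (b : ℝ) (hQ : Continuous Q) (hQ0 : ∀ s, 0 < s → 0 ≤ Q s) (r : ℝ) :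
    Tendsto (fun n => volterraIter b Q n r) atTop (𝓝 (volterraSol b Q r)) :=
  tendsto_atTop_ciSup (volterraIter_mono b hQ hQ0 r) (bddAbove_volterraIter b hQ hQ0 r)

lemma volterraIter_le_sol (b : ℝ) (hQ : Continuous Q) (hQ0 : ∀ s, 0 < s → 0 ≤ Q s) (n : ℕ)
    (r : ℝ) : volterraIter b Q n r ≤ volterraSol b Q r :=
  le_ciSup (bddAbove_volterraIter b hQ hQ0 r) n

lemma measurable_volterraSol (b : ℝ) (hQ : Continuous Q) : Measurable (volterraSol b Q) :=
  Measurable.iSup fun n => (continuous_volterraIter b hQ n).measurable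

lemma volterraSol_eq (b : ℝ) (hQ : Continuous Q) (hQ0 : ∀ s, 0 < s → 0 ≤ Q s) :
    volterraSol b Q = volterraOp b Q (volterraSol b Q) := by
  ext r
  refine tendsto_nhds_unique ((tendsto_add_atTop_iff_nat 1).2 (tendsto_volterraIter b hQ hQ0 r)) ?_
  refine tendsto_const_nhds.add (tendsto_integral_of_dominated_convergence
    (fun s => (Ioc 0 |r|).indicator (fun s => |r| ^ 2 * (s / 4)) s * |Q s|)
    (fun n => aestronglyMeasurable_volterra hQ (continuous_volterraIter b hQ n).measurable r _)
    (integrableOn_indicator_weight hQ |r|) (fun n => ?_) ?_)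
  · filter_upwards [ae_restrict_mem measurableSet_Ioi] with s hs
    exact norm_volterra_integrand_le (le_abs_self r) hs (cappedExp_pos _).le
      (cappedExp_le_one _)
  · refine Eventually.of_forall fun s => tendsto_const_nhds.mul (tendsto_const_nhds.mul ?_)
    exact (continuous_cappedExp.tendsto _).comp (tendsto_volterraIter b hQ hQ0 s)

lemma continuous_volterraSol (b : ℝ) (hQ : Continuous Q) (hQ0 : ∀ s, 0 < s → 0 ≤ Q s) :
    Continuous (volterraSol b Q) := by
  rw [volterraSol_eq b hQ hQ0]
  exact continuous_volterraOp b hQ (measurable_volterraSol b hQ)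

lemma volterraSol_mono (hQ : Continuous Q) (hQ0 : ∀ s, 0 < s → 0 ≤ Q s) (h : b ≤ b') (r : ℝ) :
    volterraSol b Q r ≤ volterraSol b' Q r := by
  refine le_of_tendsto_of_tendsto' (tendsto_volterraIter b hQ hQ0 r)
    (tendsto_volterraIter b' hQ hQ0 r) fun n => ?_
  induction n generalizing r with
  | zero => exact mul_le_mul_of_nonneg_right h (sq_nonneg r)
  | succ n ih =>
    exact volterraOp_mono hQ hQ0 (continuous_volterraIter b hQ n).measurable
      (continuous_volterraIter b' hQ n).measurable h (fun s _ => ih s) r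

/-- Grönwall's inequality in integral form, obtained by applying the differential form to the
primitive of `d`. -/
lemma le_exp_of_le_add_integral {d : ℝ → ℝ} (hd : Continuous d) (hd0 : ∀ r, 0 ≤ d r) {ε C R : ℝ}
    (hC : 0 < C) (h : ∀ r ∈ Icc 0 R, d r ≤ ε + C * ∫ s in (0 : ℝ)..r, d s) :
    ∀ r ∈ Icc 0 R, d r ≤ ε * Real.exp (C * r) := by
  intro r hr
  have hder : ∀ x, HasDerivAt (fun r => ∫ s in (0 : ℝ)..r, d s) (d x) x := fun x =>
    intervalIntegral.integral_hasDerivAt_right (hd.intervalIntegrable _ _)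
      (hd.stronglyMeasurableAtFilter _ _) hd.continuousAt
  have hnn : ∀ x, 0 ≤ x → 0 ≤ ∫ s in (0 : ℝ)..x, d s := fun x hx =>
    intervalIntegral.integral_nonneg hx fun s _ => hd0 s
  have key := norm_le_gronwallBound_of_norm_deriv_right_le (f := fun r => ∫ s in (0 : ℝ)..r, d s)
    (f' := d) (δ := 0) (K := C) (ε := ε) (a := 0) (b := R)
    (fun x _ => (hder x).continuousAt.continuousWithinAt)
    (fun x _ => (hder x).hasDerivWithinAt) (by simp) (fun x hx => by
      rw [Real.norm_of_nonneg (hd0 x), Real.norm_of_nonneg (hnn x hx.1)]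
      linarith [h x ⟨hx.1, hx.2.le⟩]) r hr
  rw [Real.norm_of_nonneg (hnn r hr.1), gronwallBound_of_K_ne_0 hC.ne', sub_zero] at key
  simp only [zero_mul, zero_add] at key
  have h2 := h r hr
  have h3 := mul_le_mul_of_nonneg_left key hC.le
  rw [← mul_assoc, mul_div_cancel₀ _ hC.ne'] at h3
  linarith

/-- Continuous dependence of the Volterra solution on the parameters. -/
lemma abs_volterraSol_sub_le (hQ : Continuous Q) (hQ0 : ∀ s, 0 < s → 0 ≤ Q s)
    (hQ' : Continuous Q') (hQ0' : ∀ s, 0 < s → 0 ≤ Q' s) {R M δ : ℝ} (hR : 0 < R) (hM : 0 < M)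
    (hQM : ∀ s ∈ Ioc 0 R, Q s ≤ M) (hδ : ∀ s ∈ Ioc 0 R, |Q s - Q' s| ≤ δ) :
    ∀ r ∈ Icc 0 R, |volterraSol b Q r - volterraSol b' Q' r| ≤
      (|b - b'| * R ^ 2 + δ * R ^ 4) * Real.exp (M * R ^ 3 * r) := by
  set u := volterraSol b Q
  set v := volterraSol b' Q'
  have hu : Continuous u := continuous_volterraSol b hQ hQ0
  have hv : Continuous v := continuous_volterraSol b' hQ' hQ0'
  have hd : Continuous fun r => |u r - v r| := (hu.sub hv).abs
  have hδ0 : 0 ≤ δ := (abs_nonneg _).trans (hδ R ⟨hR, le_rfl⟩)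
  refine le_exp_of_le_add_integral hd (fun r => abs_nonneg _) (by positivity) fun r hr => ?_
  have h1 : u r - v r = (b - b') * r ^ 2 + ∫ s in Ioi 0, volterraKernel (r / s) * s ^ 3 *
      (Q s * cappedExp (u s) - Q' s * cappedExp (v s)) := by
    have e1 : u r = volterraOp b Q u r := congrFun (volterraSol_eq b hQ hQ0) r
    have e2 : v r = volterraOp b' Q' v r := congrFun (volterraSol_eq b' hQ' hQ0') r
    rw [e1, e2, volterraOp, volterraOp]
    simp_rw [mul_sub (volterraKernel _ * _)]
    rw [integral_sub (integrableOn_volterra hQ hu.measurable r)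
      (integrableOn_volterra hQ' hv.measurable r)]
    ring
  have hint : IntegrableOn (fun s => R ^ 3 / 4 * (δ + M * (4 * |u s - v s|))) (Ioc 0 r) :=
    ((continuous_const.mul (continuous_const.add (continuous_const.mul
      (continuous_const.mul hd)))).integrableOn_Icc).mono_set Ioc_subset_Icc_self
  -- For s ≤ r ≤ R the kernel factor is at most r² s/4 ≤ R³/4, and it vanishes for s ≥ r. The
  -- nonlinearity differs by at most δ from the change of curvature and by 4M|u - v| from the change
  -- of solution.
  have h2 : |∫ s in Ioi 0, volterraKernel (r / s) * s ^ 3 *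
      (Q s * cappedExp (u s) - Q' s * cappedExp (v s))| ≤
      ∫ s in Ioc 0 r, R ^ 3 / 4 * (δ + M * (4 * |u s - v s|)) := by
    rw [← Real.norm_eq_abs, ← integral_indicator measurableSet_Ioc]
    refine (norm_integral_le_of_norm_le (g := (Ioc 0 r).indicator fun s =>
      R ^ 3 / 4 * (δ + M * (4 * |u s - v s|))) ?_ ?_).trans ?_
    · exact ((integrable_indicator_iff measurableSet_Ioc).2 hint).integrableOn
    · filter_upwards [ae_restrict_mem measurableSet_Ioi] with s hs
      have hs : 0 < s := hs
      by_cases hsr : s ≤ r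
      · have hsR : s ∈ Ioc 0 R := ⟨hs, hsr.trans hr.2⟩
        rw [indicator_of_mem (show s ∈ Ioc 0 r from ⟨hs, hsr⟩), norm_mul,
          Real.norm_of_nonneg (volterraKernel_mul_nonneg hs r)]
        refine mul_le_mul ?_ ?_ (norm_nonneg _) (by positivity)
        · refine (volterraKernel_mul_le r hs).trans ?_
          have : r ^ 2 ≤ R ^ 2 := pow_le_pow_left₀ hr.1 hr.2 2
          calc r ^ 2 * (s / 4) ≤ R ^ 2 * (R / 4) := by
                have := hsR.2
                gcongr
            _ = R ^ 3 / 4 := by ring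
        · have e : Q s * cappedExp (u s) - Q' s * cappedExp (v s) =
              (Q s - Q' s) * cappedExp (v s) + Q s * (cappedExp (u s) - cappedExp (v s)) := by ring
          rw [e, Real.norm_eq_abs]
          refine (abs_add_le _ _).trans (add_le_add ?_ ?_)
          · rw [abs_mul, abs_of_pos (cappedExp_pos _)]
            exact (mul_le_of_le_one_right (abs_nonneg _) (cappedExp_le_one _)).trans (hδ s hsR)
          · rw [abs_mul, abs_of_nonneg (hQ0 s hs)]
            exact mul_le_mul (hQM s hsR) (abs_cappedExp_sub_le _ _) (abs_nonneg _) hM.le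
      · rw [volterraKernel_of_le hs (not_le.1 hsr).le]
        simp only [zero_mul, norm_zero]
        exact indicator_nonneg (fun s _ => by positivity) s
    · exact setIntegral_le_integral ((integrable_indicator_iff measurableSet_Ioc).2 hint)
        (Eventually.of_forall fun s => indicator_nonneg (fun s _ => by positivity) s)
  have h6 : ∫ s in Ioc 0 r, R ^ 3 / 4 * (δ + M * (4 * |u s - v s|)) =
      R ^ 3 / 4 * (r * δ + M * (4 * ∫ s in (0 : ℝ)..r, |u s - v s|)) := by
    have hi : IntervalIntegrable (fun s => M * (4 * |u s - v s|)) volume 0 r :=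
      (continuous_const.mul (continuous_const.mul hd)).intervalIntegrable _ _
    rw [← intervalIntegral.integral_of_le hr.1, intervalIntegral.integral_const_mul,
      intervalIntegral.integral_add intervalIntegrable_const hi,
      intervalIntegral.integral_const_mul, intervalIntegral.integral_const_mul,
      intervalIntegral.integral_const, smul_eq_mul, sub_zero]
  rw [h6] at h2
  rw [h1]
  refine (abs_add_le _ _).trans ?_
  rw [abs_mul, abs_of_nonneg (sq_nonneg r)]
  have h3 : |b - b'| * r ^ 2 ≤ |b - b'| * R ^ 2 :=
    mul_le_mul_of_nonneg_left (pow_le_pow_left₀ hr.1 hr.2 2) (abs_nonneg _)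
  have h4 : r * δ * R ^ 3 ≤ R * δ * R ^ 3 := by
    have := hr.2
    gcongr
  have h5 : 0 ≤ δ * R ^ 4 := by positivity
  nlinarith

end Volterra

/-! ### The shooting problem for the quadratic coefficient. -/

section Shooting

open Set Filter Topology

variable {p b m : ℝ} {Q u : ℝ → ℝ}

lemma integrableOn_gaussian_weight (hp : 0 < p) (hm : m < 0) :
    IntegrableOn (fun s : ℝ => s / 4 * ((1 + s ^ (4 * p)) * Real.exp (4 * (m * s ^ 2)))) (Ioi 0) := by
  have h1 := integrableOn_rpow_mul_exp_neg_mul_sq (b := -(4 * m)) (by linarith)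
    (s := 1) (by norm_num)
  have h2 := integrableOn_rpow_mul_exp_neg_mul_sq (b := -(4 * m)) (by linarith)
    (s := 1 + 4 * p) (by linarith)
  refine IntegrableOn.congr_fun ((h1.add h2).const_mul (1 / 4)) (fun s hs => ?_) measurableSet_Ioi
  have hs : 0 < s := hs
  simp only [Pi.add_apply]
  rw [Real.rpow_add hs, Real.rpow_one, show -(-(4 * m)) * s ^ 2 = 4 * (m * s ^ 2) by ring]
  ring

lemma weight_le_gaussian (hQ1 : ∀ s, 0 < s → Q s ≤ 1 + s ^ (4 * p)) {s : ℝ} (hs : 0 < s)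
    (hus : u s ≤ m * s ^ 2) : s / 4 * (Q s * cappedExp (u s)) ≤
      s / 4 * ((1 + s ^ (4 * p)) * Real.exp (4 * (m * s ^ 2))) := by
  have h1 : cappedExp (u s) ≤ Real.exp (4 * (m * s ^ 2)) :=
    (cappedExp_le_exp _).trans (Real.exp_le_exp.2 (by linarith))
  have h2 := hQ1 s hs
  have h3 := (cappedExp_pos (u s)).le
  gcongr

lemma weight_nonneg (hQ0 : ∀ s, 0 < s → 0 ≤ Q s) {s : ℝ} (hs : 0 < s) (t : ℝ) :
    0 ≤ s / 4 * (Q s * cappedExp t) :=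
  mul_nonneg (by positivity) (mul_nonneg (hQ0 s hs) (cappedExp_pos _).le)

lemma measurable_weight (hQ : Continuous Q) (hu : Measurable u) :
    Measurable fun s => s / 4 * (Q s * cappedExp (u s)) :=
  (measurable_id.div_const 4).mul (hQ.measurable.mul (continuous_cappedExp.measurable.comp hu))

lemma integrableOn_weight (hp : 0 < p) (hm : m < 0) (hQ : Continuous Q)
    (hQ0 : ∀ s, 0 < s → 0 ≤ Q s) (hQ1 : ∀ s, 0 < s → Q s ≤ 1 + s ^ (4 * p)) (hu : Measurable u)
    (h : ∀ s, 0 < s → u s ≤ m * s ^ 2) :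
    IntegrableOn (fun s => s / 4 * (Q s * cappedExp (u s))) (Ioi 0) := by
  refine (integrableOn_gaussian_weight hp hm).mono' (measurable_weight hQ hu).aestronglyMeasurable ?_
  filter_upwards [ae_restrict_mem measurableSet_Ioi] with s hs
  rw [Real.norm_of_nonneg (weight_nonneg hQ0 hs _)]
  exact weight_le_gaussian hQ1 hs (h s hs)

lemma volterraOp_le (hQ : Continuous Q) (hQ0 : ∀ s, 0 < s → 0 ≤ Q s) (hu : Measurable u)
    (hi : IntegrableOn (fun s => s / 4 * (Q s * cappedExp (u s))) (Ioi 0)) (r : ℝ) :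
    volterraOp b Q u r ≤ (b + ∫ s in Ioi 0, s / 4 * (Q s * cappedExp (u s))) * r ^ 2 := by
  rw [add_mul, volterraOp, ← integral_mul_const]
  refine add_le_add le_rfl (setIntegral_mono_on (integrableOn_volterra hQ hu r) (hi.mul_const _)
    measurableSet_Ioi fun s hs => ?_)
  have := mul_le_mul_of_nonneg_right (volterraKernel_mul_le r hs)
    (mul_nonneg (hQ0 s hs) (cappedExp_pos (u s)).le)
  linarith

/-- A barrier principle: bounds by `m r²` propagate along the Picard iteration. -/
lemma volterraSol_le (hp : 0 < p) (hm : m < 0) (hbm : b ≤ m) (hQ : Continuous Q)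
    (hQ0 : ∀ s, 0 < s → 0 ≤ Q s) (hQ1 : ∀ s, 0 < s → Q s ≤ 1 + s ^ (4 * p))
    (H : ∀ v : ℝ → ℝ, Continuous v → (∀ s, 0 < s → v s ≤ m * s ^ 2) →
      (∀ s, 0 < s → v s ≤ volterraSol b Q s) →
      b + ∫ s in Ioi 0, s / 4 * (Q s * cappedExp (v s)) ≤ m) (r : ℝ) :
    volterraSol b Q r ≤ m * r ^ 2 := by
  -- The bound is carried through the iterates: each lies below m r² by induction, which supplies
  -- Gaussian integrability, and below the limit by monotonicity. These are the two facts that `H`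
  -- may use.
  refine le_of_tendsto' (tendsto_volterraIter b hQ hQ0 r) fun n => ?_
  induction n generalizing r with
  | zero => exact mul_le_mul_of_nonneg_right hbm (sq_nonneg r)
  | succ n ih =>
    have hc := continuous_volterraIter b hQ n
    refine (volterraOp_le hQ hQ0 hc.measurable (integrableOn_weight hp hm hQ hQ0 hQ1 hc.measurable
      fun s _ => ih s) r).trans (mul_le_mul_of_nonneg_right ?_ (sq_nonneg r))
    exact H _ hc (fun s _ => ih s) fun s _ => volterraIter_le_sol b hQ hQ0 n s

/-- The mass moment that has to balance `-b` for the Volterra solution to be normal. -/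
noncomputable def volterraMoment (b : ℝ) (Q : ℝ → ℝ) : ENNReal :=
  ∫⁻ s in Ioi 0, ENNReal.ofReal (s / 4 * (Q s * cappedExp (volterraSol b Q s)))

lemma volterraMoment_mono {b' : ℝ} (hQ : Continuous Q) (hQ0 : ∀ s, 0 < s → 0 ≤ Q s)
    (h : b ≤ b') : volterraMoment b Q ≤ volterraMoment b' Q := by
  refine setLIntegral_mono' measurableSet_Ioi fun s hs => ENNReal.ofReal_le_ofReal ?_
  have hs : 0 < s := hs
  exact mul_le_mul_of_nonneg_left (mul_le_mul_of_nonneg_left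
    (cappedExp_mono (volterraSol_mono hQ hQ0 h s)) (hQ0 s hs)) (by positivity)

lemma volterraMoment_eq (hQ0 : ∀ s, 0 < s → 0 ≤ Q s)
    (hi : IntegrableOn (fun s => s / 4 * (Q s * cappedExp (volterraSol b Q s))) (Ioi 0)) :
    volterraMoment b Q =
      ENNReal.ofReal (∫ s in Ioi 0, s / 4 * (Q s * cappedExp (volterraSol b Q s))) :=
  (ofReal_integral_eq_lintegral_ofReal hi ((ae_restrict_mem measurableSet_Ioi).mono
    fun _ hs => weight_nonneg hQ0 hs _)).symm

lemma integrableOn_weight_of_moment (hQ : Continuous Q) (hQ0 : ∀ s, 0 < s → 0 ≤ Q s)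
    (h : volterraMoment b Q < ⊤) :
    IntegrableOn (fun s => s / 4 * (Q s * cappedExp (volterraSol b Q s))) (Ioi 0) := by
  refine ⟨(measurable_weight hQ (measurable_volterraSol b hQ)).aestronglyMeasurable, ?_⟩
  rw [hasFiniteIntegral_iff_ofReal ((ae_restrict_mem measurableSet_Ioi).mono
    fun s hs => weight_nonneg hQ0 hs _)]
  exact h

/-- The moment is nondecreasing in b while -b is strictly decreasing. -/
lemma volterraMoment_unique {b' : ℝ} (hQ : Continuous Q) (hQ0 : ∀ s, 0 < s → 0 ≤ Q s)
    (hb : b ≤ 0) (hb' : b' ≤ 0) (h : volterraMoment b Q = ENNReal.ofReal (-b))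
    (h' : volterraMoment b' Q = ENNReal.ofReal (-b')) : b = b' := by
  wlog hlt : b ≤ b' generalizing b b'
  · exact (this hb' hb h' h (not_le.1 hlt).le).symm
  have := volterraMoment_mono hQ hQ0 hlt
  rw [h, h', ENNReal.ofReal_le_ofReal_iff (by linarith)] at this
  linarith

/-- A lower bound for the shooting parameter that is uniform in the curvature function. -/
noncomputable def shootingBound (p : ℝ) : ℝ :=
  max 1 (2 * ∫ s in Ioi (0 : ℝ), s / 4 * ((1 + s ^ (4 * p)) * Real.exp (4 * (-(1 / 2) * s ^ 2))))

lemma volterraMoment_shootingBound_le (hp : 0 < p) (hQ : Continuous Q)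
    (hQ0 : ∀ s, 0 < s → 0 ≤ Q s) (hQ1 : ∀ s, 0 < s → Q s ≤ 1 + s ^ (4 * p)) :
    volterraMoment (-shootingBound p) Q ≤ ENNReal.ofReal (shootingBound p / 2) := by
  set B := shootingBound p with hB
  have hB1 : 1 ≤ B := le_max_left _ _
  -- The barrier is -(B/2) r². Since B ≥ 1 it lies below -r²/2, whose Gaussian moment is at most B/2
  -- by the choice of B, and -B + B/2 = -B/2 closes the argument.
  have key : ∀ v : ℝ → ℝ, Measurable v → (∀ s, 0 < s → v s ≤ -(B / 2) * s ^ 2) →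
      ∫ s in Ioi 0, s / 4 * (Q s * cappedExp (v s)) ≤ B / 2 := fun v hv h => by
    have h' : ∀ s, 0 < s → v s ≤ -(1 / 2) * s ^ 2 := fun s hs =>
      (h s hs).trans (mul_le_mul_of_nonneg_right (by linarith) (sq_nonneg s))
    have hB2 : 2 * ∫ s in Ioi (0 : ℝ), s / 4 * ((1 + s ^ (4 * p)) *
        Real.exp (4 * (-(1 / 2) * s ^ 2))) ≤ B := le_max_right _ _
    have := setIntegral_mono_on (integrableOn_weight hp (by norm_num) hQ hQ0 hQ1 hv h')
      (integrableOn_gaussian_weight hp (by norm_num)) measurableSet_Ioi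
      fun s hs => weight_le_gaussian hQ1 hs (h' s hs)
    linarith
  have hle := volterraSol_le hp (m := -(B / 2)) (b := -B) (by linarith) (by linarith) hQ hQ0 hQ1
    fun v hv h _ => by linarith [key v hv.measurable h]
  have hi := integrableOn_weight hp (by linarith) hQ hQ0 hQ1 (measurable_volterraSol (-B) hQ)
    fun s _ => hle s
  rw [volterraMoment_eq hQ0 hi]
  exact ENNReal.ofReal_le_ofReal (key _ (measurable_volterraSol (-B) hQ) fun s _ => hle s)

/-- On a bounded interval the cap gives a dominating function, so no decay of the solutions is
needed. -/
lemma tendsto_head_weight {ι : Type*} {l : Filter ι} [l.IsCountablyGenerated] {F : ι → ℝ → ℝ}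
    {q : ι → ℝ → ℝ} (hq : ∀ i, Continuous (q i)) (hq0 : ∀ i s, 0 < s → 0 ≤ q i s)
    (hq1 : ∀ i s, 0 < s → q i s ≤ 1 + s ^ (4 * p)) (hp : 0 < p) (hF : ∀ i, Measurable (F i))
    (hqQ : ∀ s, 0 < s → Tendsto (fun i => q i s) l (𝓝 (Q s)))
    (hFu : ∀ s, 0 < s → Tendsto (fun i => F i s) l (𝓝 (u s))) (R : ℝ) :
    Tendsto (fun i => ∫ s in Ioc 0 R, s / 4 * (q i s * cappedExp (F i s))) l
      (𝓝 (∫ s in Ioc 0 R, s / 4 * (Q s * cappedExp (u s)))) := by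
  have hc : Continuous fun s : ℝ => s / 4 * (1 + s ^ (4 * p)) :=
    (continuous_id.div_const 4).mul
      (continuous_const.add (Real.continuous_rpow_const (by positivity)))
  refine tendsto_integral_filter_of_dominated_convergence (fun s : ℝ => s / 4 * (1 + s ^ (4 * p)))
    (Eventually.of_forall fun i => (measurable_weight (hq i) (hF i)).aestronglyMeasurable)
    (Eventually.of_forall fun i => ?_) (hc.integrableOn_Icc.mono_set Ioc_subset_Icc_self) ?_
  · filter_upwards [ae_restrict_mem measurableSet_Ioc] with s hs
    have hs0 : 0 < s := hs.1
    rw [Real.norm_of_nonneg (weight_nonneg (hq0 i) hs0 _)]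
    exact mul_le_mul_of_nonneg_left ((mul_le_of_le_one_right (hq0 i s hs0)
      (cappedExp_le_one _)).trans (hq1 i s hs0)) (by positivity)
  · filter_upwards [ae_restrict_mem measurableSet_Ioc] with s hs
    exact tendsto_const_nhds.mul ((hqQ s hs.1).mul
      ((continuous_cappedExp.tendsto _).comp (hFu s hs.1)))

lemma tendsto_volterraSol {ι : Type*} {l : Filter ι} {β : ι → ℝ} {q : ι → ℝ → ℝ}
    (hq : ∀ i, Continuous (q i)) (hq0 : ∀ i s, 0 < s → 0 ≤ q i s) (hQ : Continuous Q)
    (hQ0 : ∀ s, 0 < s → 0 ≤ Q s) (hβ : Tendsto β l (𝓝 b)) {r M : ℝ} (hr : 0 < r) (hM : 0 < M)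
    (hQM : ∀ s ∈ Ioc 0 r, Q s ≤ M) {δ : ι → ℝ} (hδ : Tendsto δ l (𝓝 0))
    (hqδ : ∀ i, ∀ s ∈ Ioc 0 r, |Q s - q i s| ≤ δ i) :
    Tendsto (fun i => volterraSol (β i) (q i) r) l (𝓝 (volterraSol b Q r)) := by
  rw [tendsto_iff_dist_tendsto_zero]
  have h0 : Tendsto (fun i => (|b - β i| * r ^ 2 + δ i * r ^ 4) * Real.exp (M * r ^ 3 * r)) l
      (𝓝 0) := by
    have := ((((tendsto_const_nhds (x := b)).sub hβ).abs.mul_const (r ^ 2)).add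
      (hδ.mul_const (r ^ 4))).mul_const (Real.exp (M * r ^ 3 * r))
    simpa using this
  refine squeeze_zero (fun _ => dist_nonneg) (fun i => ?_) h0
  rw [dist_comm, Real.dist_eq]
  exact abs_volterraSol_sub_le hQ hQ0 (hq i) (hq0 i) hr hM hQM (hqδ i) r ⟨hr.le, le_rfl⟩

lemma le_one_add_rpow_of_le (hp : 0 < p) (hQ1 : ∀ s, 0 < s → Q s ≤ 1 + s ^ (4 * p)) (R : ℝ) :
    ∀ s ∈ Ioc 0 R, Q s ≤ 1 + R ^ (4 * p) := fun s hs =>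
  (hQ1 s hs.1).trans (add_le_add le_rfl (Real.rpow_le_rpow hs.1.le hs.2 (by positivity)))

/-- Continuity of the Volterra solution in the shooting parameter. -/
lemma tendsto_volterraSol_param {ι : Type*} {l : Filter ι} {β : ι → ℝ} (hp : 0 < p)
    (hQ : Continuous Q) (hQ0 : ∀ s, 0 < s → 0 ≤ Q s) (hQ1 : ∀ s, 0 < s → Q s ≤ 1 + s ^ (4 * p))
    (hβ : Tendsto β l (𝓝 b)) {r : ℝ} (hr : 0 < r) :
    Tendsto (fun i => volterraSol (β i) Q r) l (𝓝 (volterraSol b Q r)) :=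
  tendsto_volterraSol (fun _ => hQ) (fun _ => hQ0) hQ hQ0 hβ hr
    (M := 1 + r ^ (4 * p)) (by positivity) (le_one_add_rpow_of_le hp hQ1 r)
    (tendsto_const_nhds (x := (0 : ℝ))) (fun _ s _ => by simp)

/-- Strict inequality is an open condition to the right: a slightly larger b stays below a quadratic
barrier, whose Gaussian tail controls the moment near infinity. -/
lemma exists_moment_lt_of_moment_lt (hp : 0 < p) (hQ : Continuous Q)
    (hQ0 : ∀ s, 0 < s → 0 ≤ Q s) (hQ1 : ∀ s, 0 < s → Q s ≤ 1 + s ^ (4 * p))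
    (h : volterraMoment b Q < ENNReal.ofReal (-b)) :
    ∃ b' > b, b' ≤ 0 ∧ volterraMoment b' Q ≤ ENNReal.ofReal (-b') := by
  have hi := integrableOn_weight_of_moment hQ hQ0 (h.trans ENNReal.ofReal_lt_top)
  rw [volterraMoment_eq hQ0 hi, ENNReal.ofReal_lt_ofReal_iff_of_nonneg
    (setIntegral_nonneg measurableSet_Ioi fun s hs => weight_nonneg hQ0 hs _)] at h
  set J := ∫ s in Ioi 0, s / 4 * (Q s * cappedExp (volterraSol b Q s)) with hJ
  -- The gap `l` is negative. Increasing b, changing the moment on (0, R], and adding the tail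
  -- beyond R each cost at most -l/8, leaving b' plus the moment at most 5l/8 ≤ l/2, the coefficient
  -- of the barrier.
  set l := b + J with hl
  have hl0 : l < 0 := by linarith
  have hg := integrableOn_gaussian_weight hp (m := l / 2) (by linarith)
  obtain ⟨R, hR0, hR⟩ : ∃ R > 0, ∫ s in Ioi R, s / 4 * ((1 + s ^ (4 * p)) *
      Real.exp (4 * (l / 2 * s ^ 2))) < -l / 8 := by
    have h1 := intervalIntegral_tendsto_integral_Ioi 0 hg tendsto_id
    have h2 := h1.eventually (lt_mem_nhds (show (∫ s in Ioi (0 : ℝ), s / 4 * ((1 + s ^ (4 * p)) *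
      Real.exp (4 * (l / 2 * s ^ 2)))) - (-l / 8) < _ by linarith))
    obtain ⟨R, hR, hR0⟩ := (h2.and (eventually_gt_atTop 0)).exists
    refine ⟨R, hR0, ?_⟩
    rw [id, intervalIntegral.integral_of_le (le_of_lt hR0)] at hR
    have hR0' : (0 : ℝ) ≤ R := le_of_lt hR0
    have h3 := setIntegral_union (f := fun s : ℝ => s / 4 * ((1 + s ^ (4 * p)) *
      Real.exp (4 * (l / 2 * s ^ 2)))) (μ := volume) (Ioc_disjoint_Ioi (le_refl R))
      measurableSet_Ioi (hg.mono_set Ioc_subset_Ioi_self)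
      (hg.mono_set (Ioi_subset_Ioi hR0'))
    rw [Ioc_union_Ioi_eq_Ioi hR0'] at h3
    linarith
  have ht := tendsto_head_weight (l := 𝓝[>] b) (F := fun β => volterraSol β Q) (q := fun _ => Q)
    (fun _ => hQ) (fun _ => hQ0) (fun _ => hQ1) hp (fun β => measurable_volterraSol β hQ)
    (fun s _ => tendsto_const_nhds) (fun s hs => tendsto_volterraSol_param hp hQ hQ0 hQ1
      (tendsto_id.mono_left nhdsWithin_le_nhds) hs) R
  have hhead : ∫ s in Ioc 0 R, s / 4 * (Q s * cappedExp (volterraSol b Q s)) ≤ J :=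
    setIntegral_mono_set hi ((ae_restrict_mem measurableSet_Ioi).mono
      fun s hs => weight_nonneg hQ0 hs _) Ioc_subset_Ioi_self.eventuallyLE
  have ev1 := ht.eventually (gt_mem_nhds (show _ < J + -l / 8 by linarith))
  have ev2 : ∀ᶠ β in 𝓝[>] b, β < b + -l / 8 :=
    mem_nhdsWithin_of_mem_nhds (gt_mem_nhds (by linarith))
  obtain ⟨b', ⟨h1, h2⟩, hb'⟩ := ((ev1.and ev2).and self_mem_nhdsWithin).exists
  have hb'0 : b < b' := hb'
  have key : ∀ v : ℝ → ℝ, Measurable v → (∀ s, 0 < s → v s ≤ l / 2 * s ^ 2) →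
      (∀ s, 0 < s → v s ≤ volterraSol b' Q s) →
      b' + ∫ s in Ioi 0, s / 4 * (Q s * cappedExp (v s)) ≤ l / 2 := by
    intro v hv hvl hvs
    have hvi := integrableOn_weight hp (by linarith : l / 2 < 0) hQ hQ0 hQ1 hv hvl
    have hsplit := setIntegral_union (f := fun s => s / 4 * (Q s * cappedExp (v s))) (μ := volume)
      (Ioc_disjoint_Ioi (le_refl R)) measurableSet_Ioi (hvi.mono_set Ioc_subset_Ioi_self)
      (hvi.mono_set (Ioi_subset_Ioi hR0.le))
    rw [Ioc_union_Ioi_eq_Ioi hR0.le] at hsplit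
    have hA : ∫ s in Ioc 0 R, s / 4 * (Q s * cappedExp (v s)) ≤
        ∫ s in Ioc 0 R, s / 4 * (Q s * cappedExp (volterraSol b' Q s)) := by
      refine setIntegral_mono_on (hvi.mono_set Ioc_subset_Ioi_self) ?_ measurableSet_Ioc fun s hs =>
        mul_le_mul_of_nonneg_left (mul_le_mul_of_nonneg_left (cappedExp_mono (hvs s hs.1))
          (hQ0 s hs.1)) (by linarith [hs.1])
      exact (((continuous_id.div_const 4).mul (hQ.mul (continuous_cappedExp.comp
        (continuous_volterraSol b' hQ hQ0)))).integrableOn_Icc).mono_set Ioc_subset_Icc_self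
    have hB : ∫ s in Ioi R, s / 4 * (Q s * cappedExp (v s)) ≤
        ∫ s in Ioi R, s / 4 * ((1 + s ^ (4 * p)) * Real.exp (4 * (l / 2 * s ^ 2))) :=
      setIntegral_mono_on (hvi.mono_set (Ioi_subset_Ioi hR0.le))
        (hg.mono_set (Ioi_subset_Ioi hR0.le)) measurableSet_Ioi fun s hs => by
          have hs0 : 0 < s := hR0.trans hs
          exact weight_le_gaussian hQ1 hs0 (hvl s hs0)
    rw [hsplit]
    linarith
  have hJ0 : 0 ≤ J := setIntegral_nonneg measurableSet_Ioi fun s hs => weight_nonneg hQ0 hs _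
  have hle := volterraSol_le hp (by linarith : l / 2 < 0) (by linarith : b' ≤ l / 2) hQ hQ0 hQ1
    fun v hv h1 h2 => key v hv.measurable h1 h2
  have hi' := integrableOn_weight hp (by linarith) hQ hQ0 hQ1 (measurable_volterraSol b' hQ)
    fun s _ => hle s
  have hfin := key _ (measurable_volterraSol b' hQ) (fun s _ => hle s) fun s _ => le_rfl
  refine ⟨b', hb'0, by linarith, ?_⟩
  rw [volterraMoment_eq hQ0 hi']
  exact ENNReal.ofReal_le_ofReal (by linarith)

/-- The shooting problem is solvable. -/
theorem exists_volterraMoment_eq (hp : 0 < p) (hQ : Continuous Q)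
    (hQ0 : ∀ s, 0 < s → 0 ≤ Q s) (hQ1 : ∀ s, 0 < s → Q s ≤ 1 + s ^ (4 * p)) :
    ∃ b ∈ Icc (-shootingBound p) 0, volterraMoment b Q = ENNReal.ofReal (-b) := by
  have hB1 : 1 ≤ shootingBound p := le_max_left _ _
  -- The supremum of the subsolutions is the solution: Fatou's lemma places it in `S`, and strict
  -- inequality there would allow a larger element.
  set S := {b : ℝ | b ≤ 0 ∧ volterraMoment b Q ≤ ENNReal.ofReal (-b)} with hS
  have hmem : -shootingBound p ∈ S := by
    refine ⟨by linarith, (volterraMoment_shootingBound_le hp hQ hQ0 hQ1).trans ?_⟩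
    exact ENNReal.ofReal_le_ofReal (by linarith)
  have hbdd : BddAbove S := ⟨0, fun b hb => hb.1⟩
  obtain ⟨β, -, hβ, hβS⟩ := exists_seq_tendsto_sSup ⟨_, hmem⟩ hbdd
  set b := sSup S
  have hb0 : b ≤ 0 := csSup_le ⟨_, hmem⟩ fun b hb => hb.1
  have hle : volterraMoment b Q ≤ ENNReal.ofReal (-b) := by
    have h1 : volterraMoment b Q ≤
        liminf (fun n => volterraMoment (β n) Q) atTop := by
      refine le_trans (le_of_eq ?_) (lintegral_liminf_le fun n =>
        (measurable_weight hQ (measurable_volterraSol (β n) hQ)).ennreal_ofReal)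
      refine setLIntegral_congr_fun measurableSet_Ioi fun s hs => ?_
      refine (Tendsto.liminf_eq ?_).symm
      refine (ENNReal.continuous_ofReal.tendsto _).comp (tendsto_const_nhds.mul
        (tendsto_const_nhds.mul ((continuous_cappedExp.tendsto _).comp ?_)))
      exact tendsto_volterraSol_param hp hQ hQ0 hQ1 hβ hs
    refine h1.trans ?_
    have h2 : Tendsto (fun n => ENNReal.ofReal (-β n)) atTop (𝓝 (ENNReal.ofReal (-b))) :=
      (ENNReal.continuous_ofReal.tendsto _).comp hβ.neg
    rw [← h2.liminf_eq]
    exact liminf_le_liminf (Eventually.of_forall fun n => (hβS n).2)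
  refine ⟨b, ⟨le_csSup hbdd hmem, hb0⟩, hle.eq_of_not_lt fun hlt => ?_⟩
  obtain ⟨b', hb', hb'0, hb'1⟩ := exists_moment_lt_of_moment_lt hp hQ hQ0 hQ1 hlt
  exact absurd (le_csSup hbdd ⟨hb'0, hb'1⟩) (not_le.2 hb')

end Shooting

/-! ### The interpolating family and attainment of every admissible mass. -/

section Family

open Set Filter Topology

variable {p b c d : ℝ}

lemma continuous_powerProfile (hp : 0 < p) (c d : ℝ) :
    Continuous fun s : ℝ => c + d * s ^ (4 * p) :=
  continuous_const.add (continuous_const.mul (Real.continuous_rpow_const (by positivity)))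

lemma powerProfile_nonneg (p : ℝ) (hc : 0 ≤ c) (hd : 0 ≤ d) :
    ∀ s : ℝ, 0 < s → 0 ≤ c + d * s ^ (4 * p) := fun s hs => by positivity

lemma powerProfile_le (p : ℝ) (hc : c ≤ 1) (hd : d ≤ 1) :
    ∀ s : ℝ, 0 < s → c + d * s ^ (4 * p) ≤ 1 + s ^ (4 * p) := fun s hs =>
  add_le_add hc (mul_le_of_le_one_left (by positivity) hd)

/-- A balanced Volterra solution is a logarithmic potential. -/
lemma volterraSol_eq_neg_integral {Q : ℝ → ℝ} (hQ : Continuous Q)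
    (hQ0 : ∀ s, 0 < s → 0 ≤ Q s) (hb : b ≤ 0)
    (h : volterraMoment b Q = ENNReal.ofReal (-b)) (r : ℝ) :
    IntegrableOn (fun s => logKernel (r / s) * (Q s * cappedExp (volterraSol b Q s) * s ^ 3))
      (Ioi 0) ∧
    volterraSol b Q r =
      -∫ s in Ioi 0, logKernel (r / s) * (Q s * cappedExp (volterraSol b Q s) * s ^ 3) := by
  have hi := integrableOn_weight_of_moment hQ hQ0 (by rw [h]; exact ENNReal.ofReal_lt_top)
  have hJ : ∫ s in Ioi 0, s / 4 * (Q s * cappedExp (volterraSol b Q s)) = -b := by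
    rw [volterraMoment_eq hQ0 hi, ENNReal.ofReal_eq_ofReal_iff (setIntegral_nonneg measurableSet_Ioi
      fun s hs => weight_nonneg hQ0 hs _) (by linarith)] at h
    exact h
  have hv := integrableOn_volterra hQ (measurable_volterraSol b hQ) r
  -- The moment condition says that the quadratic part of the kernel splitting integrates to -b r²,
  -- exactly cancelling the quadratic term of the Volterra equation.
  have heq : ∀ s ∈ Ioi (0 : ℝ), r ^ 2 * (s / 4 * (Q s * cappedExp (volterraSol b Q s))) -
      volterraKernel (r / s) * s ^ 3 * (Q s * cappedExp (volterraSol b Q s)) =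
      logKernel (r / s) * (Q s * cappedExp (volterraSol b Q s) * s ^ 3) := fun s hs => by
    have : s ≠ 0 := ne_of_gt hs
    rw [logKernel_eq]
    field_simp
  refine ⟨IntegrableOn.congr_fun ((hi.const_mul (r ^ 2)).sub hv) heq measurableSet_Ioi, ?_⟩
  rw [← setIntegral_congr_fun measurableSet_Ioi heq, integral_sub (hi.const_mul _) hv,
    integral_const_mul, hJ]
  have := congrFun (volterraSol_eq b hQ hQ0) r
  rw [volterraOp] at this
  linarith

/-- The potential of a nonnegative density against a nonnegative kernel has a sign. Hence the cap is
inactive and the true exponential equation holds. -/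
lemma volterraSol_nonpos {Q : ℝ → ℝ} (hQ : Continuous Q)
    (hQ0 : ∀ s, 0 < s → 0 ≤ Q s) (hb : b ≤ 0)
    (h : volterraMoment b Q = ENNReal.ofReal (-b)) (r : ℝ) : volterraSol b Q r ≤ 0 := by
  rw [(volterraSol_eq_neg_integral hQ hQ0 hb h r).2, neg_nonpos]
  exact setIntegral_nonneg measurableSet_Ioi fun s hs => mul_nonneg (logKernel_nonneg _)
    (mul_nonneg (mul_nonneg (hQ0 s hs) (cappedExp_pos _).le) (pow_nonneg (le_of_lt hs) 3))

/-- Potentials decay fast enough to have finite mass. -/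
lemma integrableOn_density_of_potential (hp : 0 < p) (hc : 0 ≤ c) (hd : 0 ≤ d) (hc1 : c ≤ 1)
    (hd1 : d ≤ 1) {U : ℝ → ℝ} (hU : Continuous U)
    (hK : ∀ r, IntegrableOn (fun s => logKernel (r / s) *
      ((c + d * s ^ (4 * p)) * Real.exp (4 * U s) * s ^ 3)) (Ioi 0))
    (h : ∀ r, U r = -∫ s in Ioi 0, logKernel (r / s) *
      ((c + d * s ^ (4 * p)) * Real.exp (4 * U s) * s ^ 3)) :
    IntegrableOn (fun s => (c + d * s ^ (4 * p)) * Real.exp (4 * U s) * s ^ 3) (Ioi 0) := by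
  set f : ℝ → ℝ := fun s => (c + d * s ^ (4 * p)) * Real.exp (4 * U s) * s ^ 3 with hf
  have hfc : Continuous f := ((continuous_powerProfile hp c d).mul
    (Real.continuous_exp.comp (continuous_const.mul hU))).mul (continuous_pow 3)
  have hf0 : ∀ s, 0 < s → 0 ≤ f s := fun s hs => by positivity
  have hfI : ∀ R, IntegrableOn f (Ioc 0 R) := fun R =>
    hfc.integrableOn_Icc.mono_set Ioc_subset_Icc_self
  -- Either the partial masses never exceed p + 2, and integrability follows, or one of them does.
  -- In that case U(r) ≤ -(p+2) log(r/R) for r > R, and the density is O(r^{4p - 4(p+2) + 3}) =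
  -- O(r⁻⁵).
  by_cases hbig : ∃ R, 1 ≤ R ∧ p + 2 < ∫ s in Ioc 0 R, f s
  · obtain ⟨R, hR1, hR⟩ := hbig
    have hR0 : 0 < R := by linarith
    have hUle : ∀ r, R < r → U r ≤ -((p + 2) * Real.log (r / R)) := fun r hr => by
      have hlog : 0 ≤ Real.log (r / R) := Real.log_nonneg ((one_le_div hR0).2 hr.le)
      rw [h r, neg_le_neg_iff]
      calc (p + 2) * Real.log (r / R) ≤ (∫ s in Ioc 0 R, f s) * Real.log (r / R) :=
            mul_le_mul_of_nonneg_right hR.le hlog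
        _ = ∫ s in Ioc 0 R, Real.log (r / R) * f s := by rw [integral_const_mul, mul_comm]
        _ ≤ ∫ s in Ioc 0 R, logKernel (r / s) * f s := by
            refine setIntegral_mono_on ((hfI R).const_mul _) ((hK r).mono_set Ioc_subset_Ioi_self)
              measurableSet_Ioc fun s hs => mul_le_mul_of_nonneg_right ?_ (hf0 s hs.1)
            have hr0 : 0 < r := by linarith
            refine le_trans ?_ (log_le_logKernel (div_pos hr0 hs.1))
            exact Real.log_le_log (by positivity) (div_le_div_of_nonneg_left hr0.le hs.1 hs.2)
        _ ≤ ∫ s in Ioi 0, logKernel (r / s) * f s :=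
            setIntegral_mono_set (hK r) ((ae_restrict_mem measurableSet_Ioi).mono fun s hs =>
              mul_nonneg (logKernel_nonneg _) (hf0 s hs)) Ioc_subset_Ioi_self.eventuallyLE
    rw [← Ioc_union_Ioi_eq_Ioi hR0.le]
    refine (hfI R).union ?_
    refine ((integrableOn_Ioi_rpow_of_lt (show (-5 : ℝ) < -1 by norm_num) hR0).const_mul
      (2 * R ^ (4 * (p + 2)))).mono' hfc.aestronglyMeasurable ?_
    filter_upwards [ae_restrict_mem measurableSet_Ioi] with r hr
    have hr : R < r := hr
    have hr0 : 0 < r := by linarith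
    rw [Real.norm_of_nonneg (hf0 r hr0)]
    have h1 : c + d * r ^ (4 * p) ≤ 2 * r ^ (4 * p) := by
      have h2 := powerProfile_le p hc1 hd1 r hr0
      have h3 : 1 ≤ r ^ (4 * p) := Real.one_le_rpow (by linarith) (by positivity)
      linarith
    have h2 : Real.exp (4 * U r) ≤ R ^ (4 * (p + 2)) * r ^ (-(4 * (p + 2))) := by
      have h4 : Real.exp (4 * U r) ≤ (r / R) ^ (-(4 * (p + 2))) := by
        rw [Real.rpow_def_of_pos (by positivity)]
        exact Real.exp_le_exp.2 (by linarith [hUle r hr])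
      refine h4.trans (le_of_eq ?_)
      rw [Real.div_rpow hr0.le hR0.le, Real.rpow_neg hR0.le, div_inv_eq_mul, mul_comm]
    calc f r ≤ 2 * r ^ (4 * p) * (R ^ (4 * (p + 2)) * r ^ (-(4 * (p + 2)))) * r ^ 3 := by
          simp only [hf]; gcongr
      _ = 2 * R ^ (4 * (p + 2)) * (r ^ (4 * p) * r ^ (-(4 * (p + 2))) * r ^ (3 : ℝ)) := by
          rw [show (3 : ℝ) = (3 : ℕ) by norm_num, Real.rpow_natCast]; ring
      _ = 2 * R ^ (4 * (p + 2)) * r ^ (-5 : ℝ) := by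
          rw [← Real.rpow_add hr0, ← Real.rpow_add hr0]; congr 2; ring
  · push Not at hbig
    refine integrableOn_Ioi_of_intervalIntegral_norm_bounded (p + 2) 0 hfI
      (tendsto_id (α := ℝ) (x := atTop)) ?_
    filter_upwards [eventually_ge_atTop 1] with R hR
    have hR0 : (0 : ℝ) ≤ R := by linarith
    change ∫ s in (0 : ℝ)..R, ‖f s‖ ≤ p + 2
    rw [intervalIntegral.integral_of_le hR0]
    refine le_trans (le_of_eq ?_) (hbig R hR)
    exact setIntegral_congr_fun measurableSet_Ioc fun s hs => Real.norm_of_nonneg (hf0 s hs.1)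

/-- A balanced Volterra solution is a radial normal solution. -/
theorem isRadialNormal_volterraSol (hp : 0 < p) (hc : 0 ≤ c) (hd : 0 ≤ d) (hc1 : c ≤ 1)
    (hd1 : d ≤ 1) (hb : b ≤ 0)
    (h : volterraMoment b (fun s => c + d * s ^ (4 * p)) = ENNReal.ofReal (-b)) :
    IsRadialNormal p c d (volterraSol b fun s => c + d * s ^ (4 * p)) := by
  have hQ := continuous_powerProfile hp c d
  have hQ0 := powerProfile_nonneg p hc hd
  have hcap := fun r => cappedExp_of_nonpos (volterraSol_nonpos hQ hQ0 hb h r)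
  have hpot := volterraSol_eq_neg_integral hQ hQ0 hb h
  simp_rw [hcap] at hpot
  have hcont := continuous_volterraSol b hQ hQ0
  exact ⟨hcont, integrableOn_density_of_potential hp hc hd hc1 hd1 hcont (fun r => (hpot r).1)
    fun r => (hpot r).2, 0, fun r _ => by rw [zero_sub]; exact (hpot r).2⟩

/-- The interpolating family of curvature functions. -/
noncomputable def familyProfile (p τ s : ℝ) : ℝ := (1 - τ) + τ * s ^ (4 * p)

lemma abs_familyProfile_sub_le (hp : 0 < p) (τ τ' : ℝ) (R : ℝ) : ∀ s ∈ Ioc 0 R,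
    |familyProfile p τ s - familyProfile p τ' s| ≤ |τ - τ'| * (1 + R ^ (4 * p)) := fun s hs => by
  have e : familyProfile p τ s - familyProfile p τ' s = (τ - τ') * (s ^ (4 * p) - 1) := by
    unfold familyProfile; ring
  have h1 : 0 ≤ s ^ (4 * p) := Real.rpow_nonneg hs.1.le _
  have h2 : s ^ (4 * p) ≤ R ^ (4 * p) := Real.rpow_le_rpow hs.1.le hs.2 (by positivity)
  rw [e, abs_mul]
  exact mul_le_mul_of_nonneg_left (abs_le.2 ⟨by linarith, by linarith⟩) (abs_nonneg _)

variable {τ : ℝ}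

lemma tendsto_volterraSol_family (hp : 0 < p) (hτ : τ ∈ Icc (0 : ℝ) 1) {t β : ℕ → ℝ}
    (ht : ∀ n, t n ∈ Icc (0 : ℝ) 1) (htt : Tendsto t atTop (𝓝 τ)) (hβ : Tendsto β atTop (𝓝 b))
    {s : ℝ} (hs : 0 < s) :
    Tendsto (fun n => volterraSol (β n) (familyProfile p (t n)) s) atTop
      (𝓝 (volterraSol b (familyProfile p τ) s)) := by
  have hQ : ∀ τ, Continuous (familyProfile p τ) := fun τ => continuous_powerProfile hp _ _
  have hQ0 : ∀ τ ∈ Icc (0 : ℝ) 1, ∀ s, 0 < s → 0 ≤ familyProfile p τ s := fun τ hτ =>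
    powerProfile_nonneg p (by linarith [hτ.2]) hτ.1
  refine tendsto_volterraSol (fun n => hQ _) (fun n => hQ0 _ (ht n)) (hQ τ) (hQ0 τ hτ) hβ hs
    (M := 1 + s ^ (4 * p)) (by positivity) (le_one_add_rpow_of_le hp
      (powerProfile_le p (by linarith [hτ.1]) hτ.2) s)
    (δ := fun n => |τ - t n| * (1 + s ^ (4 * p))) ?_ fun n => abs_familyProfile_sub_le hp _ _ _
  have := ((tendsto_const_nhds (x := τ)).sub htt).abs.mul_const (1 + s ^ (4 * p))
  simpa using this

lemma tendsto_familyProfile {t : ℕ → ℝ} (htt : Tendsto t atTop (𝓝 τ)) (s : ℝ) :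
    Tendsto (fun n => familyProfile p (t n) s) atTop (𝓝 (familyProfile p τ s)) :=
  (tendsto_const_nhds.sub htt).add (htt.mul_const _)

/-- The set of pairs `(τ, b)` with `b` balanced is closed: no moment is lost at infinity. -/
lemma volterraMoment_closed (hp : 0 < p) (hτ : τ ∈ Icc (0 : ℝ) 1) {t β : ℕ → ℝ}
    (ht : ∀ n, t n ∈ Icc (0 : ℝ) 1) (htt : Tendsto t atTop (𝓝 τ)) (hβ : Tendsto β atTop (𝓝 b))
    (hβ0 : ∀ n, β n ≤ 0)
    (h : ∀ n, volterraMoment (β n) (familyProfile p (t n)) = ENNReal.ofReal (-β n)) :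
    volterraMoment b (familyProfile p τ) = ENNReal.ofReal (-b) := by
  have hQ : ∀ τ, Continuous (familyProfile p τ) := fun τ => continuous_powerProfile hp _ _
  have hQ0 : ∀ τ ∈ Icc (0 : ℝ) 1, ∀ s, 0 < s → 0 ≤ familyProfile p τ s := fun τ hτ =>
    powerProfile_nonneg p (by linarith [hτ.2]) hτ.1
  have hQ1 : ∀ τ ∈ Icc (0 : ℝ) 1, ∀ s, 0 < s → familyProfile p τ s ≤ 1 + s ^ (4 * p) :=
    fun τ hτ => powerProfile_le p (by linarith [hτ.1]) hτ.2
  have hN : ∀ n, IsRadialNormal p (1 - t n) (t n) (volterraSol (β n) (familyProfile p (t n))) :=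
    fun n => isRadialNormal_volterraSol hp (by linarith [(ht n).2]) (ht n).1
      (by linarith [(ht n).1]) (ht n).2 (hβ0 n) (h n)
  have hi : ∀ n, IntegrableOn (fun s => s / 4 * (familyProfile p (t n) s *
      cappedExp (volterraSol (β n) (familyProfile p (t n)) s))) (Ioi 0) := fun n =>
    integrableOn_weight_of_moment (hQ _) (hQ0 _ (ht n)) (by rw [h n]; exact ENNReal.ofReal_lt_top)
  have hJ : ∀ n, ∫ s in Ioi 0, s / 4 * (familyProfile p (t n) s *
      cappedExp (volterraSol (β n) (familyProfile p (t n)) s)) = -β n := fun n => by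
    have := h n
    rwa [volterraMoment_eq (hQ0 _ (ht n)) (hi n), ENNReal.ofReal_eq_ofReal_iff
      (setIntegral_nonneg measurableSet_Ioi fun s hs => weight_nonneg (hQ0 _ (ht n)) hs _)
      (by linarith [hβ0 n])] at this
  set φ : ℝ → ℝ := fun s => s / 4 * (familyProfile p τ s *
    cappedExp (volterraSol b (familyProfile p τ) s)) with hφ
  have hφ0 : ∀ s, 0 < s → 0 ≤ φ s := fun s hs => weight_nonneg (hQ0 τ hτ) hs _
  have hhead := fun R => tendsto_head_weight (p := p) (l := atTop)
    (F := fun n => volterraSol (β n) (familyProfile p (t n))) (fun n => hQ (t n))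
    (fun n => hQ0 _ (ht n)) (fun n => hQ1 _ (ht n)) hp (fun n => measurable_volterraSol _ (hQ _))
    (fun s _ => tendsto_familyProfile htt s)
    (fun s hs => tendsto_volterraSol_family hp hτ ht htt hβ hs) R
  have hsplit : ∀ n R, 0 < R → -β n = (∫ s in Ioc 0 R, s / 4 * (familyProfile p (t n) s *
      cappedExp (volterraSol (β n) (familyProfile p (t n)) s))) + ∫ s in Ioi R, s / 4 *
      (familyProfile p (t n) s * cappedExp (volterraSol (β n) (familyProfile p (t n)) s)) := by
    intro n R hR
    rw [← hJ n, ← setIntegral_union (Ioc_disjoint_Ioi (le_refl R)) measurableSet_Ioi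
      ((hi n).mono_set Ioc_subset_Ioi_self) ((hi n).mono_set (Ioi_subset_Ioi hR.le)),
      Ioc_union_Ioi_eq_Ioi hR.le]
  have hup : ∀ R, 0 < R → ∫ s in Ioc 0 R, φ s ≤ -b := fun R hR => by
    refine le_of_tendsto_of_tendsto' (hhead R) hβ.neg fun n => ?_
    rw [hsplit n R hR]
    exact le_add_of_nonneg_right (setIntegral_nonneg measurableSet_Ioi fun s hs =>
      weight_nonneg (hQ0 _ (ht n)) (hR.trans hs) _)
  -- The moment carries weight s and the mass carries s³, so the moment beyond R is at most the mass
  -- over 4R². The uniform mass bound makes this small uniformly in n.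
  have hlow : ∀ R, 0 < R → -b ≤ (∫ s in Ioc 0 R, φ s) + (2 + 2 * p) / (4 * R ^ 2) := fun R hR => by
    refine le_of_tendsto_of_tendsto' hβ.neg ((hhead R).add_const _) fun n => ?_
    rw [hsplit n R hR]
    refine add_le_add le_rfl ?_
    have hmass := (hN n).mass_le hp (by linarith [(ht n).2]) (ht n).1
    rw [← (hN n).integral_eq (by linarith [(ht n).2]) (ht n).1] at hmass
    calc ∫ s in Ioi R, s / 4 * (familyProfile p (t n) s *
          cappedExp (volterraSol (β n) (familyProfile p (t n)) s))
        ≤ ∫ s in Ioi R, (1 / (4 * R ^ 2)) * ((1 - t n + t n * s ^ (4 * p)) *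
          Real.exp (4 * volterraSol (β n) (familyProfile p (t n)) s) * s ^ 3) := by
          refine setIntegral_mono_on ((hi n).mono_set (Ioi_subset_Ioi hR.le))
            (((hN n).integrable.mono_set (Ioi_subset_Ioi hR.le)).const_mul _)
            measurableSet_Ioi fun s hs => ?_
          have hs : R < s := hs
          have hs0 : 0 < s := hR.trans hs
          have h1 := mul_le_mul_of_nonneg_left
            (cappedExp_le_exp (volterraSol (β n) (familyProfile p (t n)) s)) (hQ0 _ (ht n) s hs0)
          have h2 : s / 4 ≤ 1 / (4 * R ^ 2) * s ^ 3 := by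
            rw [div_mul_eq_mul_div, one_mul, div_le_div_iff₀ (by norm_num) (by positivity)]
            have : R ^ 2 ≤ s ^ 2 := pow_le_pow_left₀ hR.le hs.le 2
            nlinarith
          have h3 := mul_le_mul h2 h1 (mul_nonneg (hQ0 _ (ht n) s hs0) (cappedExp_pos _).le)
            (by positivity)
          refine h3.trans (le_of_eq ?_)
          simp only [familyProfile]
          ring
      _ ≤ 1 / (4 * R ^ 2) * (2 + 2 * p) := by
          rw [integral_const_mul]
          refine mul_le_mul_of_nonneg_left (le_trans ?_ hmass) (by positivity)
          refine setIntegral_mono_set (hN n).integrable ((ae_restrict_mem measurableSet_Ioi).mono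
            fun s hs => ?_) (Ioi_subset_Ioi hR.le).eventuallyLE
          exact mul_nonneg (mul_nonneg (hQ0 _ (ht n) s hs) (Real.exp_pos _).le)
            (pow_nonneg (le_of_lt hs) 3)
      _ = (2 + 2 * p) / (4 * R ^ 2) := by ring
  have hφc : Continuous φ := (continuous_id.div_const 4).mul ((hQ τ).mul
    (continuous_cappedExp.comp (continuous_volterraSol b (hQ τ) (hQ0 τ hτ))))
  have hφI : IntegrableOn φ (Ioi 0) := by
    refine integrableOn_Ioi_of_intervalIntegral_norm_bounded (-b) 0
      (fun R => hφc.integrableOn_Icc.mono_set Ioc_subset_Icc_self) (tendsto_id (α := ℝ)) ?_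
    filter_upwards [eventually_gt_atTop 0] with R hR
    rw [id, intervalIntegral.integral_of_le (le_of_lt hR)]
    refine le_trans (le_of_eq ?_) (hup R hR)
    exact setIntegral_congr_fun measurableSet_Ioc fun s hs => Real.norm_of_nonneg (hφ0 s hs.1)
  rw [volterraMoment_eq (hQ0 τ hτ) hφI]
  congr 1
  have ht1 := intervalIntegral_tendsto_integral_Ioi 0 hφI tendsto_id
  have ht2 : Tendsto (fun R : ℝ => -b - (2 + 2 * p) / (4 * R ^ 2)) atTop (𝓝 (-b - 0)) := by
    refine tendsto_const_nhds.sub (tendsto_const_nhds.div_atTop ?_)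
    exact (tendsto_pow_atTop (by norm_num)).const_mul_atTop (by norm_num)
  rw [sub_zero] at ht2
  refine tendsto_nhds_unique ht1 (tendsto_of_tendsto_of_tendsto_of_le_of_le' ht2
    tendsto_const_nhds ?_ ?_)
  · filter_upwards [eventually_gt_atTop 0] with R hR
    rw [id, intervalIntegral.integral_of_le (le_of_lt hR)]
    linarith [hlow R hR]
  · filter_upwards [eventually_gt_atTop 0] with R hR
    rw [id, intervalIntegral.integral_of_le (le_of_lt hR)]
    exact hup R hR

/-- Fatou's lemma in the form needed for closed sublevel sets. Mass may escape to infinity, so full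
continuity is not claimed. -/
lemma integral_le_of_tendsto_of_le {f : ℕ → ℝ → ℝ} {g : ℝ → ℝ} {x : ℝ}
    (hf : ∀ n, IntegrableOn (f n) (Ioi 0)) (hf0 : ∀ n s, 0 < s → 0 ≤ f n s)
    (hfm : ∀ n, Measurable (f n)) (hg : IntegrableOn g (Ioi 0)) (hg0 : ∀ s, 0 < s → 0 ≤ g s)
    (hlim : ∀ s, 0 < s → Tendsto (fun n => f n s) atTop (𝓝 (g s)))
    (hx : ∀ n, ∫ s in Ioi 0, f n s ≤ x) : ∫ s in Ioi 0, g s ≤ x := by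
  have hx0 : 0 ≤ x := le_trans (setIntegral_nonneg measurableSet_Ioi fun s hs => hf0 0 s hs) (hx 0)
  rw [← ENNReal.ofReal_le_ofReal_iff hx0, ofReal_integral_eq_lintegral_ofReal hg
    ((ae_restrict_mem measurableSet_Ioi).mono fun s hs => hg0 s hs)]
  have h1 : ∫⁻ s in Ioi 0, ENNReal.ofReal (g s) ≤
      liminf (fun n => ∫⁻ s in Ioi 0, ENNReal.ofReal (f n s)) atTop := by
    refine le_trans (le_of_eq ?_) (lintegral_liminf_le fun n => (hfm n).ennreal_ofReal)
    refine setLIntegral_congr_fun measurableSet_Ioi fun s hs => ?_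
    exact (((ENNReal.continuous_ofReal.tendsto _).comp (hlim s hs)).liminf_eq).symm
  refine h1.trans (liminf_le_of_le (by isBoundedDefault) fun y hy => ?_)
  obtain ⟨n, hn⟩ := hy.exists
  refine hn.trans ?_
  rw [← ofReal_integral_eq_lintegral_ofReal (hf n)
    ((ae_restrict_mem measurableSet_Ioi).mono fun s hs => hf0 n s hs)]
  exact ENNReal.ofReal_le_ofReal (hx n)

/-- Every admissible mass is attained within the interpolating family. -/
theorem exists_isRadialNormal_family (hp : 0 < p) {β : ℝ} (h1 : max 2 (2 * p) < β)
    (h2 : β < 2 + 2 * p) : ∃ c > 0, ∃ d > 0, ∃ U, IsRadialNormal p c d U ∧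
      headMass c U + tailMass p d U = β := by
  have hQ : ∀ τ, Continuous (familyProfile p τ) := fun τ => continuous_powerProfile hp _ _
  have hQ0 : ∀ τ ∈ Icc (0 : ℝ) 1, ∀ s, 0 < s → 0 ≤ familyProfile p τ s := fun τ hτ =>
    powerProfile_nonneg p (by linarith [hτ.2]) hτ.1
  have hQ1 : ∀ τ ∈ Icc (0 : ℝ) 1, ∀ s, 0 < s → familyProfile p τ s ≤ 1 + s ^ (4 * p) :=
    fun τ hτ => powerProfile_le p (by linarith [hτ.1]) hτ.2
  have hex := fun τ (hτ : τ ∈ Icc (0 : ℝ) 1) =>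
    exists_volterraMoment_eq hp (hQ τ) (hQ0 τ hτ) (hQ1 τ hτ)
  choose! ζ hζ hζm using hex
  have hN : ∀ τ ∈ Icc (0 : ℝ) 1,
      IsRadialNormal p (1 - τ) τ (volterraSol (ζ τ) (familyProfile p τ)) := fun τ hτ =>
    isRadialNormal_volterraSol hp (by linarith [hτ.2]) hτ.1 (by linarith [hτ.1]) hτ.2
      (hζ τ hτ).2 (hζm τ hτ)
  -- The shooting parameters lie in a fixed compact interval, every subsequential limit is balanced,
  -- and the balanced parameter is unique.
  have hζc : ∀ τ ∈ Icc (0 : ℝ) 1, ∀ t : ℕ → ℝ, (∀ n, t n ∈ Icc (0 : ℝ) 1) →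
      Tendsto t atTop (𝓝 τ) → Tendsto (fun n => ζ (t n)) atTop (𝓝 (ζ τ)) := by
    intro τ hτ t ht htt
    refine tendsto_of_subseq_tendsto fun ns hns => ?_
    obtain ⟨b, hb, ms, hms, hlim⟩ := isCompact_Icc.tendsto_subseq fun n => hζ _ (ht (ns n))
    refine ⟨ms, ?_⟩
    have hbz : b = ζ τ := by
      refine volterraMoment_unique (hQ τ) (hQ0 τ hτ) hb.2 (hζ τ hτ).2 ?_ (hζm τ hτ)
      exact volterraMoment_closed hp hτ (t := fun n => t (ns (ms n))) (fun n => ht _)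
        (htt.comp (hns.comp hms.tendsto_atTop)) hlim (fun n => (hζ _ (ht _)).2)
        fun n => hζm _ (ht _)
    rw [← hbz]
    exact hlim
  set V : ℝ → ℝ → ℝ := fun τ => volterraSol (ζ τ) (familyProfile p τ) with hV
  have hVlim : ∀ τ ∈ Icc (0 : ℝ) 1, ∀ t : ℕ → ℝ, (∀ n, t n ∈ Icc (0 : ℝ) 1) →
      Tendsto t atTop (𝓝 τ) → ∀ s, 0 < s →
      Tendsto (fun n => Real.exp (4 * V (t n) s)) atTop (𝓝 (Real.exp (4 * V τ s))) :=
    fun τ hτ t ht htt s hs => (Real.continuous_exp.tendsto _).comp (tendsto_const_nhds.mul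
      (tendsto_volterraSol_family hp hτ ht htt (hζc τ hτ t ht htt) hs))
  have hVm : ∀ τ, Measurable fun s => Real.exp (4 * V τ s) := fun τ =>
    Real.measurable_exp.comp (measurable_const.mul (measurable_volterraSol _ (hQ τ)))
  have hclosed1 : ∀ x, IsClosed {τ | τ ∈ Icc (0 : ℝ) 1 ∧ headMass (1 - τ) (V τ) ≤ x} := by
    intro x
    refine IsSeqClosed.isClosed fun t τ ht htt => ?_
    have hτ : τ ∈ Icc (0 : ℝ) 1 := isClosed_Icc.mem_of_tendsto htt
      (Eventually.of_forall fun n => (ht n).1)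
    refine ⟨hτ, integral_le_of_tendsto_of_le (fun n => (hN _ (ht n).1).integrable_head
      (by linarith [(ht n).1.2]) (ht n).1.1) (fun n s hs => ?_) (fun n => ?_)
      ((hN τ hτ).integrable_head (by linarith [hτ.2]) hτ.1) (fun s hs => ?_) (fun s hs => ?_)
      fun n => (ht n).2⟩
    · have : 0 ≤ 1 - t n := by linarith [(ht n).1.2]
      positivity
    · exact measurable_const.mul ((hVm _).mul (measurable_id.pow_const 3))
    · have : 0 ≤ 1 - τ := by linarith [hτ.2]
      positivity
    · exact (tendsto_const_nhds.sub htt).mul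
        ((hVlim τ hτ t (fun n => (ht n).1) htt s hs).mul_const _)
  have hclosed2 : ∀ x, IsClosed {τ | τ ∈ Icc (0 : ℝ) 1 ∧ tailMass p τ (V τ) ≤ x} := by
    intro x
    refine IsSeqClosed.isClosed fun t τ ht htt => ?_
    have hτ : τ ∈ Icc (0 : ℝ) 1 := isClosed_Icc.mem_of_tendsto htt
      (Eventually.of_forall fun n => (ht n).1)
    refine ⟨hτ, integral_le_of_tendsto_of_le (fun n => (hN _ (ht n).1).integrable_tail
      (by linarith [(ht n).1.2]) (ht n).1.1) (fun n s hs => ?_) (fun n => ?_)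
      ((hN τ hτ).integrable_tail (by linarith [hτ.2]) hτ.1) (fun s hs => ?_) (fun s hs => ?_)
      fun n => (ht n).2⟩
    · have := (ht n).1.1
      positivity
    · exact measurable_const.mul (((measurable_id.pow_const (4 * p)).mul (hVm _)).mul
        (measurable_id.pow_const 3))
    · have := hτ.1
      positivity
    · exact htt.mul
        (((hVlim τ hτ t (fun n => (ht n).1) htt s hs).const_mul _).mul_const _)
  have hβ2 : 2 < β := (le_max_left _ _).trans_lt h1
  have hβp : 2 * p < β := (le_max_right _ _).trans_lt h1
  -- These are the masses that Pohozaev's identity forces when the total is β; they add up to β.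
  set x := β * (2 * p + 2 - β) / (2 * p) with hx
  set y := β * (β - 2) / (2 * p) with hy
  have hx' : 2 * p * x = β * (2 * p + 2 - β) := by rw [hx]; field_simp
  have hy' : 2 * p * y = β * (β - 2) := by rw [hy]; field_simp
  have hx0 : 0 < x := div_pos (mul_pos (by linarith) (by linarith)) (by linarith)
  have hy0 : 0 < y := div_pos (mul_pos (by linarith) (by linarith)) (by linarith)
  have hx2 : x < 2 := by
    have : 0 < (β - 2) * (β - 2 * p) := mul_pos (by linarith) (by linarith)
    nlinarith
  have hy2 : y < 2 + 2 * p := by nlinarith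
  -- If both masses exceeded x and y, the total would exceed β. But at fixed Pohozaev relation the
  -- head mass is m(2p+2-m)/(2p), decreasing for m ≥ p+1, and admissible totals satisfy m > max(2,
  -- 2p) ≥ p+1, a contradiction.
  have hcover : Icc (0 : ℝ) 1 ⊆ {τ | τ ∈ Icc (0 : ℝ) 1 ∧ headMass (1 - τ) (V τ) ≤ x} ∪
      {τ | τ ∈ Icc (0 : ℝ) 1 ∧ tailMass p τ (V τ) ≤ y} := by
    intro τ hτ
    by_contra hcon
    simp only [mem_union, mem_ofPred_eq, hτ, true_and, not_or, not_le] at hcon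
    obtain ⟨hA, hB⟩ := hcon
    have hP := (hN τ hτ).pohozaev hp (by linarith [hτ.2]) hτ.1
    have hτ0 : 0 < τ := by
      refine hτ.1.lt_of_ne fun h => ?_
      rw [← h] at hB
      simp only [tailMass, zero_mul, integral_zero] at hB
      linarith
    have hτ1 : 0 < 1 - τ := by
      refine lt_of_le_of_ne (by linarith [hτ.2]) fun h => ?_
      rw [← h] at hA
      simp only [headMass, zero_mul, integral_zero] at hA
      linarith
    obtain ⟨hm1, hm2⟩ := (hN τ hτ).mass_mem hp hτ1 hτ0
    have hm3 := (le_max_left _ _).trans_lt hm1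
    have hm4 := (le_max_right _ _).trans_lt hm1
    set H := headMass (1 - τ) (V τ)
    set T := tailMass p τ (V τ)
    have e1 : 2 * p * T = (H + T) * (H + T - 2) := by linear_combination 2 * hP
    have e2 : 2 * p * H = (H + T) * (2 * p + 2 - (H + T)) := by linear_combination -2 * hP
    have hgt : β < H + T := by
      by_contra! hle
      nlinarith
    nlinarith
  obtain ⟨τ, hτ, ⟨-, hA⟩, -, hB⟩ := isPreconnected_closed_iff.1 isPreconnected_Icc _ _
    (hclosed1 x) (hclosed2 y) hcover
    ⟨1, right_mem_Icc.2 zero_le_one, right_mem_Icc.2 zero_le_one, by simp [headMass, hx0.le]⟩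
    ⟨0, left_mem_Icc.2 zero_le_one, left_mem_Icc.2 zero_le_one, by simp [tailMass, hy0.le]⟩
  have hP := (hN τ hτ).pohozaev hp (by linarith [hτ.2]) hτ.1
  -- At τ = 0 Pohozaev forces head mass 2 > x; at τ = 1 it forces tail mass 2+2p > y. The common
  -- point is therefore interior.
  have hτ0 : 0 < τ := by
    refine hτ.1.lt_of_ne fun h => ?_
    have hpos := (hN τ hτ).headMass_pos (by linarith) hτ.1
    have h0 : tailMass p τ (V τ) = 0 := by rw [← h]; simp [tailMass]
    have hP' : headMass (1 - τ) (V τ) + (1 + p) * tailMass p τ (V τ) =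
      (headMass (1 - τ) (V τ) + tailMass p τ (V τ)) ^ 2 / 2 := hP
    have hpos' : 0 < headMass (1 - τ) (V τ) := hpos
    rw [h0] at hP'
    nlinarith
  have hτ1 : 0 < 1 - τ := by
    refine lt_of_le_of_ne (by linarith [hτ.2]) fun h => ?_
    have hpos : 0 < tailMass p τ (V τ) := (hN τ hτ).tailMass_pos (by linarith [hτ.2]) hτ0
    have h0 : headMass (1 - τ) (V τ) = 0 := by rw [← h]; simp [headMass]
    have hP' : headMass (1 - τ) (V τ) + (1 + p) * tailMass p τ (V τ) =
      (headMass (1 - τ) (V τ) + tailMass p τ (V τ)) ^ 2 / 2 := hP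
    rw [h0] at hP'
    nlinarith
  refine ⟨1 - τ, hτ1, τ, hτ0, V τ, hN τ hτ, ?_⟩
  obtain ⟨hm1, hm2⟩ := (hN τ hτ).mass_mem hp hτ1 hτ0
  have hm3 := (le_max_left _ _).trans_lt hm1
  have hm4 := (le_max_right _ _).trans_lt hm1
  change _ = _ at hP
  set H := headMass (1 - τ) (V τ)
  set T := tailMass p τ (V τ)
  have e1 : 2 * p * T = (H + T) * (H + T - 2) := by linear_combination 2 * hP
  have e2 : 2 * p * H = (H + T) * (2 * p + 2 - (H + T)) := by linear_combination -2 * hP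
  -- The total is at most x + y = β, and a smaller admissible total would have head mass above x by
  -- the same monotonicity.
  refine le_antisymm ?_ ?_
  · by_contra! hlt
    nlinarith
  · by_contra! hlt
    nlinarith

/-- Radial normal solutions with curvature `κ (1 + |x|^{4p})` of every admissible mass exist. -/
theorem exists_isRadialNormal (hp : 0 < p) {β κ : ℝ} (hκ : 0 < κ) (h1 : max 2 (2 * p) < β)
    (h2 : β < 2 + 2 * p) : ∃ U, IsRadialNormal p κ κ U ∧
      ∫ s in Ioi 0, (κ + κ * s ^ (4 * p)) * Real.exp (4 * U s) * s ^ 3 = β := by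
  obtain ⟨c, hc, d, hd, U, hU, hβ⟩ := exists_isRadialNormal_family hp h1 h2
  rw [← hU.integral_eq hc.le hd.le] at hβ
  set f : ℝ → ℝ := fun s => (c + d * s ^ (4 * p)) * Real.exp (4 * U s) * s ^ 3 with hf
  -- The dilation factor solves d λ^{4p} = c, and the additive constant η solves κ e^{4η} = λ⁴ c.
  -- Since the kernel depends only on r/s, the equation and the mass are preserved.
  set lam := (c / d) ^ (1 / (4 * p)) with hlam
  have hl0 : 0 < lam := by positivity
  have hl : d * lam ^ (4 * p) = c := by
    rw [hlam, ← Real.rpow_mul (by positivity), one_div_mul_cancel (by positivity), Real.rpow_one]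
    field_simp
  set η := Real.log (lam ^ 4 * c / κ) / 4 with hη
  have hη' : κ * Real.exp (4 * η) = lam ^ 4 * c := by
    rw [hη, mul_div_cancel₀ _ (by norm_num : (4 : ℝ) ≠ 0), Real.exp_log (by positivity)]
    field_simp
  have hdens : ∀ s ∈ Ioi (0 : ℝ), lam * f (lam * s) =
      (κ + κ * s ^ (4 * p)) * Real.exp (4 * (U (lam * s) + η)) * s ^ 3 := fun s hs => by
    have hs : 0 < s := hs
    simp only [hf]
    rw [Real.mul_rpow hl0.le hs.le, mul_add 4, Real.exp_add]
    linear_combination (-(1 + s ^ (4 * p)) * Real.exp (4 * U (lam * s)) * s ^ 3) * hη' +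
      (lam ^ 4 * s ^ (4 * p) * Real.exp (4 * U (lam * s)) * s ^ 3) * hl
  have hsub : ∀ g : ℝ → ℝ, ∫ s in Ioi 0, lam * g (lam * s) = ∫ s in Ioi 0, g s := fun g => by
    rw [integral_const_mul, integral_comp_mul_left_Ioi g 0 hl0, mul_zero, smul_eq_mul,
      mul_inv_cancel_left₀ hl0.ne']
  obtain ⟨C, hC⟩ := hU.exists_eq
  refine ⟨fun s => U (lam * s) + η, ⟨(hU.continuous.comp (continuous_const.mul
    continuous_id)).add continuous_const, ?_, C + η, fun r hr => ?_⟩, ?_⟩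
  · refine IntegrableOn.congr_fun ?_ hdens measurableSet_Ioi
    refine Integrable.const_mul ?_ lam
    have := (integrableOn_Ioi_comp_mul_left_iff f 0 hl0).2 (by rw [mul_zero]; exact hU.integrable)
    exact this
  · have h3 := hsub fun s => logKernel (lam * r / s) * f s
    rw [hC (lam * r) (by positivity), ← h3, add_sub_right_comm]
    congr 2
    refine setIntegral_congr_fun measurableSet_Ioi fun s hs => ?_
    rw [← hdens s hs, mul_div_mul_left _ _ hl0.ne']
    ring
  · rw [← hβ, ← hsub f]
    exact (setIntegral_congr_fun measurableSet_Ioi hdens).symm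

end Family

/-! ### Flat remainders and the gain of regularity under the radial bilaplacian. -/

section Flat

open Set Filter Topology

/-- `E` is `k` times differentiable on `(0, ∞)` and its derivatives of order `j ≤ k` are
`o(r^{k-j})` at the origin. -/
def IsFlat : ℕ → (ℝ → ℝ) → Prop
  | 0, E => ContinuousOn E (Ioi 0) ∧ Tendsto E (𝓝[>] 0) (𝓝 0)
  | k + 1, E => ∃ E' : ℝ → ℝ, (∀ r, 0 < r → HasDerivAt E (E' r) r) ∧ IsFlat k E' ∧
      IsFlat k fun r => E r / r

variable {E E₁ E₂ : ℝ → ℝ} {k m : ℕ}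

lemma IsFlat.congr (h : IsFlat k E₁) (heq : ∀ r, 0 < r → E₁ r = E₂ r) : IsFlat k E₂ := by
  induction k generalizing E₁ E₂ with
  | zero =>
    refine ⟨h.1.congr fun r hr => (heq r hr).symm, h.2.congr' ?_⟩
    filter_upwards [self_mem_nhdsWithin] with r hr using heq r hr
  | succ k ih =>
    obtain ⟨E', h1, h2, h3⟩ := h
    refine ⟨E', fun r hr => (h1 r hr).congr_of_eventuallyEq ?_, h2,
      ih h3 fun r hr => by rw [heq r hr]⟩
    filter_upwards [lt_mem_nhds hr] with x hx using (heq x hx).symm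

lemma IsFlat.add (h₁ : IsFlat k E₁) (h₂ : IsFlat k E₂) : IsFlat k fun r => E₁ r + E₂ r := by
  induction k generalizing E₁ E₂ with
  | zero => exact ⟨h₁.1.add h₂.1, by simpa using h₁.2.add h₂.2⟩
  | succ k ih =>
    obtain ⟨F₁, a1, a2, a3⟩ := h₁
    obtain ⟨F₂, b1, b2, b3⟩ := h₂
    exact ⟨fun r => F₁ r + F₂ r, fun r hr => (a1 r hr).add (b1 r hr), ih a2 b2,
      (ih a3 b3).congr fun r _ => by ring⟩

lemma IsFlat.const_mul (h : IsFlat k E) (c : ℝ) : IsFlat k fun r => c * E r := by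
  induction k generalizing E with
  | zero => exact ⟨continuousOn_const.mul h.1, by simpa using h.2.const_mul c⟩
  | succ k ih =>
    obtain ⟨F, a1, a2, a3⟩ := h
    exact ⟨fun r => c * F r, fun r hr => (a1 r hr).const_mul c, ih a2,
      (ih a3).congr fun r _ => by ring⟩

lemma IsFlat.of_succ (h : IsFlat (k + 1) E) : IsFlat k E := by
  induction k generalizing E with
  | zero =>
    obtain ⟨F, a1, a2, a3⟩ := h
    refine ⟨fun r hr => (a1 r hr).continuousAt.continuousWithinAt, ?_⟩
    have h0 : Tendsto (fun r : ℝ => r) (𝓝[>] 0) (𝓝 0) := tendsto_id.mono_left nhdsWithin_le_nhds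
    have h1 := h0.mul a3.2
    rw [zero_mul] at h1
    refine h1.congr' ?_
    filter_upwards [self_mem_nhdsWithin] with r hr
    have : r ≠ 0 := ne_of_gt hr
    field_simp
  | succ k ih =>
    obtain ⟨F, a1, a2, a3⟩ := h
    exact ⟨F, a1, ih a2, ih a3⟩

lemma IsFlat.zero (h : IsFlat k E) : IsFlat 0 E := by
  induction k with
  | zero => exact h
  | succ k ih => exact ih h.of_succ

/-- Extension by 0 gives a globally continuous function, to which the fundamental theorem of
calculus applies up to the origin. -/
lemma IsFlat.exists_continuous (h : IsFlat k E) :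
    ∃ F : ℝ → ℝ, Continuous F ∧ F 0 = 0 ∧ ∀ r, 0 < r → F r = E r := by
  have h0 := h.zero
  refine ⟨fun r => if 0 < r then E r else 0, ?_, by simp, fun r hr => by simp [hr]⟩
  refine continuous_iff_continuousAt.2 fun r => ?_
  rcases lt_trichotomy r 0 with hr | rfl | hr
  · refine continuousAt_const.congr (f := fun _ => (0 : ℝ)) ?_
    filter_upwards [gt_mem_nhds hr] with x hx
    simp [hx.le]
  · rw [ContinuousAt, ← nhdsLE_sup_nhdsGT, tendsto_sup]
    simp only [lt_self_iff_false, if_false]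
    constructor
    · refine tendsto_const_nhds.congr' ?_
      filter_upwards [self_mem_nhdsWithin] with x hx
      simp [mem_Iic.1 hx]
    · refine h0.2.congr' ?_
      filter_upwards [self_mem_nhdsWithin] with x hx
      simp [mem_Ioi.1 hx]
  · refine (h0.1.continuousAt (Ioi_mem_nhds hr)).congr ?_
    filter_upwards [lt_mem_nhds hr] with x hx
    simp [hx]

/-- The weighted radial mean `r⁻⁽ᵐ⁺¹⁾ ∫₀ʳ sᵐ f(s) ds`. -/
noncomputable def radialMean (m : ℕ) (f : ℝ → ℝ) (r : ℝ) : ℝ :=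
  (∫ s in (0 : ℝ)..r, s ^ m * f s) / r ^ (m + 1)

lemma radialMean_congr {r : ℝ} (hr : 0 < r) (h : ∀ s, 0 < s → E₁ s = E₂ s) :
    radialMean m E₁ r = radialMean m E₂ r := by
  unfold radialMean
  congr 1
  refine intervalIntegral.integral_congr_ae (Eventually.of_forall fun s hs => ?_)
  rw [uIoc_of_le hr.le] at hs
  rw [h s hs.1]

lemma hasDerivAt_radialMean {f : ℝ → ℝ} (hf : Continuous f) (m : ℕ) {r : ℝ} (hr : 0 < r) :
    HasDerivAt (radialMean m f) (f r / r - (m + 1) * (radialMean m f r / r)) r := by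
  have hc : Continuous fun s : ℝ => s ^ m * f s := (continuous_pow m).mul hf
  have h1 : HasDerivAt (fun r => ∫ s in (0 : ℝ)..r, s ^ m * f s) (r ^ m * f r) r :=
    intervalIntegral.integral_hasDerivAt_right (hc.intervalIntegrable _ _)
      (hc.stronglyMeasurableAtFilter _ _) hc.continuousAt
  refine (h1.div (hasDerivAt_pow (m + 1) r) (by positivity)).congr_deriv ?_
  unfold radialMean
  rw [Nat.add_sub_cancel]
  have : r ≠ 0 := hr.ne'
  push_cast
  field_simp
  ring

lemma IsFlat.hasDerivAt_radialMean (h : IsFlat k E) (m : ℕ) {r : ℝ} (hr : 0 < r) :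
    HasDerivAt (radialMean m E) (E r / r - (m + 1) * (radialMean m E r / r)) r := by
  obtain ⟨F, hF, -, hFE⟩ := h.exists_continuous
  have := _root_.hasDerivAt_radialMean hF m hr
  rw [hFE r hr, radialMean_congr hr hFE] at this
  refine this.congr_of_eventuallyEq ?_
  filter_upwards [lt_mem_nhds hr] with x hx using (radialMean_congr hx hFE).symm

/-- Dividing by r shifts the weight and divides the argument. This is why flatness of E/r passes to
the mean divided by r in the induction below. -/
lemma radialMean_div {r : ℝ} (hr : 0 < r) (m : ℕ) (E : ℝ → ℝ) :
    radialMean m E r / r = radialMean (m + 1) (fun s => E s / s) r := by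
  unfold radialMean
  have : ∫ s in (0 : ℝ)..r, s ^ (m + 1) * (E s / s) = ∫ s in (0 : ℝ)..r, s ^ m * E s := by
    refine intervalIntegral.integral_congr_ae (Eventually.of_forall fun s hs => ?_)
    rw [uIoc_of_le hr.le] at hs
    have : s ≠ 0 := hs.1.ne'
    field_simp
    ring
  rw [this, div_div, ← pow_succ]

lemma IsFlat.radialMean (h : IsFlat k E) (m : ℕ) : IsFlat k (radialMean m E) := by
  induction k generalizing E m with
  | zero =>
    refine ⟨fun r hr => (h.hasDerivAt_radialMean m hr).continuousAt.continuousWithinAt, ?_⟩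
    rw [Metric.tendsto_nhds]
    intro ε hε
    have h2 := (Metric.tendsto_nhds.1 h.2) (ε / 2) (by positivity)
    obtain ⟨δ, hδ, hδE⟩ := mem_nhdsGT_iff_exists_Ioo_subset.1 h2
    filter_upwards [Ioo_mem_nhdsGT hδ] with r hr
    have hr0 : 0 < r := hr.1
    have hb : ‖∫ s in (0 : ℝ)..r, s ^ m * E s‖ ≤ r ^ m * (ε / 2) * |r - 0| := by
      refine intervalIntegral.norm_integral_le_of_norm_le_const fun s hs => ?_
      rw [uIoc_of_le hr0.le] at hs
      have h3 : dist (E s) 0 < ε / 2 := hδE ⟨hs.1, hs.2.trans_lt hr.2⟩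
      rw [dist_zero_right] at h3
      rw [norm_mul, norm_pow, Real.norm_of_nonneg hs.1.le]
      exact mul_le_mul (pow_le_pow_left₀ hs.1.le hs.2 m) h3.le (norm_nonneg _) (by positivity)
    rw [sub_zero, abs_of_pos hr0] at hb
    rw [dist_zero_right]
    unfold _root_.radialMean
    rw [norm_div, Real.norm_of_nonneg (by positivity : 0 ≤ r ^ (m + 1)), div_lt_iff₀ (by positivity)]
    have h4 : 0 < r ^ (m + 1) := by positivity
    calc _ ≤ _ := hb
      _ = ε / 2 * r ^ (m + 1) := by ring
      _ < ε * r ^ (m + 1) := by nlinarith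
  | succ k ih =>
    have hd := fun r (hr : 0 < r) => h.hasDerivAt_radialMean m hr
    obtain ⟨F, a1, a2, a3⟩ := h
    have h4 : IsFlat k fun r => _root_.radialMean m E r / r :=
      (ih a3 (m + 1)).congr fun r hr => (radialMean_div hr m E).symm
    exact ⟨_, hd, (a3.add (h4.const_mul (-(m + 1)))).congr fun r _ => by ring, h4⟩

/-- V/r is the unweighted mean of V', because V vanishes at the origin. -/
lemma IsFlat.of_deriv {V V' : ℝ → ℝ} (hd : ∀ r, 0 < r → HasDerivAt V (V' r) r)
    (h : IsFlat k V') (h0 : Tendsto V (𝓝[>] 0) (𝓝 0)) : IsFlat (k + 1) V := by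
  refine ⟨V', hd, h, (h.radialMean 0).congr fun r hr => ?_⟩
  obtain ⟨F, hF, -, hFV⟩ := h.exists_continuous
  rw [← radialMean_congr hr hFV]
  unfold _root_.radialMean
  simp only [pow_zero, one_mul, zero_add, pow_one]
  congr 1
  have hV : IsFlat 0 V := ⟨fun r hr => (hd r hr).continuousAt.continuousWithinAt, h0⟩
  obtain ⟨W, hW, hW0, hWV⟩ := hV.exists_continuous
  rw [intervalIntegral.integral_eq_sub_of_hasDerivAt_of_le (f := W) hr.le hW.continuousOn
    (fun x hx => ?_) (hF.intervalIntegrable _ _), hW0, sub_zero, hWV r hr]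
  rw [hFV x hx.1]
  refine (hd x hx.1).congr_of_eventuallyEq ?_
  filter_upwards [lt_mem_nhds hx.1] with y hy using hWV y hy

lemma IsFlat.hasDerivAt_pow_mul_radialMean (h : IsFlat k E) (m j : ℕ) {r : ℝ} (hr : 0 < r) :
    HasDerivAt (fun r => r ^ (j + 1) * _root_.radialMean m E r)
      (r ^ j * E r + ((j : ℝ) - m) * (r ^ j * _root_.radialMean m E r)) r := by
  refine ((hasDerivAt_pow (j + 1) r).mul (h.hasDerivAt_radialMean m hr)).congr_deriv ?_
  rw [Nat.add_sub_cancel]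
  have : r ≠ 0 := hr.ne'
  push_cast
  field_simp
  ring

lemma IsFlat.mul_radialMean (h : IsFlat k E) (m : ℕ) :
    IsFlat (k + 1) fun r => r * _root_.radialMean m E r := by
  refine ⟨_, fun r hr => ?_, h.add ((h.radialMean m).const_mul (-m)),
    (h.radialMean m).congr fun r hr => ?_⟩
  · have := h.hasDerivAt_pow_mul_radialMean m 0 hr
    simp only [zero_add, pow_one, pow_zero, one_mul, Nat.cast_zero, zero_sub] at this
    exact this
  · have : r ≠ 0 := hr.ne'
    field_simp

/-- The derivative contains r E with coefficient α + β + γ = 0. What remains is a combination of r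
times means, each already one order flatter than `E`; hence a gain of two orders. -/
lemma IsFlat.sq_mul_radialMean (h : IsFlat k E) {α β γ : ℝ} (hs : α + β + γ = 0) :
    IsFlat (k + 2) fun r => r ^ 2 * (α * _root_.radialMean 1 E r + β * _root_.radialMean 3 E r +
      γ * _root_.radialMean 5 E r) := by
  refine ⟨_, fun r hr => ?_, ((h.mul_radialMean 3).const_mul (-2 * β)).add
    ((h.mul_radialMean 5).const_mul (-4 * γ)), ((((h.mul_radialMean 1).const_mul α).add
    ((h.mul_radialMean 3).const_mul β)).add ((h.mul_radialMean 5).const_mul γ)).congr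
    fun r hr => ?_⟩
  · have h1 := ((((h.hasDerivAt_pow_mul_radialMean 1 1 hr).const_mul α).add
      ((h.hasDerivAt_pow_mul_radialMean 3 1 hr).const_mul β)).add
      ((h.hasDerivAt_pow_mul_radialMean 5 1 hr).const_mul γ))
    refine (h1.congr_deriv ?_).congr_of_eventuallyEq (Eventually.of_forall fun x => ?_)
    · push_cast
      linear_combination r * E r * hs
    · simp only [Pi.add_apply]
      ring
  · have : r ≠ 0 := hr.ne'
    field_simp

/-- The operator `f ↦ u'` for the solution `u` of `Δ² u = f` in the radial variable. -/
noncomputable def biharmonicFlux (f : ℝ → ℝ) (r : ℝ) : ℝ :=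
  r ^ 3 * (radialMean 1 f r / 2 - radialMean 3 f r + radialMean 5 f r / 2)

/-- The coefficients 1/2, -1, 1/2 sum to zero, and so do the coefficients 1/2, 1, -3/2 of the
derivative. The cancellation thus works at two successive levels, for a gain of three orders. -/
lemma IsFlat.biharmonicFlux (h : IsFlat k E) : IsFlat (k + 3) (biharmonicFlux E) := by
  have h1 := h.sq_mul_radialMean (α := 1 / 2) (β := 1) (γ := -(3 / 2)) (by norm_num)
  have h2 := h.sq_mul_radialMean (α := 1 / 2) (β := -1) (γ := 1 / 2) (by norm_num)
  refine ⟨_, fun r hr => ?_, h1, h2.congr fun r hr => ?_⟩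
  · have h3 := ((((h.hasDerivAt_pow_mul_radialMean 1 2 hr).const_mul (1 / 2)).sub
      (h.hasDerivAt_pow_mul_radialMean 3 2 hr)).add
      ((h.hasDerivAt_pow_mul_radialMean 5 2 hr).const_mul (1 / 2)))
    refine (h3.congr_deriv ?_).congr_of_eventuallyEq (Eventually.of_forall fun x => ?_)
    · push_cast
      ring
    · simp only [Pi.add_apply, Pi.sub_apply, _root_.biharmonicFlux]
      ring
  · have : r ≠ 0 := hr.ne'
    unfold _root_.biharmonicFlux
    field_simp
    ring

end Flat

/-! ### Even Taylor expansions with flat remainders. -/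

section EvenPolynomial

open Polynomial Set Filter Topology

lemma exists_derivative_eq (q : ℝ[X]) : ∃ s : ℝ[X], derivative s = q := by
  induction q using Polynomial.induction_on' with
  | add p q hp hq =>
    obtain ⟨s, hs⟩ := hp
    obtain ⟨t, ht⟩ := hq
    exact ⟨s + t, by rw [derivative_add, hs, ht]⟩
  | monomial n a =>
    refine ⟨monomial (n + 1) (a / (n + 1)), ?_⟩
    rw [derivative_monomial, Nat.add_sub_cancel]
    congr 1
    push_cast
    field_simp

lemma exists_add_two_mul_X_mul_derivative_eq (q : ℝ[X]) :
    ∃ s : ℝ[X], s + 2 * X * derivative s = q := by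
  induction q using Polynomial.induction_on' with
  | add p q hp hq =>
    obtain ⟨s, hs⟩ := hp
    obtain ⟨t, ht⟩ := hq
    exact ⟨s + t, by rw [derivative_add, ← hs, ← ht]; ring⟩
  | monomial n a =>
    refine ⟨C (a / (2 * n + 1)) * X ^ n, ?_⟩
    have h : (C (a / (2 * n + 1)) : ℝ[X]) * (2 * n + 1) = C a := by
      rw [show (2 * n + 1 : ℝ[X]) = C (2 * n + 1 : ℝ) by
        rw [map_add, map_mul, map_ofNat, map_natCast, map_one], ← C_mul]
      congr 1
      field_simp
    rw [← C_mul_X_pow_eq_monomial, ← h]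
    cases n with
    | zero => simp
    | succ n =>
      rw [derivative_C_mul_X_pow]
      simp only [Nat.add_sub_cancel, C_mul]
      push_cast
      simp only [map_add, map_natCast, map_one]
      ring

lemma hasDerivAt_eval_sq (s : ℝ[X]) (r : ℝ) :
    HasDerivAt (fun r => s.eval (r ^ 2)) (2 * r * (derivative s).eval (r ^ 2)) r := by
  have := (s.hasDerivAt (r ^ 2)).comp r (hasDerivAt_pow 2 r)
  refine this.congr_deriv ?_
  push_cast
  ring

/-- Taylor expansion of even and odd functions with a flat remainder. -/
lemma exists_isFlat_sub_eval_sq (k : ℕ) (g : ℝ → ℝ) (hg : ContDiff ℝ k g) :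
    ((∀ x, g (-x) = g x) → ∃ q : ℝ[X], IsFlat k fun r => g r - q.eval (r ^ 2)) ∧
    ((∀ x, g (-x) = -g x) → ∃ q : ℝ[X], IsFlat k fun r => g r - r * q.eval (r ^ 2)) := by
  -- Even and odd functions are treated together, since differentiation exchanges them.
  induction k generalizing g with
  | zero =>
    have hc : Continuous g := hg.continuous
    constructor
    · intro _
      refine ⟨C (g 0), ?_⟩
      simp only [eval_C]
      have h1 : Continuous fun r => g r - g 0 := hc.sub continuous_const
      refine ⟨h1.continuousOn, ?_⟩
      have := h1.tendsto 0
      rw [sub_self] at this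
      exact this.mono_left nhdsWithin_le_nhds
    · intro ho
      refine ⟨0, ?_⟩
      simp only [eval_zero, mul_zero, sub_zero]
      have h0 : g 0 = 0 := by
        have := ho 0
        rw [neg_zero] at this
        linarith
      refine ⟨hc.continuousOn, ?_⟩
      have := hc.tendsto 0
      rw [h0] at this
      exact this.mono_left nhdsWithin_le_nhds
  | succ k ih =>
    have hd : Differentiable ℝ g := hg.differentiable (by simp)
    have hg' : ContDiff ℝ k (deriv g) := by
      push_cast at hg
      exact (contDiff_succ_iff_deriv.1 hg).2.2
    have hzero : ∀ h : ℝ → ℝ, Continuous h → h 0 = 0 → Tendsto h (𝓝[>] 0) (𝓝 0) :=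
      fun h hc h0 => by
        have := hc.tendsto 0
        rw [h0] at this
        exact this.mono_left nhdsWithin_le_nhds
    constructor
    · intro he
      have hodd : ∀ x, deriv g (-x) = -deriv g x := fun x => by
        have h1 := deriv_comp_neg g x
        rw [show (fun x => g (-x)) = g from funext he] at h1
        linarith
      obtain ⟨q, hq⟩ := (ih _ hg').2 hodd
      -- The derivative of s(r²) is 2r s'(r²), so s' = q/2 matches the odd expansion of g'.
      obtain ⟨s, hs⟩ := exists_derivative_eq (C (1 / 2) * q)
      refine ⟨s + C (g 0 - s.eval 0), IsFlat.of_deriv (fun r hr => ?_) hq (hzero _ ?_ ?_)⟩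
      · simp only [eval_add, eval_C]
        refine ((hd r).hasDerivAt.sub ((hasDerivAt_eval_sq s r).add_const _)).congr_deriv ?_
        rw [hs, eval_mul, eval_C]
        ring
      · exact hd.continuous.sub ((s + C (g 0 - s.eval 0)).continuous.comp (continuous_pow 2))
      · simp
    · intro ho
      have heven : ∀ x, deriv g (-x) = deriv g x := fun x => by
        have h1 := deriv_comp_neg g x
        rw [show (fun x => g (-x)) = fun x => -g x from funext ho, deriv.fun_neg] at h1
        linarith
      have h0 : g 0 = 0 := by
        have := ho 0
        rw [neg_zero] at this
        linarith
      obtain ⟨q, hq⟩ := (ih _ hg').1 heven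
      -- The derivative of r s(r²) is (s + 2X s')(r²).
      obtain ⟨s, hs⟩ := exists_add_two_mul_X_mul_derivative_eq q
      refine ⟨s, IsFlat.of_deriv (fun r hr => ?_) hq (hzero _ ?_ ?_)⟩
      · refine ((hd r).hasDerivAt.sub ((hasDerivAt_id r).mul (hasDerivAt_eval_sq s r))).congr_deriv ?_
        rw [← hs]
        simp only [eval_add, eval_mul, eval_X, eval_ofNat, id]
        ring
      · exact hd.continuous.sub (continuous_id.mul (s.continuous.comp (continuous_pow 2)))
      · simp [h0]

lemma exists_radialMean_eval_sq (m : ℕ) (q : ℝ[X]) :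
    ∃ s : ℝ[X], ∀ r, 0 < r → radialMean m (fun s => q.eval (s ^ 2)) r = s.eval (r ^ 2) := by
  induction q using Polynomial.induction_on' with
  | add p q hp hq =>
    obtain ⟨s, hs⟩ := hp
    obtain ⟨t, ht⟩ := hq
    refine ⟨s + t, fun r hr => ?_⟩
    rw [eval_add, ← hs r hr, ← ht r hr]
    unfold radialMean
    have hi : ∀ p : ℝ[X], IntervalIntegrable (fun s : ℝ => s ^ m * p.eval (s ^ 2)) volume 0 r :=
      fun p => ((continuous_pow m).mul (p.continuous.comp (continuous_pow 2))).intervalIntegrable _ _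
    rw [← add_div, ← intervalIntegral.integral_add (hi p) (hi q)]
    simp_rw [eval_add, mul_add]
  | monomial n a =>
    refine ⟨monomial n (a / (m + 2 * n + 1)), fun r hr => ?_⟩
    unfold radialMean
    have : ∀ s : ℝ, s ^ m * (monomial n a).eval (s ^ 2) = a * s ^ (m + 2 * n) := fun s => by
      rw [eval_monomial]; ring
    simp_rw [this]
    rw [intervalIntegral.integral_const_mul, integral_pow, eval_monomial]
    have : r ≠ 0 := hr.ne'
    have h2 : (m + 2 * n + 1 : ℝ) ≠ 0 := by positivity
    simp only [ne_eq, Nat.add_eq_zero_iff, one_ne_zero, and_false, not_false_eq_true, zero_pow, sub_zero]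
    push_cast
    field_simp
    ring

/-- Regularity gain of the radial bilaplacian. -/
lemma exists_isFlat_add_four {k : ℕ} {U f : ℝ → ℝ} (hU : Continuous U) {b : ℝ} {q : ℝ[X]}
    (hf : Continuous f) (hd : ∀ r, 0 < r → HasDerivAt U (b * r + biharmonicFlux f r) r)
    (hq : IsFlat k fun r => f r - q.eval (r ^ 2)) :
    ∃ s : ℝ[X], s.eval 0 = U 0 ∧ IsFlat (k + 4) fun r => U r - s.eval (r ^ 2) := by
  obtain ⟨q1, h1⟩ := exists_radialMean_eval_sq 1 q
  obtain ⟨q3, h3⟩ := exists_radialMean_eval_sq 3 q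
  obtain ⟨q5, h5⟩ := exists_radialMean_eval_sq 5 q
  -- The means of a polynomial in r² are again such polynomials, so the flux of the polynomial part
  -- is r times a polynomial in r²; `s` integrates it together with the term b r.
  obtain ⟨s, hs⟩ := exists_derivative_eq
    (C (1 / 2) * (C b + X * (C (1 / 2) * q1 - q3 + C (1 / 2) * q5)))
  have hmean : ∀ m r, 0 < r → radialMean m f r = radialMean m (fun r => f r - q.eval (r ^ 2)) r +
      radialMean m (fun s => q.eval (s ^ 2)) r := fun m r hr => by
    unfold radialMean
    have hqc : Continuous fun s : ℝ => q.eval (s ^ 2) := q.continuous.comp (continuous_pow 2)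
    have i1 : IntervalIntegrable (fun s => s ^ m * (f s - q.eval (s ^ 2))) volume 0 r :=
      ((continuous_pow m).mul (hf.sub hqc)).intervalIntegrable _ _
    have i2 : IntervalIntegrable (fun s => s ^ m * q.eval (s ^ 2)) volume 0 r :=
      ((continuous_pow m).mul hqc).intervalIntegrable _ _
    rw [← add_div, ← intervalIntegral.integral_add i1 i2]
    congr 2
    ext s
    ring
  refine ⟨s + C (U 0 - s.eval 0), by simp, IsFlat.of_deriv (fun r hr => ?_) hq.biharmonicFlux ?_⟩
  · simp only [eval_add, eval_C]
    refine ((hd r hr).sub ((hasDerivAt_eval_sq s r).add_const _)).congr_deriv ?_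
    rw [hs]
    unfold biharmonicFlux
    rw [hmean 1 r hr, hmean 3 r hr, hmean 5 r hr, h1 r hr, h3 r hr, h5 r hr]
    simp only [eval_add, eval_sub, eval_mul, eval_X, eval_C]
    ring
  · have hc : Continuous fun r => U r - (s + C (U 0 - s.eval 0)).eval (r ^ 2) :=
      hU.sub ((s + C (U 0 - s.eval 0)).continuous.comp (continuous_pow 2))
    have := hc.tendsto 0
    simp only [ne_eq, OfNat.ofNat_ne_zero, not_false_eq_true, zero_pow, eval_add, eval_C,
      add_sub_cancel, sub_self] at this
    refine Tendsto.mono_left ?_ nhdsWithin_le_nhds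
    simpa using this

end EvenPolynomial

/-! ### From flat profiles to smooth functions on the whole space. -/

section RadialSmoothness

open Set Filter Topology

variable {X F : Type} [NormedAddCommGroup X] [NormedAddCommGroup F] [NormedSpace ℝ F]

/-- The product of a profile `E(|x|)` with an angular factor `P`, set to `0` at the origin. -/
noncomputable def radialProduct (E : ℝ → ℝ) (P : X → F) (x : X) : F :=
  open Classical in if x = 0 then 0 else E ‖x‖ • P x

lemma radialProduct_of_ne {E : ℝ → ℝ} {P : X → F} {x : X} (hx : x ≠ 0) :
    radialProduct E P x = E ‖x‖ • P x := if_neg hx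

lemma radialProduct_zero (E : ℝ → ℝ) (P : X → F) : radialProduct E P 0 = 0 := if_pos rfl

lemma tendsto_norm_nhdsNE : Tendsto (fun x : X => ‖x‖) (𝓝[≠] 0) (𝓝[>] 0) := by
  refine tendsto_nhdsWithin_iff.2 ⟨?_, ?_⟩
  · have := (continuous_norm (E := X)).tendsto 0
    rw [norm_zero] at this
    exact this.mono_left nhdsWithin_le_nhds
  · filter_upwards [self_mem_nhdsWithin] with x hx using norm_pos_iff.2 hx

variable [InnerProductSpace ℝ X]

/-- The derivative of a function homogeneous of degree 0 has degree -1, so multiplying it by |x|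
restores degree 0 and the induction can continue. -/
lemma fderiv_homogeneous {P : X → F} (hP : ContDiffOn ℝ ∞ P {0}ᶜ)
    (hh : ∀ t : ℝ, 0 < t → ∀ x, x ≠ 0 → P (t • x) = P x) {t : ℝ} (ht : 0 < t) {x : X}
    (hx : x ≠ 0) : t • fderiv ℝ P (t • x) = fderiv ℝ P x := by
  have hd : ∀ y : X, y ≠ 0 → DifferentiableAt ℝ P y := fun y hy =>
    (hP.differentiableOn (by simp)).differentiableAt (isOpen_compl_singleton.mem_nhds hy)
  have htx : t • x ≠ 0 := smul_ne_zero ht.ne' hx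
  have h1 : HasFDerivAt (fun y => P (t • y)) ((fderiv ℝ P (t • x)).comp
      (t • ContinuousLinearMap.id ℝ X)) x :=
    HasFDerivAt.comp x (hd _ htx).hasFDerivAt ((hasFDerivAt_id x).const_smul t)
  have h2 : HasFDerivAt (fun y => P (t • y)) (fderiv ℝ P x) x := by
    refine (hd x hx).hasFDerivAt.congr_of_eventuallyEq ?_
    filter_upwards [isOpen_compl_singleton.mem_nhds hx] with y hy using hh t ht y hy
  rw [← h1.unique h2]
  ext v
  simp

variable [FiniteDimensional ℝ X]

lemma exists_bound_of_homogeneous {P : X → F} (hP : ContDiffOn ℝ ∞ P {0}ᶜ)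
    (hh : ∀ t : ℝ, 0 < t → ∀ x, x ≠ 0 → P (t • x) = P x) : ∃ C, ∀ x, x ≠ 0 → ‖P x‖ ≤ C := by
  have hc : ContinuousOn P (Metric.sphere (0 : X) 1) := hP.continuousOn.mono fun x hx h => by
    simp [mem_singleton_iff.1 h] at hx
  obtain ⟨C, hC⟩ := (isCompact_sphere (0 : X) 1).exists_bound_of_continuousOn hc
  refine ⟨C, fun x hx => ?_⟩
  have hn : 0 < ‖x‖ := norm_pos_iff.2 hx
  rw [← hh ‖x‖⁻¹ (by positivity) x hx]
  refine hC _ ?_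
  rw [mem_sphere_zero_iff_norm, norm_smul, norm_inv, norm_norm, inv_mul_cancel₀ hn.ne']

/-- Flat profiles times smooth angular factors are smooth functions on the whole space. -/
theorem contDiff_radialProduct (k : ℕ) {E : ℝ → ℝ} (hE : IsFlat k E) {P : X → F}
    (hP : ContDiffOn ℝ ∞ P {0}ᶜ) (hh : ∀ t : ℝ, 0 < t → ∀ x, x ≠ 0 → P (t • x) = P x) :
    ContDiff ℝ k (radialProduct E P) := by
  induction k generalizing E F with
  | zero =>
    obtain ⟨C, hC⟩ := exists_bound_of_homogeneous hP hh
    refine contDiff_zero.2 (continuous_iff_continuousAt.2 fun x => ?_)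
    by_cases hx : x = 0
    · subst hx
      rw [continuousAt_iff_punctured_nhds, radialProduct_zero]
      have h1 : Tendsto (fun x : X => |E ‖x‖| * C) (𝓝[≠] 0) (𝓝 0) := by
        have := (hE.2.comp (tendsto_norm_nhdsNE (X := X))).abs.mul_const C
        simpa using this
      refine squeeze_zero_norm' ?_ h1
      filter_upwards [self_mem_nhdsWithin] with x hx
      rw [radialProduct_of_ne hx, norm_smul, Real.norm_eq_abs]
      exact mul_le_mul_of_nonneg_left (hC x hx) (abs_nonneg _)
    · have hn : 0 < ‖x‖ := norm_pos_iff.2 hx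
      have h1 : ContinuousAt (fun y => E ‖y‖ • P y) x :=
        ((hE.1.continuousAt (Ioi_mem_nhds hn)).comp continuous_norm.continuousAt).smul
          (hP.continuousOn.continuousAt (isOpen_compl_singleton.mem_nhds hx))
      refine h1.congr ?_
      filter_upwards [isOpen_compl_singleton.mem_nhds hx] with y hy
      exact (radialProduct_of_ne hy).symm
  | succ k ih =>
    obtain ⟨C, hC⟩ := exists_bound_of_homogeneous hP hh
    obtain ⟨E', hd, hE', hEr⟩ := hE
    -- Away from 0 the derivative of E(|x|) P(x) is E' P₁ + (E/r) P₂. Both terms pair a profile of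
    -- flatness k with an angular factor of degree 0, so the induction varies the target space.
    set P₁ : X → X →L[ℝ] F := fun x => (‖x‖⁻¹ • innerSL ℝ x).smulRight (P x) with hP₁
    set P₂ : X → X →L[ℝ] F := fun x => ‖x‖ • fderiv ℝ P x with hP₂
    have hnorm : ContDiffOn ℝ ∞ (fun x : X => ‖x‖) {0}ᶜ := fun x hx =>
      (contDiffAt_norm ℝ hx).contDiffWithinAt
    have hP₁s : ContDiffOn ℝ ∞ P₁ {0}ᶜ := by
      have hi : ContDiffOn ℝ ∞ (fun x : X => innerSL ℝ x) {0}ᶜ :=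
        (innerSL ℝ (E := X)).contDiff.contDiffOn
      refine ContDiffOn.smulRight (ContDiffOn.smul (f := fun x : X => ‖x‖⁻¹) ?_ hi) hP
      exact hnorm.inv fun x hx => norm_ne_zero_iff.2 hx
    have hP₂s : ContDiffOn ℝ ∞ P₂ {0}ᶜ :=
      hnorm.smul (hP.fderiv_of_isOpen isOpen_compl_singleton (by simp))
    have hP₁h : ∀ t : ℝ, 0 < t → ∀ x, x ≠ 0 → P₁ (t • x) = P₁ x := fun t ht x hx => by
      simp only [hP₁]
      rw [hh t ht x hx, norm_smul, Real.norm_of_nonneg ht.le, map_smul, smul_smul]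
      congr 2
      field_simp
    have hP₂h : ∀ t : ℝ, 0 < t → ∀ x, x ≠ 0 → P₂ (t • x) = P₂ x := fun t ht x hx => by
      simp only [hP₂]
      rw [norm_smul, Real.norm_of_nonneg ht.le, mul_comm, mul_smul, fderiv_homogeneous hP hh ht hx]
    push_cast
    rw [contDiff_succ_iff_hasFDerivAt]
    refine ⟨fun x => radialProduct E' P₁ x + radialProduct (fun r => E r / r) P₂ x,
      (ih hE' hP₁s hP₁h).add (ih hEr hP₂s hP₂h), fun x => ?_⟩
    by_cases hx : x = 0
    · subst hx
      beta_reduce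
      rw [radialProduct_zero, radialProduct_zero, add_zero, hasFDerivAt_iff_isLittleO_nhds_zero]
      simp only [radialProduct_zero, zero_add, sub_zero, zero_apply]
      rw [Asymptotics.isLittleO_iff]
      intro ε hε
      have h1 : Tendsto (fun x : X => |E ‖x‖ / ‖x‖| * C) (𝓝[≠] 0) (𝓝 0) := by
        have := (hEr.zero.2.comp (tendsto_norm_nhdsNE (X := X))).abs.mul_const C
        simpa using this
      have h2 := eventually_nhdsWithin_iff.1 (h1.eventually (gt_mem_nhds hε))
      filter_upwards [h2] with h hlt
      by_cases h0 : h = 0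
      · simp [h0, radialProduct_zero]
      · have hn : 0 < ‖h‖ := norm_pos_iff.2 h0
        rw [radialProduct_of_ne h0, norm_smul, Real.norm_eq_abs]
        have h3 := hlt h0
        rw [abs_div, abs_of_pos hn] at h3
        calc |E ‖h‖| * ‖P h‖ ≤ |E ‖h‖| * C := mul_le_mul_of_nonneg_left (hC h h0) (abs_nonneg _)
          _ = |E ‖h‖| / ‖h‖ * C * ‖h‖ := by field_simp
          _ ≤ ε * ‖h‖ := mul_le_mul_of_nonneg_right h3.le hn.le
    · have hn : 0 < ‖x‖ := norm_pos_iff.2 hx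
      have hdn : HasFDerivAt (fun y : X => ‖y‖) (‖x‖⁻¹ • innerSL ℝ x) x := by
        have h1 := (hasStrictFDerivAt_norm_sq x).hasFDerivAt.sqrt (by positivity)
        simp only [Real.sqrt_sq (norm_nonneg _)] at h1
        refine h1.congr_fderiv ?_
        ext v
        simp
        field_simp
      have hdP : HasFDerivAt P (fderiv ℝ P x) x := ((hP.differentiableOn (by simp)).differentiableAt
        (isOpen_compl_singleton.mem_nhds hx)).hasFDerivAt
      have h2 := ((hd ‖x‖ hn).comp_hasFDerivAt x hdn).smul hdP
      beta_reduce
      rw [radialProduct_of_ne hx, radialProduct_of_ne hx]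
      refine (h2.congr_fderiv ?_).congr_of_eventuallyEq ?_
      · ext v
        simp [hP₁, hP₂, smul_smul]
        rw [div_mul_cancel₀ _ hn.ne', add_comm, mul_assoc]
      · filter_upwards [isOpen_compl_singleton.mem_nhds hx] with y hy
        exact radialProduct_of_ne hy

open Polynomial in
-- The polynomial part is smooth because |x|² is, and the flat remainder is smooth as a radial
-- product with trivial angular factor.
lemma contDiff_of_isFlat_sub {k : ℕ} {U : ℝ → ℝ} {s : ℝ[X]} (h0 : s.eval 0 = U 0)
    (h : IsFlat k fun r => U r - s.eval (r ^ 2)) : ContDiff ℝ k fun x : X => U ‖x‖ := by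
  have h1 := contDiff_radialProduct (X := X) k h (P := fun _ => (1 : ℝ)) contDiffOn_const
    fun _ _ _ _ => rfl
  have h2 : ContDiff ℝ k fun x : X => s.eval (‖x‖ ^ 2) := by
    have : ContDiff ℝ k fun t : ℝ => s.eval t := by
      simpa [Polynomial.coe_aeval_eq_eval] using s.contDiff_aeval (𝕜 := ℝ) (R := ℝ) k
    exact this.comp (contDiff_norm_sq ℝ)
  convert h2.add h1 using 1
  ext x
  by_cases hx : x = 0
  · subst hx
    simp [radialProduct_zero, h0]
  · rw [radialProduct_of_ne hx]
    simp

end RadialSmoothness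

/-! ### Bootstrapping the regularity of radial normal solutions. -/

section RadialNormalRegularity

open Set Filter Topology

variable {p c d : ℝ} {U : ℝ → ℝ}

lemma IsRadialNormal.hasDerivAt (h : IsRadialNormal p c d U) (hp : 0 < p) :
    ∃ b, ∀ r, 0 < r → HasDerivAt U
      (b * r + biharmonicFlux (fun s => (c + d * s ^ (4 * p)) * Real.exp (4 * U s)) r) r := by
  set f : ℝ → ℝ := fun s => (c + d * s ^ (4 * p)) * Real.exp (4 * U s) with hf
  have hfc : Continuous f := (continuous_powerProfile hp c d).mul
    (Real.continuous_exp.comp (continuous_const.mul h.continuous))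
  obtain ⟨C, hC⟩ := h.exists_eq
  have ha := h.integrable
  have ha' := integrableOn_density_div hp h.continuous h.integrable
  have has : IntegrableOn (fun s => s * f s) (Ioi 0) := by
    rw [← Ioc_union_Ioi_eq_Ioi zero_le_one]
    refine IntegrableOn.union ((continuous_id.mul hfc).integrableOn_Icc.mono_set
      Ioc_subset_Icc_self) ?_
    refine (ha.mono_set (Ioi_subset_Ioi zero_le_one)).norm.mono'
      (continuous_id.mul hfc).aestronglyMeasurable ?_
    filter_upwards [ae_restrict_mem measurableSet_Ioi] with s hs
    have hs1 : 1 < s := hs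
    rw [norm_mul, norm_mul _ (s ^ 3), mul_comm]
    refine mul_le_mul_of_nonneg_left ?_ (norm_nonneg _)
    rw [Real.norm_of_nonneg (by positivity), Real.norm_of_nonneg (by positivity)]
    exact le_self_pow₀ hs1.le (by norm_num)
  refine ⟨-(1 / 2) * ∫ s in Ioi 0, s * f s, fun r hr => ?_⟩
  have hU : HasDerivAt U (-((∫ s in Ioi 0, fluxKernel (r / s) * (f s * s ^ 3)) / r)) r := by
    refine ((hasDerivAt_integral_logKernel ha ha' hr).const_sub C).congr_of_eventuallyEq ?_
    filter_upwards [lt_mem_nhds hr] with x hx using hC x hx.le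
  refine hU.congr_deriv ?_
  -- The flux kernel times s³ equals r² s/2 for s ≥ r and s³ - s⁵/(2r²) for s ≤ r. Extending the
  -- first formula to all s gives the linear term, and `g` corrects it on (0, r].
  set g : ℝ → ℝ := fun s => r ^ 2 / 2 * (s ^ 1 * f s) + (s ^ 5 * f s) / (2 * r ^ 2) - s ^ 3 * f s
    with hg
  have hgc : Continuous g := ((continuous_const.mul ((continuous_pow 1).mul hfc)).add
    (((continuous_pow 5).mul hfc).div_const _)).sub ((continuous_pow 3).mul hfc)
  have hgi : IntegrableOn g (Ioc 0 r) := hgc.integrableOn_Icc.mono_set Ioc_subset_Icc_self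
  have hfl : ∫ s in Ioi 0, fluxKernel (r / s) * (f s * s ^ 3) =
      r ^ 2 / 2 * (∫ s in Ioi 0, s * f s) - ∫ s in (0 : ℝ)..r, g s := by
    rw [intervalIntegral.integral_of_le hr.le, ← integral_indicator measurableSet_Ioc,
      ← integral_const_mul]
    have e : ∫ s, (Ioc 0 r).indicator g s = ∫ s in Ioi 0, (Ioc 0 r).indicator g s := by
      rw [setIntegral_eq_integral_of_forall_compl_eq_zero]
      intro s hs
      exact indicator_of_notMem (fun h => hs h.1) _
    rw [e, ← integral_sub (has.const_mul _)
      ((integrable_indicator_iff measurableSet_Ioc).2 hgi).integrableOn]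
    refine setIntegral_congr_fun measurableSet_Ioi fun s hs => ?_
    have hs : 0 < s := hs
    rcases lt_or_ge r s with hrs | hrs
    · rw [indicator_of_notMem (fun h => absurd h.2 (not_le.2 hrs)), fluxKernel,
        if_pos ((div_le_one hs).2 hrs.le)]
      field_simp
      try ring
    · rw [indicator_of_mem (show s ∈ Ioc 0 r from ⟨hs, hrs⟩), fluxKernel]
      split_ifs with hle
      · have hrs' : r = s := le_antisymm ((div_le_one hs).1 hle) hrs
        subst hrs'
        simp only [hg]
        field_simp
        ring
      · simp only [hg]
        field_simp
        ring
  have hgint : ∫ s in (0 : ℝ)..r, g s = r ^ 2 / 2 * (∫ s in (0 : ℝ)..r, s ^ 1 * f s) +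
      (∫ s in (0 : ℝ)..r, s ^ 5 * f s) / (2 * r ^ 2) - ∫ s in (0 : ℝ)..r, s ^ 3 * f s := by
    have i : ∀ m : ℕ, IntervalIntegrable (fun s => s ^ m * f s) volume 0 r := fun m =>
      ((continuous_pow m).mul hfc).intervalIntegrable _ _
    rw [← intervalIntegral.integral_const_mul, ← intervalIntegral.integral_div,
      ← intervalIntegral.integral_add ((i 1).const_mul _) ((i 5).div_const _),
      ← intervalIntegral.integral_sub (((i 1).const_mul _).add ((i 5).div_const _)) (i 3)]
  rw [hfl, hgint]
  unfold biharmonicFlux radialMean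
  have : r ≠ 0 := hr.ne'
  field_simp
  ring

variable {X : Type} [NormedAddCommGroup X] [InnerProductSpace ℝ X] [FiniteDimensional ℝ X]
  [Nontrivial X]

/-- Radial normal solutions gain four derivatives. -/
lemma IsRadialNormal.contDiff_add_four (h : IsRadialNormal p c d U) (hp : 0 < p) {k : ℕ}
    (hk : ContDiff ℝ k fun x : X => (c + d * ‖x‖ ^ (4 * p)) * Real.exp (4 * U ‖x‖)) :
    ContDiff ℝ (k + 4 : ℕ) fun x : X => U ‖x‖ := by
  obtain ⟨b, hb⟩ := h.hasDerivAt hp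
  obtain ⟨e, he⟩ := exists_norm_eq X zero_le_one
  -- Restriction to a line through the origin produces an even function of one variable, to which
  -- the even Taylor expansion applies.
  have hline : ContDiff ℝ k fun t : ℝ => (c + d * |t| ^ (4 * p)) * Real.exp (4 * U |t|) := by
    have h1 : ContDiff ℝ k fun t : ℝ => t • e := contDiff_id.smul contDiff_const
    convert hk.comp h1 using 1
    ext t
    simp [norm_smul, he]
  obtain ⟨q, hq⟩ := (exists_isFlat_sub_eval_sq k _ hline).1 fun x => by rw [abs_neg]
  have hc : Continuous fun s : ℝ => (c + d * s ^ (4 * p)) * Real.exp (4 * U s) :=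
    (continuous_powerProfile hp c d).mul
      (Real.continuous_exp.comp (continuous_const.mul h.continuous))
  obtain ⟨s, hs0, hs⟩ := exists_isFlat_add_four h.continuous hc hb (q := q)
    (hq.congr fun r hr => by rw [abs_of_pos hr])
  exact contDiff_of_isFlat_sub hs0 hs

lemma IsRadialNormal.contDiff_four (h : IsRadialNormal p c d U) (hp : 0 < p) :
    ContDiff ℝ 4 fun x : X => U ‖x‖ := by
  have := h.contDiff_add_four (X := X) hp (k := 0) (contDiff_zero.2 ?_)
  · simpa using this
  · exact ((continuous_powerProfile hp c d).comp continuous_norm).mul (Real.continuous_exp.comp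
      (continuous_const.mul (h.continuous.comp continuous_norm)))

/-- With smooth curvature the right side is as regular as the solution, so each pass gains four
derivatives. -/
lemma IsRadialNormal.contDiff_infty (h : IsRadialNormal p c d U) (hp : 0 < p)
    (hQ : ContDiff ℝ ∞ fun x : X => c + d * ‖x‖ ^ (4 * p)) :
    ContDiff ℝ ∞ fun x : X => U ‖x‖ := by
  have key : ∀ j : ℕ, ContDiff ℝ (4 * j : ℕ) fun x : X => U ‖x‖ := fun j => by
    induction j with
    | zero => exact contDiff_zero.2 (h.continuous.comp continuous_norm)
    | succ j ih =>
      refine h.contDiff_add_four hp ?_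
      exact (hQ.of_le (by exact_mod_cast le_top)).mul
        (Real.contDiff_exp.comp (contDiff_const.mul ih))
  exact _root_.contDiff_infty.2 fun n => (key n).of_le (by exact_mod_cast by omega)

end RadialNormalRegularity

/-! ### The angular mean of the logarithm. -/

section AngularIntegral

open Set Filter Topology intervalIntegral

lemma integral_cos_mul_of_ne_zero {k : ℤ} (hk : k ≠ 0) :
    ∫ θ in (0 : ℝ)..Real.pi, Real.cos (k * θ) = 0 := by
  have hk' : (k : ℝ) ≠ 0 := Int.cast_ne_zero.2 hk
  rw [intervalIntegral.integral_comp_mul_left (fun x => Real.cos x) hk', integral_cos,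
    Real.sin_int_mul_pi]
  simp

lemma integral_sin_sq_mul_cos_nat_mul {n : ℕ} (hn : n ≠ 0) :
    ∫ θ in (0 : ℝ)..Real.pi, Real.sin θ ^ 2 * Real.cos (n * θ) =
      if n = 2 then -(Real.pi / 4) else 0 := by
  have h : ∀ θ : ℝ, Real.sin θ ^ 2 * Real.cos (n * θ) = 1 / 2 * Real.cos ((n : ℤ) * θ) -
      1 / 4 * Real.cos (((n : ℤ) - 2 : ℤ) * θ) - 1 / 4 * Real.cos (((n : ℤ) + 2 : ℤ) * θ) := by
    intro θ
    push_cast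
    rw [sub_mul, add_mul, Real.cos_sub, Real.cos_add, Real.sin_sq_eq_half_sub]
    ring
  have hi : ∀ k : ℤ, IntervalIntegrable (fun θ => Real.cos (k * θ)) volume 0 Real.pi := fun k =>
    (Real.continuous_cos.comp (continuous_const.mul continuous_id)).intervalIntegrable _ _
  simp_rw [h]
  rw [intervalIntegral.integral_sub (((hi _).const_mul _).sub ((hi _).const_mul _))
    ((hi _).const_mul _), intervalIntegral.integral_sub ((hi _).const_mul _) ((hi _).const_mul _),
    intervalIntegral.integral_const_mul, intervalIntegral.integral_const_mul,
    intervalIntegral.integral_const_mul, integral_cos_mul_of_ne_zero (by exact_mod_cast hn),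
    integral_cos_mul_of_ne_zero (by omega : (n : ℤ) + 2 ≠ 0)]
  split_ifs with h2
  · subst h2
    simp
    ring
  · rw [integral_cos_mul_of_ne_zero (by omega)]
    simp

/-- The mean of `log |1 - q e^{iθ}|²` against `sin² θ`. -/
lemma integral_sin_sq_mul_log {q : ℝ} (hq0 : 0 ≤ q) (hq1 : q < 1) :
    ∫ θ in (0 : ℝ)..Real.pi, Real.sin θ ^ 2 * Real.log (1 - 2 * q * Real.cos θ + q ^ 2) =
      Real.pi * q ^ 2 / 4 := by
  -- The real part of -log(1 - q e^{iθ}) = Σ qⁿ e^{inθ}/n. Against sin² θ = (1 - cos 2θ)/2 only n =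
  -- 2 survives.
  have hsum : ∀ θ : ℝ, HasSum (fun n : ℕ => Real.sin θ ^ 2 * (q ^ n * Real.cos (n * θ) / n))
      (Real.sin θ ^ 2 * (-(1 / 2) * Real.log (1 - 2 * q * Real.cos θ + q ^ 2))) := by
    intro θ
    refine HasSum.mul_left _ ?_
    set z : ℂ := q * Complex.exp (θ * Complex.I) with hz
    have hzn : ‖z‖ = q := by
      rw [hz, norm_mul, Complex.norm_exp_ofReal_mul_I, mul_one, Complex.norm_real,
        Real.norm_of_nonneg hq0]
    have h1 := Complex.hasSum_re (Complex.hasSum_taylorSeries_neg_log (z := z) (by rwa [hzn]))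
    have e1 : (-Complex.log (1 - z)).re =
        -(1 / 2) * Real.log (1 - 2 * q * Real.cos θ + q ^ 2) := by
      rw [Complex.neg_re, Complex.log_re]
      have h2 : 1 - 2 * q * Real.cos θ + q ^ 2 = ‖1 - z‖ ^ 2 := by
        rw [← Complex.normSq_eq_norm_sq, Complex.normSq_apply, hz, Complex.exp_mul_I,
          ← Complex.ofReal_cos, ← Complex.ofReal_sin]
        simp [-Complex.ofReal_cos, -Complex.ofReal_sin]
        nlinarith [Real.sin_sq_add_cos_sq θ]
      rw [h2, Real.log_pow]
      push_cast
      ring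
    rw [e1] at h1
    have e2 : (fun n : ℕ => q ^ n * Real.cos (n * θ) / n) = fun n : ℕ => (z ^ n / n).re := by
      funext n
      rw [hz, mul_pow, ← Complex.exp_nat_mul, ← Complex.ofReal_pow,
        show (n : ℂ) * (θ * Complex.I) = ((n * θ : ℝ) : ℂ) * Complex.I by push_cast; ring,
        Complex.exp_mul_I, ← Complex.ofReal_cos, ← Complex.ofReal_sin, ← Complex.ofReal_natCast,
        Complex.div_ofReal_re, Complex.re_ofReal_mul]
      simp [-Complex.ofReal_cos, -Complex.ofReal_sin]
    rw [e2]
    exact h1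
  have hI := intervalIntegral.hasSum_integral_of_dominated_convergence (μ := volume) (a := 0)
    (b := Real.pi) (fun n _ => q ^ n) (fun n => ?_) (fun n => ?_) ?_ ?_
    (Eventually.of_forall fun θ _ => hsum θ)
  · have hterm : ∀ n : ℕ, ∫ θ in (0 : ℝ)..Real.pi,
        Real.sin θ ^ 2 * (q ^ n * Real.cos (n * θ) / n) =
        if n = 2 then -(Real.pi * q ^ 2 / 8) else 0 := by
      intro n
      rcases eq_or_ne n 0 with rfl | hn
      -- The term n = 0 vanishes because division by zero gives zero.
      · simp
      · have : ∀ θ : ℝ, Real.sin θ ^ 2 * (q ^ n * Real.cos (n * θ) / n) =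
            q ^ n / n * (Real.sin θ ^ 2 * Real.cos (n * θ)) := fun θ => by ring
        simp_rw [this]
        rw [intervalIntegral.integral_const_mul, integral_sin_sq_mul_cos_nat_mul hn]
        split_ifs with h2
        · subst h2; push_cast; ring
        · simp
    simp_rw [hterm] at hI
    have h3 := hI.unique (hasSum_ite_eq 2 (-(Real.pi * q ^ 2 / 8)))
    have h4 : ∀ θ : ℝ, Real.sin θ ^ 2 * (-(1 / 2) *
        Real.log (1 - 2 * q * Real.cos θ + q ^ 2)) =
        -(1 / 2) * (Real.sin θ ^ 2 * Real.log (1 - 2 * q * Real.cos θ + q ^ 2)) := fun θ => by ring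
    simp_rw [h4] at h3
    rw [intervalIntegral.integral_const_mul] at h3
    linarith
  · exact (Continuous.aestronglyMeasurable (by fun_prop))
  · refine Eventually.of_forall fun θ _ => ?_
    rw [norm_mul, norm_div, norm_mul, Real.norm_of_nonneg (sq_nonneg (Real.sin θ)),
      Real.norm_of_nonneg (pow_nonneg hq0 n), Real.norm_natCast]
    have h1 : Real.sin θ ^ 2 ≤ 1 := Real.sin_sq_le_one θ
    have h2 : ‖Real.cos (n * θ)‖ ≤ 1 := Real.abs_cos_le_one _
    have h3 : 0 ≤ q ^ n := pow_nonneg hq0 n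
    rcases eq_or_ne n 0 with rfl | hn
    · simp
    · have hn1 : (1 : ℝ) ≤ n := by exact_mod_cast Nat.one_le_iff_ne_zero.2 hn
      calc Real.sin θ ^ 2 * (q ^ n * ‖Real.cos (n * θ)‖ / n) ≤ 1 * (q ^ n * 1 / 1) := by gcongr
        _ = q ^ n := by ring
  · exact Eventually.of_forall fun θ _ => summable_geometric_of_lt_one hq0 hq1
  · simp

/-- Factoring out the larger of r and s leaves a ratio q < 1 and reduces both cases to the preceding
integral. The excluded value s = r is negligible in the later integration. -/
lemma integral_sin_sq_mul_log_ratio {r s : ℝ} (hr : 0 ≤ r) (hs : 0 < s) (hne : r ≠ s) :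
    ∫ θ in (0 : ℝ)..Real.pi, Real.sin θ ^ 2 *
      Real.log (s / √(r ^ 2 - 2 * r * s * Real.cos θ + s ^ 2)) =
      -(Real.pi / 2) * logKernel (r / s) := by
  have hpos : ∀ q θ : ℝ, 0 ≤ q → q < 1 → 0 < 1 - 2 * q * Real.cos θ + q ^ 2 := fun q θ h0 h1 => by
    nlinarith [Real.cos_le_one θ, mul_nonneg h0 (sub_nonneg.2 (Real.cos_le_one θ))]
  have key : ∀ q c : ℝ, 0 ≤ q → q < 1 → ∫ θ in (0 : ℝ)..Real.pi, Real.sin θ ^ 2 *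
      (c - 1 / 2 * Real.log (1 - 2 * q * Real.cos θ + q ^ 2)) =
      Real.pi / 2 * (c - q ^ 2 / 4) := by
    intro q c h0 h1
    have hc : Continuous fun θ => Real.log (1 - 2 * q * Real.cos θ + q ^ 2) :=
      Continuous.log (by fun_prop) fun θ => (hpos q θ h0 h1).ne'
    have e : ∀ θ : ℝ, Real.sin θ ^ 2 * (c - 1 / 2 * Real.log (1 - 2 * q * Real.cos θ + q ^ 2)) =
        c * Real.sin θ ^ 2 - 1 / 2 * (Real.sin θ ^ 2 *
          Real.log (1 - 2 * q * Real.cos θ + q ^ 2)) := fun θ => by ring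
    simp_rw [e]
    have i1 : IntervalIntegrable (fun θ => c * Real.sin θ ^ 2) volume 0 Real.pi :=
      Continuous.intervalIntegrable (by fun_prop) _ _
    have i2 : IntervalIntegrable (fun θ => 1 / 2 * (Real.sin θ ^ 2 *
        Real.log (1 - 2 * q * Real.cos θ + q ^ 2))) volume 0 Real.pi :=
      Continuous.intervalIntegrable (by fun_prop) _ _
    rw [intervalIntegral.integral_sub i1 i2, intervalIntegral.integral_const_mul,
      intervalIntegral.integral_const_mul, integral_sin_sq_mul_log h0 h1, integral_sin_sq]
    simp
    ring
  rcases lt_or_gt_of_ne hne with h | h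
  · have hq1 : r / s < 1 := (div_lt_one hs).2 h
    have hq0 : 0 ≤ r / s := by positivity
    rw [logKernel, if_pos hq1.le, show -(Real.pi / 2) * ((r / s) ^ 2 / 4) =
      Real.pi / 2 * (0 - (r / s) ^ 2 / 4) by ring, ← key (r / s) 0 hq0 hq1]
    refine intervalIntegral.integral_congr fun θ _ => ?_
    have hp := hpos (r / s) θ hq0 hq1
    have e : r ^ 2 - 2 * r * s * Real.cos θ + s ^ 2 =
        s ^ 2 * (1 - 2 * (r / s) * Real.cos θ + (r / s) ^ 2) := by field_simp; ring
    rw [e, Real.sqrt_mul (sq_nonneg s), Real.sqrt_sq hs.le, ← div_div, div_self hs.ne',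
      one_div, Real.log_inv, Real.log_sqrt hp.le]
    ring
  · have hr0 : 0 < r := hs.trans h
    have hq1 : s / r < 1 := (div_lt_one hr0).2 h
    have hq0 : 0 ≤ s / r := by positivity
    have h1 : ¬ r / s ≤ 1 := not_le.2 ((one_lt_div hs).2 h)
    rw [logKernel, if_neg h1, show -(Real.pi / 2) * (Real.log (r / s) + ((r / s) ^ 2)⁻¹ / 4) =
      Real.pi / 2 * (Real.log (s / r) - (s / r) ^ 2 / 4) by
        rw [← inv_div s r, Real.log_inv, inv_pow, inv_inv]; ring, ← key (s / r) _ hq0 hq1]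
    refine intervalIntegral.integral_congr fun θ _ => ?_
    have hp := hpos (s / r) θ hq0 hq1
    have e : r ^ 2 - 2 * r * s * Real.cos θ + s ^ 2 =
        r ^ 2 * (1 - 2 * (s / r) * Real.cos θ + (s / r) ^ 2) := by field_simp
    rw [e, Real.sqrt_mul (sq_nonneg r), Real.sqrt_sq hr0.le, ← div_div, Real.log_div
      (by positivity) (Real.sqrt_ne_zero'.2 hp), Real.log_sqrt hp.le]
    ring

end AngularIntegral

/-! ### Lebesgue measure on ℝ⁴ in polar coordinates around an axis. -/

section PolarCoordinates

open Set Filter Topology ENNReal Measure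

lemma lintegral_fun_norm {E : Type*} [NormedAddCommGroup E] [NormedSpace ℝ E]
    [FiniteDimensional ℝ E] [MeasurableSpace E] [BorelSpace E] [Nontrivial E] (μ : Measure E)
    [μ.IsAddHaarMeasure] {f : ℝ → ℝ≥0∞} (hf : Measurable f) :
    ∫⁻ x, f ‖x‖ ∂μ = μ.toSphere univ *
      ∫⁻ r in Ioi (0 : ℝ), ENNReal.ofReal (r ^ (Module.finrank ℝ E - 1)) * f r := by
  have hf' : Measurable fun r : Ioi (0 : ℝ) => f r := hf.comp measurable_subtype_coe
  calc ∫⁻ x, f ‖x‖ ∂μ = ∫⁻ x : ({(0)}ᶜ : Set E), f ‖x.1‖ ∂(μ.comap (↑)) := by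
        rw [lintegral_subtype_comap (measurableSet_singleton _).compl fun x => f ‖x‖,
          restrict_compl_singleton]
    _ = ∫⁻ x, f x.2 ∂μ.toSphere.prod (Measure.volumeIoiPow (Module.finrank ℝ E - 1)) :=
        by simpa [homeomorphUnitSphereProd_apply_snd_coe] using
          μ.measurePreserving_homeomorphUnitSphereProd.lintegral_comp
            (f := fun x => f x.2) (hf'.comp measurable_snd)
    _ = (∫⁻ r : Ioi (0 : ℝ), f r ∂(Measure.volumeIoiPow (Module.finrank ℝ E - 1))) *
          μ.toSphere univ := by
        have h2 : Measurable fun x : Metric.sphere (0 : E) 1 × Ioi (0 : ℝ) => f x.2 :=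
          hf'.comp measurable_snd
        rw [lintegral_prod _ h2.aemeasurable]
        exact lintegral_const
          (∫⁻ r : Ioi (0 : ℝ), f r ∂(Measure.volumeIoiPow (Module.finrank ℝ E - 1)))
    _ = _ := by
        rw [mul_comm, volumeIoiPow, lintegral_withDensity_eq_lintegral_mul _ (by fun_prop) hf']
        congr 1
        exact lintegral_subtype_comap measurableSet_Ioi
          fun r => ENNReal.ofReal (r ^ (Module.finrank ℝ E - 1)) * f r

/-- Splitting off the first coordinate of `ℝ⁴`. -/
noncomputable def splitFirst (y : EuclideanSpace ℝ (Fin 4)) : ℝ × EuclideanSpace ℝ (Fin 3) :=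
  (y 0, WithLp.toLp 2 fun i => y i.succ)

lemma measurePreserving_splitFirst : MeasurePreserving splitFirst := by
  have h1 := PiLp.volume_preserving_ofLp (Fin 4)
  have h2 := volume_preserving_piFinSuccAbove (fun _ : Fin 4 => ℝ) 0
  have h3 : MeasurePreserving (Prod.map (id : ℝ → ℝ) (WithLp.toLp 2 : (Fin 3 → ℝ) → _)) :=
    (MeasurePreserving.id volume).prod (PiLp.volume_preserving_toLp (Fin 3))
  exact h3.comp (h2.comp h1)

/-- The cylindrical coordinates `(y₀, |(y₁, y₂, y₃)|)`. -/
noncomputable def cylindrical (y : EuclideanSpace ℝ (Fin 4)) : ℝ × ℝ :=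
  ((splitFirst y).1, ‖(splitFirst y).2‖)

lemma measurable_cylindrical : Measurable cylindrical :=
  (measurable_fst.comp measurePreserving_splitFirst.measurable).prodMk
    (measurable_norm.comp (measurable_snd.comp measurePreserving_splitFirst.measurable))

lemma cylindrical_sq_add_sq (y : EuclideanSpace ℝ (Fin 4)) :
    (cylindrical y).1 ^ 2 + (cylindrical y).2 ^ 2 = ‖y‖ ^ 2 := by
  simp only [cylindrical, splitFirst, EuclideanSpace.real_norm_sq_eq, Fin.sum_univ_succ]

/-- The measure `s³ sin² θ ds dθ`. -/
noncomputable def polarMeasure : Measure (ℝ × ℝ) :=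
  ((volume.restrict (Ioi 0)).prod (volume.restrict (Ioo 0 Real.pi))).withDensity
    fun z => ENNReal.ofReal (z.1 ^ 3 * Real.sin z.2 ^ 2)

/-- The dimensional constant relating Lebesgue measure on `ℝ⁴` to `polarMeasure`. -/
noncomputable def polarConst : ℝ≥0∞ :=
  (volume : Measure (EuclideanSpace ℝ (Fin 3))).toSphere univ

lemma polarConst_ne_top : polarConst ≠ ⊤ := measure_ne_top _ _

lemma polarConst_ne_zero : polarConst ≠ 0 := by
  rw [polarConst, Ne, Measure.measure_univ_eq_zero]
  exact toSphere_ne_zero _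

lemma measurable_polarMap :
    Measurable fun z : ℝ × ℝ => (z.1 * Real.cos z.2, z.1 * Real.sin z.2) := by fun_prop

/-- Lebesgue measure on `ℝ⁴` in cylindrical-polar coordinates. -/
theorem map_cylindrical : (volume : Measure (EuclideanSpace ℝ (Fin 4))).map cylindrical =
    polarConst • polarMeasure.map fun z => (z.1 * Real.cos z.2, z.1 * Real.sin z.2) := by
  refine Measure.ext_of_lintegral _ fun F hF => ?_
  rw [lintegral_map hF measurable_cylindrical, lintegral_smul_measure, smul_eq_mul,
    lintegral_map hF measurable_polarMap]
  have hF' : Measurable fun w : ℝ × EuclideanSpace ℝ (Fin 3) => F (w.1, ‖w.2‖) :=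
    hF.comp (measurable_fst.prodMk (measurable_norm.comp measurable_snd))
  -- Integrating over spheres in the ℝ³ factor leaves ρ² on a half-plane. The indicator extends it
  -- to the plane, where polar coordinates apply; it then restricts the angle to (0, π).
  set G : ℝ × ℝ → ℝ≥0∞ := fun w => (Ioi 0).indicator (fun ρ => ENNReal.ofReal (ρ ^ 2)) w.2 * F w
    with hG
  have hGm : Measurable G :=
    (((Measurable.indicator (by fun_prop) measurableSet_Ioi)).comp measurable_snd).mul hF
  have h1 : ∫⁻ y, F (cylindrical y) = polarConst * ∫⁻ w, G w := by
    have e1 := measurePreserving_splitFirst.lintegral_comp hF'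
    have e2 : ∫⁻ y, F (cylindrical y) =
        ∫⁻ y, (fun w : ℝ × EuclideanSpace ℝ (Fin 3) => F (w.1, ‖w.2‖)) (splitFirst y) := rfl
    rw [e2, e1, volume_eq_prod, volume_eq_prod, lintegral_prod _ hF'.aemeasurable,
      lintegral_prod _ hGm.aemeasurable, ← lintegral_const_mul _ hGm.lintegral_prod_right']
    refine lintegral_congr fun a => ?_
    have e3 := lintegral_fun_norm (volume : Measure (EuclideanSpace ℝ (Fin 3)))
      (f := fun ρ => F (a, ρ)) (hF.comp (measurable_const.prodMk measurable_id))
    rw [e3, finrank_euclideanSpace_fin, polarConst]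
    congr 1
    rw [← lintegral_indicator measurableSet_Ioi]
    refine lintegral_congr fun ρ => ?_
    simp only [hG, indicator]
    split_ifs <;> simp
  rw [h1, ← lintegral_comp_polarCoord_symm, polarMeasure,
    lintegral_withDensity_eq_lintegral_mul _ (by fun_prop)
      (g := fun z : ℝ × ℝ => F (z.1 * Real.cos z.2, z.1 * Real.sin z.2))
      (hF.comp measurable_polarMap)]
  congr 1
  rw [prod_restrict, ← volume_eq_prod,
    ← lintegral_indicator (measurableSet_Ioi.prod measurableSet_Ioo),
    ← lintegral_indicator polarCoord.open_target.measurableSet]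
  refine lintegral_congr fun z => ?_
  obtain ⟨s, θ⟩ := z
  simp only [polarCoord_target, polarCoord_symm_apply, indicator, mem_prod, mem_Ioi, mem_Ioo, hG,
    Pi.mul_apply, smul_eq_mul]
  by_cases hs : 0 < s
  swap
  · simp [hs]
  have hpi := Real.pi_pos
  by_cases hθ : 0 < θ ∧ θ < Real.pi
  · have hsin := Real.sin_pos_of_pos_of_lt_pi hθ.1 hθ.2
    rw [if_pos ⟨hs, by linarith, hθ.2⟩, if_pos (mul_pos hs hsin), if_pos ⟨hs, hθ⟩, ← mul_assoc,
      ← ENNReal.ofReal_mul hs.le]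
    congr 2
    ring
  · rw [if_neg (fun h => hθ h.2 : ¬ (0 < s ∧ 0 < θ ∧ θ < Real.pi))]
    split_ifs with h2 h3
    · exfalso
      have : ¬ 0 < θ := fun h => hθ ⟨h, h2.2.2⟩
      have hsin := Real.sin_nonpos_of_nonpos_of_neg_pi_le (not_lt.1 this) h2.2.1.le
      nlinarith
    · simp
    · rfl

end PolarCoordinates

/-! ### Reduction of the logarithmic potential to one dimension. -/

section LogPotential

open Set Filter Topology

lemma integral_comp_cylindrical {H : ℝ × ℝ → ℝ} (hH : Measurable H)
    (hi : Integrable fun y => H (cylindrical y)) :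
    ∫ y, H (cylindrical y) = polarConst.toReal * ∫ s in Ioi (0 : ℝ), ∫ θ in (0 : ℝ)..Real.pi,
      s ^ 3 * Real.sin θ ^ 2 * H (s * Real.cos θ, s * Real.sin θ) := by
  have hw : Measurable fun z : ℝ × ℝ => ENNReal.ofReal (z.1 ^ 3 * Real.sin z.2 ^ 2) := by fun_prop
  have hw' : ∀ᵐ z ∂(volume.restrict (Ioi (0 : ℝ))).prod (volume.restrict (Ioo 0 Real.pi)),
      ENNReal.ofReal (z.1 ^ 3 * Real.sin z.2 ^ 2) < ⊤ :=
    Eventually.of_forall fun _ => ENNReal.ofReal_lt_top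
  have h1 : Integrable H (polarMeasure.map
      fun z => (z.1 * Real.cos z.2, z.1 * Real.sin z.2)) := by
    rw [← integrable_smul_measure polarConst_ne_zero polarConst_ne_top, ← map_cylindrical]
    exact (integrable_map_measure hH.aestronglyMeasurable measurable_cylindrical.aemeasurable).2 hi
  have h2 := (integrable_map_measure hH.aestronglyMeasurable
    measurable_polarMap.aemeasurable).1 h1
  rw [polarMeasure, integrable_withDensity_iff_integrable_smul' hw hw'] at h2
  simp only [Function.comp_apply] at h2
  rw [← integral_map measurable_cylindrical.aemeasurable hH.aestronglyMeasurable, map_cylindrical,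
    integral_smul_measure, smul_eq_mul, integral_map measurable_polarMap.aemeasurable
      hH.aestronglyMeasurable, polarMeasure, integral_withDensity_eq_integral_toReal_smul hw hw',
    integral_prod _ h2]
  congr 1
  refine setIntegral_congr_fun measurableSet_Ioi fun s hs => ?_
  have hs : 0 < s := hs
  simp only [smul_eq_mul]
  rw [intervalIntegral.integral_of_le Real.pi_pos.le, integral_Ioc_eq_integral_Ioo]
  refine integral_congr_ae (Eventually.of_forall fun θ => ?_)
  simp only
  rw [ENNReal.toReal_ofReal (by positivity)]

/-- The constant `c` with `∫ h(|y|) dy = c ∫₀^∞ h(s) s³ ds` on `ℝ⁴`. -/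
noncomputable def radialConst : ℝ := polarConst.toReal * (Real.pi / 2)

lemma radialConst_pos : 0 < radialConst :=
  mul_pos (ENNReal.toReal_pos polarConst_ne_zero polarConst_ne_top) (by positivity)

lemma sqrt_polar {s : ℝ} (hs : 0 ≤ s) (θ : ℝ) :
    √((s * Real.cos θ) ^ 2 + (s * Real.sin θ) ^ 2) = s := by
  rw [show (s * Real.cos θ) ^ 2 + (s * Real.sin θ) ^ 2 = s ^ 2 by
    nlinarith [Real.sin_sq_add_cos_sq θ], Real.sqrt_sq hs]

lemma sqrt_cylindrical (y : EuclideanSpace ℝ (Fin 4)) :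
    √((cylindrical y).1 ^ 2 + (cylindrical y).2 ^ 2) = ‖y‖ := by
  rw [cylindrical_sq_add_sq, Real.sqrt_sq (norm_nonneg y)]

lemma integral_norm_eq {h : ℝ → ℝ} (hh : Measurable h)
    (hi : Integrable fun y : EuclideanSpace ℝ (Fin 4) => h ‖y‖) :
    ∫ y : EuclideanSpace ℝ (Fin 4), h ‖y‖ = radialConst * ∫ s in Ioi (0 : ℝ), h s * s ^ 3 := by
  have hm : Measurable fun w : ℝ × ℝ => h √(w.1 ^ 2 + w.2 ^ 2) := hh.comp (by fun_prop)
  have key := integral_comp_cylindrical hm (by simpa only [sqrt_cylindrical] using hi)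
  simp only [sqrt_cylindrical] at key
  rw [key, radialConst, mul_assoc, ← integral_const_mul (Real.pi / 2)]
  congr 1
  refine setIntegral_congr_fun measurableSet_Ioi fun s (hs : 0 < s) => ?_
  simp only [sqrt_polar hs.le]
  rw [show (fun θ : ℝ => s ^ 3 * Real.sin θ ^ 2 * h s) =
    fun θ : ℝ => (s ^ 3 * h s) * Real.sin θ ^ 2 by funext θ; ring,
    intervalIntegral.integral_const_mul, integral_sin_sq]
  simp
  ring

lemma integrable_norm_iff {h : ℝ → ℝ} :
    Integrable (fun y : EuclideanSpace ℝ (Fin 4) => h ‖y‖) ↔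
      IntegrableOn (fun s => h s * s ^ 3) (Ioi 0) := by
  rw [integrable_fun_norm_addHaar, finrank_euclideanSpace_fin]
  simp only [smul_eq_mul, mul_comm, Nat.add_one_sub_one]

lemma integrable_indicator_log_norm (R : ℝ) : Integrable
    ((Metric.ball (0 : EuclideanSpace ℝ (Fin 4)) R).indicator fun y => Real.log ‖y‖) := by
  rw [integrable_indicator_iff measurableSet_ball, integrableOn_fun_norm_addHaar,
    finrank_euclideanSpace_fin]
  have hc : Continuous fun s : ℝ => s ^ 2 * (s * Real.log s) :=
    (continuous_pow 2).mul Real.continuous_mul_log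
  refine ((hc.integrableOn_Icc (a := 0) (b := R)).mono_set Ioo_subset_Icc_self).congr_fun
    (fun s _ => ?_) measurableSet_Ioo
  simp only [smul_eq_mul]
  ring

lemma abs_log_norm_div_le {V : Type*} [NormedAddCommGroup V] {x y : V} (h : 2 * ‖x‖ ≤ ‖y‖)
    (hy : y ≠ 0) : |Real.log (‖y‖ / ‖x - y‖)| ≤ Real.log 2 := by
  have hy0 : 0 < ‖y‖ := norm_pos_iff.2 hy
  have h1 : ‖y‖ - ‖x‖ ≤ ‖x - y‖ := by rw [norm_sub_rev]; exact norm_sub_norm_le y x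
  have h2 : ‖x - y‖ ≤ ‖x‖ + ‖y‖ := norm_sub_le x y
  have h3 : 0 < ‖x - y‖ := by linarith
  rw [abs_le, ← Real.log_inv]
  constructor
  · refine Real.log_le_log (by norm_num) ?_
    rw [le_div_iff₀ h3]
    linarith
  · refine Real.log_le_log (by positivity) ?_
    rw [div_le_iff₀ h3]
    linarith

/-- For |y| ≥ 2|x| the kernel is at most log 2 in absolute value. Otherwise y and x - y both lie in
a ball of radius 3|x| + 1, where the two logarithms are integrable and the density is bounded. -/
lemma integrable_log_mul {h : ℝ → ℝ} (hh : Continuous h)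
    (hi : Integrable fun y : EuclideanSpace ℝ (Fin 4) => h ‖y‖) (x : EuclideanSpace ℝ (Fin 4)) :
    Integrable fun y => Real.log (‖y‖ / ‖x - y‖) * h ‖y‖ := by
  set R := 3 * ‖x‖ + 1 with hR
  obtain ⟨M, hM⟩ := (isCompact_Icc (a := (0 : ℝ)) (b := R)).exists_bound_of_continuousOn
    hh.continuousOn
  have hx := norm_nonneg x
  have hM0 : 0 ≤ M := (norm_nonneg _).trans (hM 0 ⟨le_rfl, by positivity⟩)
  have i1 := integrable_indicator_log_norm R
  have i2 := i1.comp_sub_left x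
  refine (((i1.norm.add i2.norm).mul_const M).add (hi.norm.const_mul (Real.log 2))).mono'
    (Measurable.aestronglyMeasurable ?_) ?_
  · exact (Real.measurable_log.comp (by fun_prop)).mul (hh.measurable.comp measurable_norm)
  filter_upwards [compl_mem_ae_iff.2 (measure_singleton (0 : EuclideanSpace ℝ (Fin 4)))] with y hy
  have hl2 : 0 ≤ Real.log 2 := Real.log_nonneg one_le_two
  simp only [Pi.add_apply, norm_mul]
  rcases le_total (2 * ‖x‖) ‖y‖ with h2 | h2
  · have := mul_le_mul_of_nonneg_right (abs_log_norm_div_le h2 hy) (norm_nonneg (h ‖y‖))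
    exact this.trans (le_add_of_nonneg_left (by positivity))
  · refine le_trans ?_ (le_add_of_nonneg_right (by positivity))
    have m1 : y ∈ Metric.ball (0 : EuclideanSpace ℝ (Fin 4)) R := by
      rw [mem_ball_zero_iff]; linarith
    have m2 : x - y ∈ Metric.ball (0 : EuclideanSpace ℝ (Fin 4)) R := by
      rw [mem_ball_zero_iff]; linarith [norm_sub_le x y]
    rw [indicator_of_mem m1, indicator_of_mem m2]
    refine mul_le_mul ?_ (hM _ ⟨norm_nonneg y, by linarith⟩) (norm_nonneg _) (by positivity)
    rcases eq_or_ne (x - y) 0 with h3 | h3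
    · simp [h3]
    · rw [Real.log_div (norm_ne_zero_iff.2 hy) (norm_ne_zero_iff.2 h3)]
      exact norm_sub_le _ _

lemma norm_single_sub_sq (r : ℝ) (y : EuclideanSpace ℝ (Fin 4)) :
    ‖EuclideanSpace.single 0 r - y‖ ^ 2 = (r - (cylindrical y).1) ^ 2 + (cylindrical y).2 ^ 2 := by
  simp [cylindrical, splitFirst, EuclideanSpace.real_norm_sq_eq, Fin.sum_univ_succ]

lemma integral_log_single_mul {h : ℝ → ℝ} (hh : Continuous h)
    (hi : Integrable fun y : EuclideanSpace ℝ (Fin 4) => h ‖y‖) {r : ℝ} (hr : 0 ≤ r) :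
    ∫ y : EuclideanSpace ℝ (Fin 4),
        Real.log (‖y‖ / ‖EuclideanSpace.single 0 r - y‖) * h ‖y‖ =
      -(radialConst * ∫ s in Ioi (0 : ℝ), logKernel (r / s) * (h s * s ^ 3)) := by
  set H : ℝ × ℝ → ℝ := fun w => Real.log (√(w.1 ^ 2 + w.2 ^ 2) / √((r - w.1) ^ 2 + w.2 ^ 2)) *
    h √(w.1 ^ 2 + w.2 ^ 2) with hH
  have hm : Measurable H :=
    (Real.measurable_log.comp (by fun_prop)).mul (hh.measurable.comp (by fun_prop))
  have hHc : ∀ y : EuclideanSpace ℝ (Fin 4), H (cylindrical y) =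
      Real.log (‖y‖ / ‖EuclideanSpace.single 0 r - y‖) * h ‖y‖ := fun y => by
    simp only [hH]
    rw [sqrt_cylindrical, ← norm_single_sub_sq, Real.sqrt_sq (norm_nonneg _)]
  have key := integral_comp_cylindrical hm
    (by simpa only [hHc] using integrable_log_mul hh hi (EuclideanSpace.single 0 r))
  simp only [hHc] at key
  rw [key, radialConst, mul_assoc, ← integral_const_mul (Real.pi / 2), ← mul_neg, ← integral_neg]
  congr 1
  refine integral_congr_ae ?_
  filter_upwards [ae_restrict_mem measurableSet_Ioi,
    ae_restrict_of_ae (compl_mem_ae_iff.2 (measure_singleton r))] with s (hs : 0 < s) hsr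
  have e : ∀ θ : ℝ, s ^ 3 * Real.sin θ ^ 2 * H (s * Real.cos θ, s * Real.sin θ) =
      (s ^ 3 * h s) * (Real.sin θ ^ 2 *
        Real.log (s / √(r ^ 2 - 2 * r * s * Real.cos θ + s ^ 2))) := fun θ => by
    simp only [hH]
    rw [sqrt_polar hs.le, show (r - s * Real.cos θ) ^ 2 + (s * Real.sin θ) ^ 2 =
      r ^ 2 - 2 * r * s * Real.cos θ + s ^ 2 by nlinarith [Real.sin_sq_add_cos_sq θ]]
    ring
  simp only [e]
  rw [intervalIntegral.integral_const_mul, integral_sin_sq_mul_log_ratio hr hs (Ne.symm hsr)]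
  ring

/-- The logarithmic potential of a radial density on `ℝ⁴` as a one-dimensional integral. -/
theorem integral_log_mul {h : ℝ → ℝ} (hh : Continuous h)
    (hi : Integrable fun y : EuclideanSpace ℝ (Fin 4) => h ‖y‖) (x : EuclideanSpace ℝ (Fin 4)) :
    ∫ y, Real.log (‖y‖ / ‖x - y‖) * h ‖y‖ =
      -(radialConst * ∫ s in Ioi (0 : ℝ), logKernel (‖x‖ / s) * (h s * s ^ 3)) := by
  rw [← integral_log_single_mul hh hi (norm_nonneg x)]
  -- A reflection carrying x to the first axis preserves norms and volume, so the axial formula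
  -- suffices.
  set e : EuclideanSpace ℝ (Fin 4) := EuclideanSpace.single 0 ‖x‖ with he
  have hn : ‖x‖ = ‖e‖ := by simp [he]
  set T := (ℝ ∙ (x - e))ᗮ.reflection with hT
  have hTx : T x = e := Submodule.reflection_sub hn
  rw [← T.measurePreserving.integral_comp T.toHomeomorph.measurableEmbedding]
  refine integral_congr_ae (Eventually.of_forall fun y => ?_)
  simp only
  rw [← hTx, T.norm_map, ← T.norm_map (x - T y), map_sub, Submodule.reflection_reflection]

end LogPotential

/-! ### Passage between ℝ⁴ and the one-dimensional problem, and the conclusion. -/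

section Main

open Set Filter Topology

lemma normalConst_four_pos : 0 < normalConst 4 := by
  have h : 0 < sphereVolume 4 := by
    rw [sphereVolume, measureReal_def]
    refine ENNReal.toReal_pos ?_ (measure_ne_top _ _)
    rw [Ne, Measure.measure_univ_eq_zero]
    exact Measure.toSphere_ne_zero _
  rw [normalConst]
  positivity

/-- The constant multiplying the one-dimensional density of a radial normal solution. -/
noncomputable def densityConst : ℝ := normalConst 4 * radialConst

lemma densityConst_pos : 0 < densityConst := mul_pos normalConst_four_pos radialConst_pos

variable {p : ℝ} {U : ℝ → ℝ}

lemma powerCurvature_mul_exp (p : ℝ) (U : ℝ → ℝ) (x : EuclideanSpace ℝ (Fin 4)) :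
    powerCurvature 4 p x * Real.exp ((4 : ℕ) * U ‖x‖) =
      (fun s : ℝ => (1 + s ^ (4 * p)) * Real.exp (4 * U s)) ‖x‖ := by
  simp [powerCurvature]

lemma density_eq (κ p : ℝ) (U : ℝ → ℝ) (s : ℝ) :
    (κ + κ * s ^ (4 * p)) * Real.exp (4 * U s) * s ^ 3 =
    κ * ((1 + s ^ (4 * p)) * Real.exp (4 * U s) * s ^ 3) := by ring

lemma integrable_density_iff : Integrable (fun x : EuclideanSpace ℝ (Fin 4) =>
      powerCurvature 4 p x * Real.exp ((4 : ℕ) * U ‖x‖)) ↔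
    IntegrableOn (fun s => (densityConst + densityConst * s ^ (4 * p)) * Real.exp (4 * U s) * s ^ 3)
      (Ioi 0) := by
  simp only [powerCurvature_mul_exp, density_eq]
  rw [integrable_norm_iff (h := fun s : ℝ => (1 + s ^ (4 * p)) * Real.exp (4 * U s)),
    IntegrableOn, IntegrableOn,
    integrable_const_mul_iff (isUnit_iff_ne_zero.2 densityConst_pos.ne')]

lemma continuous_density (hp : 0 < p) (hU : Continuous U) :
    Continuous fun s : ℝ => (1 + s ^ (4 * p)) * Real.exp (4 * U s) :=
  (continuous_const.add (Real.continuous_rpow_const (by positivity))).mul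
    (Real.continuous_exp.comp (continuous_const.mul hU))

lemma totalCurvature_norm_eq (hp : 0 < p) (hU : Continuous U)
    (hi : Integrable (fun x : EuclideanSpace ℝ (Fin 4) =>
      powerCurvature 4 p x * Real.exp ((4 : ℕ) * U ‖x‖))) :
    totalCurvature 4 (powerCurvature 4 p) (fun x => U ‖x‖) =
      ∫ s in Ioi 0, (densityConst + densityConst * s ^ (4 * p)) * Real.exp (4 * U s) * s ^ 3 := by
  simp only [powerCurvature_mul_exp] at hi
  simp only [totalCurvature, powerCurvature_mul_exp, density_eq]
  rw [integral_norm_eq (continuous_density hp hU).measurable hi, integral_const_mul, densityConst,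
    mul_assoc]

/-- Radial normal solutions on `ℝ⁴` correspond to solutions of the one-dimensional integral
equation. -/
theorem isNormalSolution_norm_iff (hp : 0 < p) (hU : Continuous U) :
    IsNormalSolution 4 (powerCurvature 4 p) (fun x => U ‖x‖) ↔
      IsRadialNormal p densityConst densityConst U := by
  have key : Integrable (fun x : EuclideanSpace ℝ (Fin 4) =>
      powerCurvature 4 p x * Real.exp ((4 : ℕ) * U ‖x‖)) → ∀ x : EuclideanSpace ℝ (Fin 4),
      normalConst 4 * (∫ y : EuclideanSpace ℝ (Fin 4), Real.log (‖y‖ / ‖x - y‖) *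
        (powerCurvature 4 p y * Real.exp ((4 : ℕ) * U ‖y‖))) =
      -∫ s in Ioi 0, logKernel (‖x‖ / s) *
        ((densityConst + densityConst * s ^ (4 * p)) * Real.exp (4 * U s) * s ^ 3) := by
    intro hi x
    simp only [powerCurvature_mul_exp] at hi
    simp only [powerCurvature_mul_exp, density_eq, mul_left_comm _ densityConst]
    rw [integral_log_mul (continuous_density hp hU) hi, integral_const_mul, densityConst, mul_neg,
      mul_assoc]
  constructor
  · rintro ⟨hi, C, hC⟩
    refine ⟨hU, integrable_density_iff.1 hi, C, fun r hr => ?_⟩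
    have h := hC (EuclideanSpace.single 0 r)
    rw [key hi] at h
    simp only [PiLp.norm_single, Real.norm_of_nonneg hr] at h
    rw [h]
    ring
  · rintro ⟨-, hi, C, hC⟩
    have hi' := integrable_density_iff.2 hi
    refine ⟨hi', C, fun x => ?_⟩
    rw [key hi' x, neg_add_eq_sub]
    exact hC _ (norm_nonneg x)

lemma IsRadial.exists_eq_norm {u : EuclideanSpace ℝ (Fin 4) → ℝ} (hu : IsRadial u)
    (hc : Continuous u) : ∃ U : ℝ → ℝ, Continuous U ∧ u = fun x => U ‖x‖ := by
  refine ⟨fun r => u (r • EuclideanSpace.single 0 1), by fun_prop, funext fun x => hu _ _ ?_⟩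
  simp [norm_smul]

end Main

theorem mainTheorem6 (p : ℝ) (hp : 0 < p) (β : ℝ) :
    (∃ u : EuclideanSpace ℝ (Fin 4) → ℝ,
      ContDiff ℝ 4 u ∧
      (ContDiff ℝ ∞ (powerCurvature 4 p) → ContDiff ℝ ∞ u) ∧
      IsRadial u ∧
      IsNormalSolution 4 (powerCurvature 4 p) u ∧
      totalCurvature 4 (powerCurvature 4 p) u = β) ↔
    (max 2 (2 * p) < β ∧ β < 2 + 2 * p) := by
  constructor
  · rintro ⟨u, hu, -, hr, hn, rfl⟩
    obtain ⟨U, hU, rfl⟩ := hr.exists_eq_norm hu.continuous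
    have h := (isNormalSolution_norm_iff hp hU).1 hn
    rw [totalCurvature_norm_eq hp hU hn.1, h.integral_eq densityConst_pos.le densityConst_pos.le]
    exact h.mass_mem hp densityConst_pos densityConst_pos
  · rintro ⟨h1, h2⟩
    obtain ⟨U, h, hβ⟩ := exists_isRadialNormal hp densityConst_pos h1 h2
    have hn := (isNormalSolution_norm_iff hp h.continuous).2 h
    refine ⟨fun x => U ‖x‖, h.contDiff_four hp, fun hQ => h.contDiff_infty hp ?_,
      fun x y hxy => by simp only [hxy], hn,
      by rw [totalCurvature_norm_eq hp h.continuous hn.1, hβ]⟩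
    have hQ' := (contDiff_const (c := densityConst)).mul hQ
    simpa [powerCurvature, mul_add] using hQ'
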